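/- Let $A$ be a symmetrizable irreducible generalized Cartan matrix of size $l+1$, and let $\mathfrak h\supset\{\alpha_0^\vee,\dots,\alpha_l^\vee\}$, $\mathfrak h^*\supset\Delta=\{\alpha_0,\dots,\alpha_l\}$ be a (complex) realization of $A$. Fix an integral form $\mathfrak h_{\mathbb Z}\subset\mathfrak h$ (the $\mathbb Z$-span of a $\mathbb C$-basis of $\mathfrak h$) that contains every $\alpha_i^\vee$, such that $\mathfrak h_{\mathbb Z}^*:=\mathrm{Hom}(\mathfrak h_{\mathbb Z},\mathbb Z)\subset\mathfrak h^*$ contains $\Delta$ and $\mathfrak h_{\mathbb Z}/\bigoplus_i\mathbb Z\alpha_i^\vee$ is torsion free. Put $\mathfrak h_{\mathbb Q}^*=\mathfrak h_{\mathbb Z}^*\otimes\mathbb Q\subset\mathfrak h^*$, $P_{+,\mathbb Q}=\{\lambda\in\mathfrak h_{\mathbb Q}^*:\langle\alpha_i^\vee,\lambda\rangle\ge 0\ \ \forall i\}$ and $P_+=\mathfrak h_{\mathbb Z}^*\cap P_{+,\mathbb Q}$. Let $\mathfrak g=\mathfrak g(A)$ be the associated Kac--Moody Lie algebra with Cartan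 subalgebra $\mathfrak h$, and for $\lambda\in P_+$ let $L(\lambda)$ be the irreducible integrable highest weight $\mathfrak g$-module with highest weight $\lambda$. The tensor cone of $\mathfrak g$ is $$\Gamma(\mathfrak g)=\{(\lambda_1,\lambda_2,\mu)\in P_{+,\mathbb Q}^3:\ \exists N\ge 1 \text{ with } N\lambda_1,N\lambda_2,N\mu\in P_+ \text{ and } L(N\mu)\subset L(N\lambda_1)\otimes L(N\lambda_2)\},$$ where $\subset$ means being isomorphic to a $\mathfrak g$-submodule. Let $E$ be the rational vector space $$E=\{(\lambda_1,\lambda_2,\mu)\in(\mathfrak h_{\mathbb Q}^*)^3:\ \lambda_1+\lambda_2-\mu\in\mathrm{Span}_{\mathbb Q}(\Delta)\}.$$ Then $\Gamma(\mathfrak g)\subset E$, and $\Gamma(\mathfrak g)$ has nonempty interior in $E$ (for the topology of $E\cong\mathbb Q^d$ given by any basis). In particular $\Gamma(\mathfrak g)$ spans $E$ over $\mathbb Q$, and both $E$ and the $\mathbb Q$-span of $\Gamma(\mathfrak g)$ have dimension $2\dim_{\mathbb C}\mathfrak h+\#\Delta$. -/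

import Mathlib

namespace KacMoody

open scoped TensorProduct

noncomputable section

/-! ### Generalized Cartan matrices -/

section Matrices

variable {ι : Type*}

/-- `A` is a generalized Cartan matrix. -/
structure IsGCM (A : Matrix ι ι ℤ) : Prop where
  diag : ∀ i, A i i = 2
  nonpos : ∀ i j, i ≠ j → A i j ≤ 0
  zero_symm : ∀ i j, A i j = 0 → A j i = 0

/-- `A` is symmetrizable: `D * A` is symmetric for some diagonal matrix `D` with positive
rational entries. -/
def IsSymmetrizable [Fintype ι] [DecidableEq ι] (A : Matrix ι ι ℤ) : Prop :=
  ∃ d : ι → ℚ, (∀ i, 0 < d i) ∧ (Matrix.diagonal d * A.map (Int.cast : ℤ → ℚ)).IsSymm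

/-- `A` is irreducible (indecomposable): the index set is not a disjoint union of two nonempty
subsets `S`, `T` with `A i j = 0` for all `i ∈ S`, `j ∈ T`. -/
def IsIndecomposable (A : Matrix ι ι ℤ) : Prop :=
  ∀ S : Set ι, S.Nonempty → (∀ i ∈ S, ∀ j ∉ S, A i j = 0) → S = Set.univ

end Matrices

variable {ι : Type*} [Fintype ι] [DecidableEq ι] {A : Matrix ι ι ℤ}
  {H : Type*} [AddCommGroup H] [Module ℂ H]

/-- A realization of `A` on the complex vector space `H` (the Cartan subalgebra `𝔥`): linearly
independent simple coroots in `H` and simple roots in `H^*` with `⟨α_i^∨, α_j⟩ = a_ij`, where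
`dim H = 2 n - rank A` for the size `n` of `A`. -/
structure Realization (A : Matrix ι ι ℤ) (H : Type*) [AddCommGroup H] [Module ℂ H] where
  coroot : ι → H
  root : ι → Module.Dual ℂ H
  linearIndependent_coroot : LinearIndependent ℂ coroot
  linearIndependent_root : LinearIndependent ℂ root
  root_coroot : ∀ i j, root j (coroot i) = (A i j : ℂ)
  finrank_add_rank :
    Module.finrank ℂ H + (A.map (Int.cast : ℤ → ℂ)).rank = 2 * Fintype.card ι

/-- The set `Δ` of simple roots. -/
def Realization.simpleRoots (R : Realization A H) : Set (Module.Dual ℂ H) := Set.range R.root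

/-- An integral form `𝔥_ℤ` of `H`: the `ℤ`-span of a `ℂ`-basis, which contains the simple coroots,
on which the simple roots are integral, and such that `𝔥_ℤ / ⊕ ℤ α_i^∨` is torsion free. -/
structure IntegralForm (R : Realization A H) where
  lattice : Submodule ℤ H
  exists_basis : ∃ b : Module.Basis (Fin (Module.finrank ℂ H)) ℂ H,
    lattice = Submodule.span ℤ (Set.range b)
  coroot_mem : ∀ i, R.coroot i ∈ lattice
  root_integral : ∀ i, ∀ x ∈ lattice, ∃ m : ℤ, R.root i x = m
  torsion_free : ∀ (k : ℤ), ∀ x ∈ lattice, k ≠ 0 →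
    k • x ∈ Submodule.span ℤ (Set.range R.coroot) → x ∈ Submodule.span ℤ (Set.range R.coroot)

/-! ### The Kac-Moody Lie algebra -/

/-- Generators: the elements of `H` and the Chevalley generators `e_i`, `f_i`. -/
inductive Generators (ι H : Type*)
  | h : H → Generators ι H
  | e : ι → Generators ι H
  | f : ι → Generators ι H

section Algebra

variable (R : Realization A H)

/-- The free Lie algebra on the generators. -/
abbrev FreeLie (ι H : Type*) : Type _ := FreeLieAlgebra ℂ (Generators ι H)

/-- The free generator attached to `x ∈ 𝔥`. -/
abbrev freeH (ι : Type*) {H : Type*} (x : H) : FreeLie ι H := FreeLieAlgebra.of ℂ (Generators.h x)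

/-- The free generator `e_i`. -/
abbrev freeE (H : Type*) {ι : Type*} (i : ι) : FreeLie ι H := FreeLieAlgebra.of ℂ (Generators.e i)

/-- The free generator `f_i`. -/
abbrev freeF (H : Type*) {ι : Type*} (i : ι) : FreeLie ι H := FreeLieAlgebra.of ℂ (Generators.f i)

/-- The defining relators of `𝔤(A)` inside the free Lie algebra on the generators. -/
inductive Relator : FreeLie ι H → Prop
  | add (x y : H) : Relator (freeH ι (x + y) - (freeH ι x + freeH ι y))
  | smul (c : ℂ) (x : H) : Relator (freeH ι (c • x) - c • freeH ι x)
  | hh (x y : H) : Relator ⁅freeH ι x, freeH ι y⁆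
  | he (x : H) (i : ι) : Relator (⁅freeH ι x, freeE H i⁆ - R.root i x • freeE H i)
  | hf (x : H) (i : ι) : Relator (⁅freeH ι x, freeF H i⁆ + R.root i x • freeF H i)
  | ef_same (i : ι) : Relator (⁅freeE H i, freeF H i⁆ - freeH ι (R.coroot i))
  | ef_ne (i j : ι) (hij : i ≠ j) : Relator ⁅freeE H i, freeF H j⁆
  | serre_e (i j : ι) (hij : i ≠ j) :
      Relator (((LieAlgebra.ad ℂ (FreeLie ι H) (freeE H i)) ^ (1 - A i j).toNat) (freeE H j))
  | serre_f (i j : ι) (hij : i ≠ j) :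
      Relator (((LieAlgebra.ad ℂ (FreeLie ι H) (freeF H i)) ^ (1 - A i j).toNat) (freeF H j))

/-- The ideal generated by the defining relators. -/
def relatorIdeal : LieIdeal ℂ (FreeLie ι H) :=
  LieSubmodule.lieSpan ℂ (FreeLie ι H) {x | Relator R x}

/-- The Kac-Moody Lie algebra `𝔤 = 𝔤(A)`, with Cartan subalgebra (the image of) `H`. -/
def KMAlgebra : Type _ := FreeLie ι H ⧸ relatorIdeal R

instance : LieRing (KMAlgebra R) :=
  inferInstanceAs (LieRing (FreeLie ι H ⧸ relatorIdeal R))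

instance : LieAlgebra ℂ (KMAlgebra R) :=
  inferInstanceAs (LieAlgebra ℂ (FreeLie ι H ⧸ relatorIdeal R))

/-- The image of a generator in `𝔤`. -/
def gen (x : Generators ι H) : KMAlgebra R :=
  LieSubmodule.Quotient.mk (N := relatorIdeal R) (FreeLieAlgebra.of ℂ x)

/-! ### Highest weight modules -/

/-- The universal enveloping algebra `U(𝔤)`. -/
abbrev Env : Type _ := UniversalEnvelopingAlgebra ℂ (KMAlgebra R)

/-- The left ideal of `U(𝔤)` generated by the `e_i` and by `x - ⟨wt, x⟩` for `x ∈ 𝔥`. -/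
def vermaIdeal (wt : Module.Dual ℂ H) : Submodule (Env R) (Env R) :=
  Submodule.span (Env R)
    (Set.range (fun i : ι => UniversalEnvelopingAlgebra.ι ℂ (gen R (.e i))) ∪
     Set.range (fun x : H => UniversalEnvelopingAlgebra.ι ℂ (gen R (.h x)) -
        algebraMap ℂ (Env R) (wt x)))

/-- The Verma module `M(wt)`. -/
abbrev Verma (wt : Module.Dual ℂ H) : Type _ := Env R ⧸ vermaIdeal R wt

/-- The largest proper submodule of `M(wt)`: the sum of all proper submodules. -/
def vermaRadical (wt : Module.Dual ℂ H) : Submodule (Env R) (Verma R wt) :=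
  sSup {N | N ≠ ⊤}

/-- The irreducible highest weight module `L(wt)`. -/
def IrrModule (wt : Module.Dual ℂ H) : Type _ := Verma R wt ⧸ vermaRadical R wt

variable (wt : Module.Dual ℂ H)

instance : AddCommGroup (IrrModule R wt) :=
  inferInstanceAs (AddCommGroup (Verma R wt ⧸ vermaRadical R wt))

instance : Module (Env R) (IrrModule R wt) :=
  inferInstanceAs (Module (Env R) (Verma R wt ⧸ vermaRadical R wt))

instance : Module ℂ (IrrModule R wt) :=
  inferInstanceAs (Module ℂ (Verma R wt ⧸ vermaRadical R wt))

instance : IsScalarTower ℂ (Env R) (IrrModule R wt) :=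
  inferInstanceAs (IsScalarTower ℂ (Env R) (Verma R wt ⧸ vermaRadical R wt))

/-- `𝔤` acts on `L(wt)` through `U(𝔤)`. -/
instance : LieRingModule (KMAlgebra R) (IrrModule R wt) where
  bracket x m := UniversalEnvelopingAlgebra.ι ℂ x • m
  add_lie x y m := by
    change UniversalEnvelopingAlgebra.ι ℂ (x + y) • m = _ • m + _ • m
    rw [map_add, add_smul]
  lie_add x m n := smul_add _ m n
  leibniz_lie x y m := by
    change UniversalEnvelopingAlgebra.ι ℂ x • UniversalEnvelopingAlgebra.ι ℂ y • m =
      UniversalEnvelopingAlgebra.ι ℂ ⁅x, y⁆ • m +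
        UniversalEnvelopingAlgebra.ι ℂ y • UniversalEnvelopingAlgebra.ι ℂ x • m
    let _ : LieRing (Env R) := LieRing.ofAssociativeRing
    rw [LieHom.map_lie, LieRing.of_associative_ring_bracket, sub_smul, mul_smul, mul_smul,
      sub_add_cancel]

instance : LieModule ℂ (KMAlgebra R) (IrrModule R wt) where
  smul_lie c x m := by
    change UniversalEnvelopingAlgebra.ι ℂ (c • x) • m =
      c • (UniversalEnvelopingAlgebra.ι ℂ x • m)
    rw [map_smul, smul_assoc]
  lie_smul c x m := by
    change UniversalEnvelopingAlgebra.ι ℂ x • (c • m) =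
      c • (UniversalEnvelopingAlgebra.ι ℂ x • m)
    rw [← algebraMap_smul (Env R) c m, smul_smul, ← Algebra.commutes, mul_smul,
      algebraMap_smul]

/-- `L(ν)` is isomorphic to a `𝔤`-submodule of `L(wt₁) ⊗ L(wt₂)`. -/
def OccursInTensor (wt₁ wt₂ ν : Module.Dual ℂ H) : Prop :=
  ∃ φ : IrrModule R ν →ₗ⁅ℂ, KMAlgebra R⁆ (IrrModule R wt₁ ⊗[ℂ] IrrModule R wt₂),
    Function.Injective φ

end Algebra

/-! ### Weights and the tensor cone -/

section Cone

variable {R : Realization A H} (Z : IntegralForm R)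

/-- `𝔥_ℤ^* = Hom(𝔥_ℤ, ℤ)`, as the group of linear forms on `H` that are integral on `𝔥_ℤ`. -/
def weightLattice : AddSubgroup (Module.Dual ℂ H) where
  carrier := {wt | ∀ x ∈ Z.lattice, ∃ m : ℤ, wt x = m}
  zero_mem' := fun x _ => ⟨0, by simp⟩
  add_mem' := by
    intro a b ha hb x hx
    obtain ⟨m, hm⟩ := ha x hx
    obtain ⟨n, hn⟩ := hb x hx
    exact ⟨m + n, by simp [hm, hn]⟩
  neg_mem' := by
    intro a ha x hx
    obtain ⟨m, hm⟩ := ha x hx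
    exact ⟨-m, by simp [hm]⟩

/-- `𝔥_ℚ^* = 𝔥_ℤ^* ⊗ ℚ`, inside `𝔥^*`. -/
def rationalWeights : Submodule ℚ (Module.Dual ℂ H) :=
  Submodule.span ℚ (weightLattice Z : Set (Module.Dual ℂ H))

/-- `P_{+,ℚ}`: the rational weights with nonnegative values on all simple coroots. -/
def rationalDominant : Set (Module.Dual ℂ H) :=
  {wt | wt ∈ rationalWeights Z ∧ ∀ i, ∃ q : ℚ, 0 ≤ q ∧ wt (R.coroot i) = q}

/-- `P_+`: the dominant integral weights. -/
def dominantIntegral : Set (Module.Dual ℂ H) :=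
  {wt | wt ∈ weightLattice Z ∧ wt ∈ rationalDominant Z}

/-- The rational vector space `(𝔥_ℚ^*)^3`. -/
abbrev Triple : Type _ := rationalWeights Z × rationalWeights Z × rationalWeights Z

/-- The tensor cone `Γ(𝔤)`: the triples `(λ₁, λ₂, μ)` in `P_{+,ℚ}^3` such that for some `N ≥ 1`
the weights `Nλ₁`, `Nλ₂`, `Nμ` are in `P_+` and `L(Nμ) ⊂ L(Nλ₁) ⊗ L(Nλ₂)`. -/
def tensorCone : Set (Triple Z) :=
  {p | (p.1 : Module.Dual ℂ H) ∈ rationalDominant Z ∧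
       (p.2.1 : Module.Dual ℂ H) ∈ rationalDominant Z ∧
       (p.2.2 : Module.Dual ℂ H) ∈ rationalDominant Z ∧
       ∃ N : ℕ, 1 ≤ N ∧
         N • (p.1 : Module.Dual ℂ H) ∈ dominantIntegral Z ∧
         N • (p.2.1 : Module.Dual ℂ H) ∈ dominantIntegral Z ∧
         N • (p.2.2 : Module.Dual ℂ H) ∈ dominantIntegral Z ∧
         OccursInTensor R (N • (p.1 : Module.Dual ℂ H)) (N • (p.2.1 : Module.Dual ℂ H))
           (N • (p.2.2 : Module.Dual ℂ H))}

/-- The rational vector space `E` of all `(λ₁, λ₂, μ)` in `(𝔥_ℚ^*)^3` with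
`λ₁ + λ₂ - μ ∈ Span_ℚ(Δ)`. -/
def spanE : Submodule ℚ (Triple Z) where
  carrier := {p | (p.1 : Module.Dual ℂ H) + (p.2.1 : Module.Dual ℂ H) -
    (p.2.2 : Module.Dual ℂ H) ∈ Submodule.span ℚ R.simpleRoots}
  zero_mem' := by simp
  add_mem' := by
    intro a b ha hb
    have := Submodule.add_mem (Submodule.span ℚ R.simpleRoots) ha hb
    simp only [Set.mem_ofPred_eq, Prod.fst_add, Prod.snd_add, Submodule.coe_add]
    convert this using 1
    abel
  smul_mem' := by
    intro c a ha
    have := Submodule.smul_mem (Submodule.span ℚ R.simpleRoots) c ha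
    simp only [Set.mem_ofPred_eq, Prod.smul_fst, Prod.smul_snd, Submodule.coe_smul]
    rwa [smul_sub, smul_add] at this

/-- The subset `S ∩ V` has nonempty interior in the finite dimensional rational vector space `V`,
for the canonical topology of `V`, i.e. the topology of `ℚ^d` carried over by any basis
of `V` (which is the module topology). -/
def HasNonemptyInteriorIn {M : Type*} [AddCommGroup M] [Module ℚ M] (S : Set M)
    (V : Submodule ℚ M) : Prop :=
  (@interior V (moduleTopology ℚ V) {x : V | (x : M) ∈ S}).Nonempty

end Cone

end

end KacMoody

/-! Every weight of `L(λ₁) ⊗ L(λ₂)` lies below `λ₁ + λ₂` by a sum of simple roots with natural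
coefficients, which gives `Γ ⊂ E`. For the interior, the key fact is `occursInTensor_of_le`: if `λ₁,
λ₂` are dominant integral and `β = ∑ β_i α_i` satisfies `0 ≤ β_i ≤ ⟨α_i^∨, λ₁⟩` and `β_i ≤ ⟨α_i^∨,
λ₂⟩` for all `i`, then `L(λ₁ + λ₂ - β)` occurs in `L(λ₁) ⊗ L(λ₂)`. After clearing denominators these
are finitely many rational linear inequalities on `E` which hold strictly at some point, so `Γ`
contains a nonempty open subset of `E`. An open set spans, and `E` has coordinates `λ₁`, `λ₂`, `λ₁ +
λ₂ - μ`, hence the dimension.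

The tool is the Casimir operator. It is built without an invariant form on `𝔤(A)`: on formal
right-normed brackets there is a form for which bracketing with the letter `i` is minus the adjoint
of `[f_i, ·]`, and symmetrizability makes it symmetric. Its radical contains the Serre relators and
acts by zero on irreducible highest weight modules (`radTrivial_of_irreducible`). Dual bases modulo
the radical give the operator `∑ f_s e_s`, truncated by word length. Its commutators with `e_i` and
`f_i` telescope to explicit terms, so it has known eigenvalues (`casimirValue`) on vectors reached
from singular ones. These eigenvalues are shown to be nonzero by positivity of each summand.

A singular vector of weight `λ₁ + λ₂ - β` is found first in `V ⊗ L(λ₂)`, where `V` is the universal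
highest weight module killed by the radical. The `f`-coinvariants of `V ⊗ N` are `N`, and the
Casimir operator has image in the part killed by coinvariants. Taking `x ≠ 0` in `L(λ₂)` of weight
`λ₂ - β`, the vector `v ⊗ x` is therefore not in this image. So the operator is not surjective on a
finite dimensional weight space, hence not injective. A kernel vector must be singular: otherwise
raising it as far as possible gives a singular vector, killed by the operator, whose eigenvalue is
nonzero (`exists_singular_radVerma`).

The kernel of `V → L(λ₁)` has no nonzero vector of depth at most `β`, again by the Casimir
eigenvalue, so the singular vector survives in `L(λ₁) ⊗ L(λ₂)` (`exists_singular_tensor`).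
Integrability of the tensor product makes all singular weights dominant, and one more use of the
eigenvalue shows that the singular vector generates a copy of `L(λ₁ + λ₂ - β)`
(`highest_mem_of_stable`, `exists_irrModule_envLinearMap`). -/

namespace KacMoody

open scoped TensorProduct

noncomputable section

set_option linter.unusedSectionVars false

attribute [local instance 100] LieRing.ofAssociativeRing

section

/-! ### Words and the contravariant pairing on them -/

/-- Formal combinations of right-normed brackets: the word `([i₁, …, iₙ], k)` stands for
`[x_{i₁}, [x_{i₂}, … [x_{iₙ}, x_k]]]`. -/
abbrev WordSpace (ι : Type*) : Type _ := (List ι × ι) →₀ ℂ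

section Words

variable {ι : Type*}

/-- Bracketing with the letter `i` on the left. -/
def consWord (i : ι) : WordSpace ι →ₗ[ℂ] WordSpace ι :=
  Finsupp.lmapDomain ℂ ℂ (fun w => (i :: w.1, w.2))

/-- The sum of the values of `g` on the letters of a word. -/
def wordSum (g : ι → ℂ) (w : List ι × ι) : ℂ := (w.1.map g).sum + g w.2

/-- The diagonal operator multiplying each word by the sum of the values of `g` on its letters. -/
def wordWeight (g : ι → ℂ) : WordSpace ι →ₗ[ℂ] WordSpace ι :=
  Finsupp.linearCombination ℂ (fun w => Finsupp.single w (wordSum g w))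

@[simp] lemma consWord_single (i : ι) (w : List ι × ι) (c : ℂ) :
    consWord i (Finsupp.single w c) = Finsupp.single (i :: w.1, w.2) c := by
  simp [consWord, Finsupp.mapDomain_single]

lemma consWord_apply_nil (i k : ι) (x : WordSpace ι) : consWord i x ([], k) = 0 := by
  classical
  induction x using Finsupp.induction_linear with
  | zero => simp
  | add x y hx hy => simp [hx, hy]
  | single w c => simp

@[simp] lemma wordSum_cons (g : ι → ℂ) (i : ι) (w : List ι × ι) :
    wordSum g (i :: w.1, w.2) = g i + wordSum g w := by
  simp [wordSum, add_assoc]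

@[simp] lemma wordWeight_single (g : ι → ℂ) (w : List ι × ι) (c : ℂ) :
    wordWeight g (Finsupp.single w c) = Finsupp.single w (wordSum g w * c) := by
  simp [wordWeight, mul_comm]

lemma wordWeight_consWord (g : ι → ℂ) (i : ι) (x : WordSpace ι) :
    wordWeight g (consWord i x) = consWord i (wordWeight g x) + g i • consWord i x := by
  induction x using Finsupp.induction_linear with
  | zero => simp
  | add x y hx hy => simp only [map_add, hx, hy, smul_add]; abel
  | single w c =>
    rw [consWord_single, wordWeight_single, wordSum_cons, wordWeight_single, consWord_single,
      Finsupp.smul_single, ← Finsupp.single_add, smul_eq_mul, add_mul, add_comm]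

/-- Words of prefix length `N`. -/
def wordsOfLength (ι : Type*) (N : ℕ) : Submodule ℂ (WordSpace ι) :=
  Finsupp.supported ℂ ℂ {w | w.1.length = N}

lemma single_mem_wordsOfLength (w : List ι × ι) (c : ℂ) :
    Finsupp.single w c ∈ wordsOfLength ι w.1.length :=
  Finsupp.single_mem_supported ℂ c rfl

lemma wordsOfLength_induction {N : ℕ} {p : WordSpace ι → Prop} (h0 : p 0)
    (hadd : ∀ x y, p x → p y → p (x + y))
    (hs : ∀ w : List ι × ι, w.1.length = N → ∀ c, p (Finsupp.single w c)) {x : WordSpace ι}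
    (hx : x ∈ wordsOfLength ι N) : p x := by
  classical
  rw [← Finsupp.sum_single x]
  refine Finset.sum_induction _ p hadd h0 fun w hw => hs w ?_ _
  exact (Finsupp.mem_supported ℂ x).1 hx hw

lemma consWord_mem {N : ℕ} {x : WordSpace ι} (hx : x ∈ wordsOfLength ι N) (i : ι) :
    consWord i x ∈ wordsOfLength ι (N + 1) := by
  refine wordsOfLength_induction (p := fun x => consWord i x ∈ wordsOfLength ι (N + 1))
    (by simp) (fun x y hx hy => by rw [map_add]; exact add_mem hx hy) ?_ hx
  rintro w rfl c
  rw [consWord_single]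
  exact single_mem_wordsOfLength _ _

lemma wordWeight_mem {N : ℕ} {x : WordSpace ι} (hx : x ∈ wordsOfLength ι N) (g : ι → ℂ) :
    wordWeight g x ∈ wordsOfLength ι N := by
  refine wordsOfLength_induction (p := fun x => wordWeight g x ∈ wordsOfLength ι N)
    (by simp) (fun x y hx hy => by rw [map_add]; exact add_mem hx hy) ?_ hx
  rintro w rfl c
  rw [wordWeight_single]
  exact single_mem_wordsOfLength _ _

instance [Finite ι] (N : ℕ) : FiniteDimensional ℂ (wordsOfLength ι N) := by
  have : Finite {w : List ι × ι | w.1.length = N} := by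
    have h := (List.finite_length_eq ι N).prod (Set.finite_univ (α := ι))
    exact (h.subset fun w hw => ⟨hw, trivial⟩).to_subtype
  exact Module.Finite.equiv (Finsupp.supportedEquivFinsupp (M := ℂ) (R := ℂ)
    {w : List ι × ι | w.1.length = N}).symm

/-! ### The operators on words that model `[f_j, ·]`. -/

variable [DecidableEq ι] (A : Matrix ι ι ℤ)

/-- The bracket of a word in the `e`'s with `f_j`, expressed in words
(see `WeakRep.lie_f_E`). -/
def derWord (j : ι) : List ι → ι → WordSpace ι
  | [], _ => 0
  | i :: w, k => (if i = j then
        -Finsupp.single (w, k) (wordSum (fun p => (A j p : ℂ)) (w, k)) else 0) +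
      consWord i (derWord j w k) +
      (if w = [] ∧ k = j then Finsupp.single ([], i) (A j i : ℂ) else 0)

/-- The linear extension of `derWord`. -/
def der (j : ι) : WordSpace ι →ₗ[ℂ] WordSpace ι :=
  Finsupp.linearCombination ℂ (fun w => derWord A j w.1 w.2)

lemma der_single (j : ι) (w : List ι × ι) (c : ℂ) :
    der A j (Finsupp.single w c) = c • derWord A j w.1 w.2 := by
  simp [der]

lemma der_single_nil (j k : ι) (c : ℂ) : der A j (Finsupp.single ([], k) c) = 0 := by
  simp [der_single, derWord]

/-- Leibniz rule for `[f_j, [e_i, X]]`. The bracket `[f_j, e_i] = -δ_ij α_j^∨` multiplies `X` by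
minus its weight. The last term is the bracket of `e_i` with the Cartan component of `[f_j, X]`, a
component that `der` itself does not record. -/
lemma der_consWord (j i : ι) (x : WordSpace ι) :
    der A j (consWord i x) =
      (if i = j then -wordWeight (fun p => (A j p : ℂ)) x else 0) + consWord i (der A j x) +
        (A j i * x ([], j)) • Finsupp.single ([], i) 1 := by
  induction x using Finsupp.induction_linear with
  | zero => simp
  | add x y hx hy =>
    simp only [map_add, hx, hy, Finsupp.add_apply, mul_add, add_smul]
    split_ifs
    · rw [neg_add]; abel
    · abel
  | single w c =>
    obtain ⟨w, k⟩ := w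
    rw [consWord_single, der_single, der_single, derWord, smul_add, smul_add, map_smul]
    congr 1
    · congr 1
      split_ifs
      · simp [mul_comm]
      · simp
    · by_cases h : w = [] ∧ k = j
      · obtain ⟨rfl, rfl⟩ := h
        simp [mul_comm]
      · rw [if_neg h, Finsupp.single_apply, if_neg]
        · simp
        · simpa using h

omit [DecidableEq ι] in
lemma word_induction {p : WordSpace ι → Prop} (h0 : p 0)
    (hadd : ∀ x y, p x → p y → p (x + y)) (hnil : ∀ k c, p (Finsupp.single ([], k) c))
    (hcons : ∀ i x, p x → p (consWord i x)) (x : WordSpace ι) : p x := by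
  induction x using Finsupp.induction_linear with
  | zero => exact h0
  | add x y hx hy => exact hadd x y hx hy
  | single w c =>
    obtain ⟨w, k⟩ := w
    induction w with
    | nil => exact hnil k c
    | cons i w ih => simpa using hcons i _ ih

omit [DecidableEq ι] in
lemma wordWeight_comm (g g' : ι → ℂ) (x : WordSpace ι) :
    wordWeight g (wordWeight g' x) = wordWeight g' (wordWeight g x) := by
  induction x using Finsupp.induction_linear with
  | zero => simp
  | add x y hx hy => simp only [map_add, hx, hy]
  | single w c => simp only [wordWeight_single, mul_left_comm]

omit [DecidableEq ι] in
lemma wordWeight_apply_nil (g : ι → ℂ) (k : ι) (x : WordSpace ι) :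
    wordWeight g x ([], k) = g k * x ([], k) := by
  induction x using Finsupp.induction_linear with
  | zero => simp
  | add x y hx hy => simp [hx, hy, mul_add]
  | single w c =>
    rw [wordWeight_single]
    by_cases h : w = ([], k)
    · simp [h, wordSum]
    · simp [Finsupp.single_eq_of_ne (Ne.symm h)]

/-- Bracketing with `f_j` deletes one letter `j`, so letter sums drop by `g j`. -/
lemma wordWeight_der (g : ι → ℂ) (j : ι) (x : WordSpace ι) :
    wordWeight g (der A j x) = der A j (wordWeight g x) - g j • der A j x := by
  induction x using word_induction with
  | h0 => simp
  | hadd x y hx hy => simp only [map_add, hx, hy, smul_add]; abel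
  | hnil k c => simp only [wordWeight_single, der_single_nil, map_zero, smul_zero, sub_zero]
  | hcons i x ih =>
    simp only [wordWeight_consWord, map_add, map_smul, der_consWord, ih, wordWeight_apply_nil,
      map_sub, wordWeight_single]
    have hg : Finsupp.single (([] : List ι), i) (g i * 1) = g i • Finsupp.single (([] : List ι), i) 1 := by
      simp
    simp only [smul_add, smul_smul, apply_ite (wordWeight g), map_neg, map_zero,
      wordWeight_comm g]
    split_ifs with h
    · subst h
      simp only [wordSum, List.map_nil, List.sum_nil, zero_add, hg]
      module
    · simp only [wordSum, List.map_nil, List.sum_nil, zero_add, hg]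
      module

lemma derWord_mem (j : ι) (w : List ι) (k : ι) :
    derWord A j w k ∈ wordsOfLength ι (w.length - 1) := by
  induction w with
  | nil => simp [derWord]
  | cons i w ih =>
    rw [derWord]
    refine add_mem (add_mem ?_ ?_) ?_
    · split_ifs
      · exact neg_mem (single_mem_wordsOfLength _ _)
      · exact zero_mem _
    -- For `w = []` the inner `derWord` is zero, which matters because the subtraction in the length
    -- is truncated and the induction hypothesis cannot be shifted by one.
    · cases w with
      | nil => simp [derWord]
      | cons i' w' => exact consWord_mem ih i
    · split_ifs with h
      · rw [h.1]; exact single_mem_wordsOfLength _ _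
      · exact zero_mem _

lemma der_mem {N : ℕ} {x : WordSpace ι} (hx : x ∈ wordsOfLength ι (N + 1)) (j : ι) :
    der A j x ∈ wordsOfLength ι N := by
  refine wordsOfLength_induction (p := fun x => der A j x ∈ wordsOfLength ι N)
    (by simp) (fun x y hx hy => by rw [map_add]; exact add_mem hx hy) ?_ hx
  rintro w hw c
  rw [der_single]
  refine Submodule.smul_mem _ _ ?_
  simpa [hw] using derWord_mem A j w.1 w.2

/-! ### The bilinear form on words and its symmetry. -/

variable (d : ι → ℝ)

/-- The pairing with a word. -/
def pairWord : List ι → ι → (WordSpace ι →ₗ[ℂ] ℂ)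
  -- This is the normalization `(e_k | f_k) = 1 / d_k`; with it the symmetry of the form on
  -- two-letter words amounts to `d i * A i j = d j * A j i`.
  | [], k => ((d k : ℂ)⁻¹) • Finsupp.lapply ([], k)
  | i :: w, k => -(pairWord w k) ∘ₗ der A i

/-- The bilinear form on words for which bracketing with a letter `i` is minus the
adjoint of `der i`. -/
def pairing : WordSpace ι →ₗ[ℂ] WordSpace ι →ₗ[ℂ] ℂ :=
  (Finsupp.linearCombination ℂ (fun w : List ι × ι => pairWord A d w.1 w.2)).flip

lemma pairing_single_nil (x : WordSpace ι) (k : ι) (c : ℂ) :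
    pairing A d x (Finsupp.single ([], k) c) = c * ((d k : ℂ)⁻¹ * x ([], k)) := by
  simp [pairing, pairWord]

lemma pairing_consWord (x y : WordSpace ι) (i : ι) :
    pairing A d x (consWord i y) = -pairing A d (der A i x) y := by
  induction y using Finsupp.induction_linear with
  | zero => simp
  | add y z hy hz => simp only [map_add, hy, hz]; ring
  | single w c => simp [pairing, pairWord]

lemma pairing_nil_left (y : WordSpace ι) (k : ι) (c : ℂ) :
    pairing A d (Finsupp.single ([], k) c) y = c * ((d k : ℂ)⁻¹ * y ([], k)) := by
  induction y using word_induction with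
  | h0 => simp
  | hadd x y hx hy => simp [hx, hy, mul_add]
  | hnil k' c' =>
    rw [pairing_single_nil]
    by_cases h : k = k'
    · subst h; simp; ring
    · rw [Finsupp.single_eq_of_ne (by simpa using Ne.symm h), Finsupp.single_eq_of_ne (by simpa using h)]
      simp
  | hcons i x ih => simp [pairing_consWord, der_single_nil, consWord_apply_nil]

/-- Moving a letter `i` from `y` across the form changes both letter sums by `g i`, so the diagonal
operators are self-adjoint; words of different weights are then orthogonal. -/
lemma pairing_wordWeight (g : ι → ℂ) (x y : WordSpace ι) :
    pairing A d (wordWeight g x) y = pairing A d x (wordWeight g y) := by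
  induction y using word_induction generalizing x with
  | h0 => simp
  | hadd y z hy hz => simp only [map_add, hy, hz]
  | hnil k c =>
    rw [wordWeight_single, pairing_single_nil, pairing_single_nil, wordWeight_apply_nil]
    simp only [wordSum, List.map_nil, List.sum_nil, zero_add]; ring
  | hcons i y ih =>
    rw [pairing_consWord, wordWeight_consWord, map_add, map_smul, pairing_consWord,
      pairing_consWord, ← ih, wordWeight_der]
    simp only [map_sub, map_smul, LinearMap.sub_apply, LinearMap.smul_apply, smul_eq_mul]
    ring

variable {A d} (hd : ∀ i, 0 < d i) (hs : ∀ i j, d i * A i j = d j * A j i)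
include hd hs

/-- The adjunction in the second variable holds by definition of the form; this is the opposite one.
Expanding `der` on both sides leaves a diagonal term, settled by self-adjointness of weights, and a
boundary term on single letters, which is where symmetrizability enters. -/
lemma pairing_der (x y : WordSpace ι) (j : ι) :
    pairing A d x (der A j y) = -pairing A d (consWord j x) y := by
  induction y using word_induction generalizing x with
  | h0 => simp
  | hadd y z hy hz => simp only [map_add, hy, hz]; ring
  | hnil k c => simp [der_single_nil, pairing_single_nil, consWord_apply_nil]
  | hcons i y ih =>
    rw [pairing_consWord, neg_neg, der_consWord, der_consWord]
    simp only [map_add, map_smul, LinearMap.add_apply, LinearMap.smul_apply, pairing_single_nil,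
      pairing_consWord, pairing_nil_left, ih, neg_neg]
    have h1 : (A j i * y ([], j)) • (1 * ((d i : ℂ)⁻¹ * x ([], i))) =
        (A i j * x ([], i)) • (1 * ((d j : ℂ)⁻¹ * y ([], j))) := by
      have h2 : (d i : ℂ) * A i j = d j * A j i := by exact_mod_cast hs i j
      have h3 : (d i : ℂ) ≠ 0 := by exact_mod_cast (hd i).ne'
      have h4 : (d j : ℂ) ≠ 0 := by exact_mod_cast (hd j).ne'
      simp only [smul_eq_mul]
      field_simp
      linear_combination -(y ([], j) * x ([], i)) * h2
    rw [h1]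
    congr 2
    by_cases h : i = j
    · subst h
      simp [pairing_wordWeight]
    · rw [if_neg h, if_neg (Ne.symm h)]
      simp

lemma pairing_symm (x y : WordSpace ι) : pairing A d x y = pairing A d y x := by
  induction y using word_induction generalizing x with
  | h0 => simp
  | hadd y z hy hz => simp [hy, hz]
  | hnil k c => rw [pairing_single_nil, pairing_nil_left]
  | hcons i y ih =>
    rw [pairing_consWord, ih, pairing_der hd hs, neg_neg]

/-! ### The radical of the form. -/

omit hd hs

variable (A d)

/-- The radical of the pairing on words. -/
def wordRadical : Submodule ℂ (WordSpace ι) := LinearMap.ker (pairing A d).flip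

variable {A d}

lemma mem_wordRadical {y : WordSpace ι} :
    y ∈ wordRadical A d ↔ ∀ x, pairing A d x y = 0 := by
  rw [wordRadical, LinearMap.mem_ker, LinearMap.ext_iff]
  rfl

lemma consWord_mem_wordRadical {y : WordSpace ι} (hy : y ∈ wordRadical A d) (i : ι) :
    consWord i y ∈ wordRadical A d := by
  rw [mem_wordRadical] at *
  intro x
  rw [pairing_consWord, hy, neg_zero]

lemma wordWeight_mem_wordRadical {y : WordSpace ι} (hy : y ∈ wordRadical A d) (g : ι → ℂ) :
    wordWeight g y ∈ wordRadical A d := by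
  rw [mem_wordRadical] at *
  intro x
  rw [← pairing_wordWeight, hy]

include hd

lemma apply_nil_of_mem_wordRadical {y : WordSpace ι} (hy : y ∈ wordRadical A d) (k : ι) :
    y ([], k) = 0 := by
  rw [mem_wordRadical] at hy
  have h := hy (Finsupp.single ([], k) 1)
  rw [pairing_nil_left] at h
  have h3 : (d k : ℂ) ≠ 0 := by exact_mod_cast (hd k).ne'
  simpa [h3] using h

include hs

lemma der_mem_wordRadical {y : WordSpace ι} (hy : y ∈ wordRadical A d) (j : ι) :
    der A j y ∈ wordRadical A d := by
  rw [mem_wordRadical] at *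
  intro x
  rw [pairing_der hd hs, hy, neg_zero]

/-- Every word is a letter or begins with one that can be moved across the form, so membership is
tested by letters and derivatives alone. This is the criterion applied to the Serre relators. -/
lemma mem_wordRadical_of_der {y : WordSpace ι} (h0 : ∀ k, y ([], k) = 0)
    (hy : ∀ j, der A j y ∈ wordRadical A d) : y ∈ wordRadical A d := by
  rw [mem_wordRadical]
  intro x
  induction x using word_induction with
  | h0 => simp
  | hadd x z hx hz => simp [hx, hz]
  | hnil k c => simp [pairing_nil_left, h0]
  | hcons i x ih =>
    have := pairing_der hd hs x y i
    rw [mem_wordRadical.1 (hy i), eq_comm, neg_eq_zero] at this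
    exact this

omit hs hd

/-- A word of prefix length `N` has `N + 1` letters, so it is an eigenvector of the self-adjoint
operator `wordWeight 1` with eigenvalue `N + 1`. -/
lemma pairing_eq_zero_of_length {N N' : ℕ} (hN : N ≠ N') {x y : WordSpace ι}
    (hx : x ∈ wordsOfLength ι N) (hy : y ∈ wordsOfLength ι N') : pairing A d x y = 0 := by
  have key : ∀ {N} {x : WordSpace ι}, x ∈ wordsOfLength ι N →
      wordWeight (fun _ => 1) x = ((N : ℂ) + 1) • x := by
    intro N x hx
    refine wordsOfLength_induction (p := fun x => wordWeight (fun _ => 1) x = ((N : ℂ) + 1) • x)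
      (by simp) (fun x y hx hy => by rw [map_add, hx, hy, smul_add]) ?_ hx
    rintro w rfl c
    rw [wordWeight_single]
    simp [wordSum]
  have h := pairing_wordWeight A d (fun _ => 1) x y
  rw [key hx, key hy, map_smul, map_smul, LinearMap.smul_apply, smul_eq_mul, smul_eq_mul,
    ← sub_eq_zero, ← sub_mul, mul_eq_zero] at h
  refine h.resolve_left fun h => hN ?_
  have : (N : ℂ) = N' := by linear_combination h
  exact_mod_cast this

include hd hs

/-- Orthogonal systems of words: dual bases modulo the radical. -/
lemma exists_dual_system [Finite ι] (N : ℕ) : ∃ (n : ℕ) (c : Fin n → ℂ) (v : Fin n → WordSpace ι),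
    (∀ s, v s ∈ wordsOfLength ι N) ∧
    ∀ x ∈ wordsOfLength ι N, x - ∑ s, (c s * pairing A d x (v s)) • v s ∈ wordRadical A d := by
  classical
  let B : LinearMap.BilinForm ℂ (wordsOfLength ι N) :=
    (pairing A d).compl₁₂ (wordsOfLength ι N).subtype (wordsOfLength ι N).subtype
  have hB : B.IsSymm := ⟨fun x y => pairing_symm hd hs x y⟩
  have : Invertible (2 : ℂ) := invertibleOfNonzero two_ne_zero
  obtain ⟨v, hv⟩ := LinearMap.BilinForm.exists_orthogonal_basis (K := ℂ)
    (V := wordsOfLength ι N) (B := B) (LinearMap.BilinForm.isSymm_iff.1 hB)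
  -- For an isotropic vector of the orthogonal basis the convention `0⁻¹ = 0` gives coefficient
  -- zero, as it should: such a vector is orthogonal to the whole basis.
  refine ⟨_, fun s => (B (v s) (v s))⁻¹, fun s => v s, fun s => (v s).2, fun x hx => ?_⟩
  rw [mem_wordRadical]
  have hmem : x - ∑ s, ((B (v s) (v s))⁻¹ * pairing A d x (v s)) • (v s : WordSpace ι) ∈
      wordsOfLength ι N :=
    sub_mem hx (Submodule.sum_mem _ fun s _ => Submodule.smul_mem _ _ (v s).2)
  have hvt : ∀ t, B (v t) (⟨_, hmem⟩ : wordsOfLength ι N) = 0 := by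
    intro t
    change pairing A d (v t) (x - _) = 0
    rw [map_sub, map_sum, Finset.sum_eq_single t]
    · rw [map_smul, smul_eq_mul, pairing_symm hd hs x]
      by_cases h0 : B (v t) (v t) = 0
      · have : B (v t) (⟨x, hx⟩ : wordsOfLength ι N) = 0 := by
          rw [← v.sum_repr ⟨x, hx⟩, map_sum]
          refine Finset.sum_eq_zero fun s _ => ?_
          rw [map_smul]
          by_cases hst : t = s
          · subst hst; simp [h0]
          · have : B (v t) (v s) = 0 := hv hst
            simp [this]
        change pairing A d (v t) x = 0 at this
        rw [this]; simp
      · change _ - (B (v t) (v t))⁻¹ * _ * (B (v t) (v t)) = 0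
        field_simp
        simp
    · intro s _ hst
      have : B (v t) (v s) = 0 := hv (Ne.symm hst)
      change pairing A d (v t) (v s) = 0 at this
      rw [map_smul, this, smul_zero]
    · simp
  intro y
  induction y using Finsupp.induction_linear with
  | zero => simp
  | add y z hy hz => simp [hy, hz]
  | single w c =>
    by_cases hw : w.1.length = N
    · subst hw
      let y : wordsOfLength ι w.1.length := ⟨_, single_mem_wordsOfLength w c⟩
      change B y ⟨_, hmem⟩ = 0
      rw [← v.sum_repr y, map_sum, LinearMap.sum_apply]
      refine Finset.sum_eq_zero fun s _ => ?_
      rw [map_smul, LinearMap.smul_apply, hvt, smul_zero]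
    · exact pairing_eq_zero_of_length hw (single_mem_wordsOfLength w c) hmem

end Words

end

section

/-! ### Representations by Chevalley operators, without Serre relations -/

/-- Operators `h`, `e i`, `f i` on `M` satisfying the Chevalley relations (but possibly not the
Serre relations). -/
structure WeakRep {ι : Type*} [Fintype ι] [DecidableEq ι] {A : Matrix ι ι ℤ} {H : Type*} [AddCommGroup H]
    [Module ℂ H] (R : Realization A H) (M : Type*) [AddCommGroup M] [Module ℂ M] where
  h : H →ₗ[ℂ] Module.End ℂ M
  e : ι → Module.End ℂ M
  f : ι → Module.End ℂ M
  lie_hh : ∀ x y, ⁅h x, h y⁆ = 0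
  lie_he : ∀ x i, ⁅h x, e i⁆ = R.root i x • e i
  lie_hf : ∀ x i, ⁅h x, f i⁆ = -(R.root i x • f i)
  lie_ef : ∀ i j, ⁅e i, f j⁆ = if i = j then h (R.coroot i) else 0

section Bracket

variable {ι : Type*} {M : Type*} [AddCommGroup M] [Module ℂ M]

/-- The right-normed bracket of the operators `a i` along a word. -/
def bracketWord (a : ι → Module.End ℂ M) : List ι → ι → Module.End ℂ M
  | [], k => a k
  | i :: w, k => ⁅a i, bracketWord a w k⁆

/-- The linear extension of `bracketWord`. -/
def bracket (a : ι → Module.End ℂ M) : WordSpace ι →ₗ[ℂ] Module.End ℂ M :=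
  Finsupp.linearCombination ℂ (fun w => bracketWord a w.1 w.2)

@[simp] lemma bracket_single (a : ι → Module.End ℂ M) (w : List ι × ι) (c : ℂ) :
    bracket a (Finsupp.single w c) = c • bracketWord a w.1 w.2 := by
  simp [bracket]

lemma bracket_consWord (a : ι → Module.End ℂ M) (i : ι) (x : WordSpace ι) :
    bracket a (consWord i x) = ⁅a i, bracket a x⁆ := by
  induction x using Finsupp.induction_linear with
  | zero => simp
  | add x y hx hy => simp only [map_add, hx, hy, lie_add]
  | single w c => simp [bracketWord]

lemma bracket_apply_eq_zero (a : ι → Module.End ℂ M) {m : M} (hm : ∀ i, a i m = 0)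
    (x : WordSpace ι) : bracket a x m = 0 := by
  induction x using word_induction with
  | h0 => simp
  | hadd x y hx hy => simp [hx, hy]
  | hnil k c => simp [bracketWord, hm]
  | hcons i x ih => simp [bracket_consWord, Ring.lie_def, ih, hm]

end Bracket

variable {ι : Type*} [Fintype ι] [DecidableEq ι] {A : Matrix ι ι ℤ}
  {H : Type*} [AddCommGroup H] [Module ℂ H] {R : Realization A H}
  {M : Type*} [AddCommGroup M] [Module ℂ M]

namespace WeakRep

/-- The Chevalley involution. -/
def flip (ρ : WeakRep R M) : WeakRep R M where
  h := -ρ.h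
  e := ρ.f
  f := ρ.e
  lie_hh x y := by simp [ρ.lie_hh]
  lie_he x i := by simp [ρ.lie_hf]
  lie_hf x i := by simp [ρ.lie_he]
  lie_ef i j := by
    rw [← lie_skew, ρ.lie_ef]
    by_cases h : i = j
    · subst h; simp
    · rw [if_neg h, if_neg (Ne.symm h), neg_zero]

variable (ρ : WeakRep R M)

/-- Right-normed brackets of the `e i`. -/
def E : WordSpace ι →ₗ[ℂ] Module.End ℂ M := bracket ρ.e

/-- Right-normed brackets of the `f i`. -/
def F : WordSpace ι →ₗ[ℂ] Module.End ℂ M := bracket ρ.f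

lemma E_consWord (i : ι) (x : WordSpace ι) : ρ.E (consWord i x) = ⁅ρ.e i, ρ.E x⁆ :=
  bracket_consWord _ _ _

lemma F_consWord (i : ι) (x : WordSpace ι) : ρ.F (consWord i x) = ⁅ρ.f i, ρ.F x⁆ :=
  bracket_consWord _ _ _

lemma E_single_nil (k : ι) (c : ℂ) : ρ.E (Finsupp.single ([], k) c) = c • ρ.e k := by
  simp [E, bracketWord]

lemma F_single_nil (k : ι) (c : ℂ) : ρ.F (Finsupp.single ([], k) c) = c • ρ.f k := by
  simp [F, bracketWord]

lemma lie_h_E (t : H) (x : WordSpace ι) :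
    ⁅ρ.h t, ρ.E x⁆ = ρ.E (wordWeight (fun i => R.root i t) x) := by
  induction x using word_induction with
  | h0 => simp
  | hadd x y hx hy => simp only [map_add, lie_add, hx, hy]
  | hnil k c =>
    rw [wordWeight_single, E_single_nil, E_single_nil, lie_smul, ρ.lie_he]
    simp [wordSum, smul_smul, mul_comm]
  | hcons i x ih =>
    rw [E_consWord, leibniz_lie, ih, ρ.lie_he, wordWeight_consWord, map_add, map_smul, E_consWord,
      E_consWord, smul_lie, add_comm]

lemma lie_h_F (t : H) (x : WordSpace ι) :
    ⁅ρ.h t, ρ.F x⁆ = -ρ.F (wordWeight (fun i => R.root i t) x) := by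
  have := ρ.flip.lie_h_E t x
  change ⁅-ρ.h t, ρ.F x⁆ = ρ.F _ at this
  rw [← this, neg_lie, neg_neg]

/-- Only the one-letter word `j` has a bracket with `f_j` in the Cartan subalgebra; this accounts
for the term beside `der`. -/
lemma lie_f_E (j : ι) (x : WordSpace ι) :
    ⁅ρ.f j, ρ.E x⁆ = ρ.E (der A j x) - x ([], j) • ρ.h (R.coroot j) := by
  induction x using word_induction with
  | h0 => simp
  | hadd x y hx hy =>
    simp only [map_add, lie_add, hx, hy, Finsupp.add_apply, add_smul]; abel
  | hnil k c =>
    rw [der_single_nil, E_single_nil, lie_smul, ← lie_skew, ρ.lie_ef]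
    by_cases h : k = j
    · subst h; simp
    · rw [if_neg h, Finsupp.single_eq_of_ne (by simpa using Ne.symm h)]
      simp
  | hcons i x ih =>
    rw [E_consWord, leibniz_lie, ih, ← lie_skew (ρ.f j) (ρ.e i), ρ.lie_ef, der_consWord, consWord_apply_nil,
      lie_sub, ← E_consWord, lie_smul, ← lie_skew (ρ.e i), ρ.lie_he, R.root_coroot, map_add, map_add,
      map_smul, E_single_nil]
    by_cases h : i = j
    · subst h
      rw [if_pos rfl, if_pos rfl, neg_lie, lie_h_E, map_neg]
      simp only [R.root_coroot]
      module
    · rw [if_neg h, if_neg h]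
      simp only [neg_zero, zero_lie, map_zero]
      module

lemma lie_e_F (j : ι) (x : WordSpace ι) :
    ⁅ρ.e j, ρ.F x⁆ = ρ.F (der A j x) + x ([], j) • ρ.h (R.coroot j) := by
  have := ρ.flip.lie_f_E j x
  change ⁅ρ.e j, ρ.F x⁆ = ρ.F _ - x ([], j) • (-ρ.h (R.coroot j)) at this
  rw [this, smul_neg, sub_neg_eq_add]

/-- Subspaces stable under all Chevalley operators. -/
structure Stable (p : Submodule ℂ M) : Prop where
  h : ∀ t, ∀ m ∈ p, ρ.h t m ∈ p
  e : ∀ i, ∀ m ∈ p, ρ.e i m ∈ p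
  f : ∀ i, ∀ m ∈ p, ρ.f i m ∈ p

lemma apply_lie_comm (a b : Module.End ℂ M) (m : M) : a (b m) = ⁅a, b⁆ m + b (a m) := by
  simp [Ring.lie_def]

/-! ### Vanishing of the radical on irreducible highest weight representations. -/

variable (d : ι → ℝ)

/-- The radical of the word pairing acts by zero. -/
def RadTrivial : Prop := ∀ x ∈ wordRadical A d, ρ.E x = 0 ∧ ρ.F x = 0

/-- The subspace generated by the images of the radical in the `f`'s. -/
def radF : Submodule ℂ M := Submodule.span ℂ {y | ∃ x ∈ wordRadical A d, ∃ m, ρ.F x m = y}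

variable {d} (hd : ∀ i, 0 < d i) (hs : ∀ i j, d i * A i j = d j * A j i)

lemma F_mem_radF {x : WordSpace ι} (hx : x ∈ wordRadical A d) (m : M) : ρ.F x m ∈ ρ.radF d :=
  Submodule.subset_span ⟨x, hx, m, rfl⟩

include hd hs in
-- Commuting a Chevalley operator past `F x` replaces `x` by another element of the radical. No
-- Cartan term appears, because elements of the radical have no one-letter component.
lemma stable_radF : ρ.Stable (ρ.radF d) := by
  have key : ∀ a : Module.End ℂ M, (∀ x ∈ wordRadical A d, ∀ m, a (ρ.F x m) ∈ ρ.radF d) →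
      ∀ m ∈ ρ.radF d, a m ∈ ρ.radF d := by
    intro a ha
    change ρ.radF d ≤ (ρ.radF d).comap a
    refine Submodule.span_le.2 ?_
    rintro _ ⟨x, hx, m, rfl⟩
    exact ha x hx m
  refine ⟨fun t => key _ fun x hx m => ?_, fun t => key _ fun x hx m => ?_,
    fun t => key _ fun x hx m => ?_⟩
  · rw [apply_lie_comm, lie_h_F]
    exact add_mem (neg_mem (ρ.F_mem_radF (wordWeight_mem_wordRadical hx _) _)) (ρ.F_mem_radF hx _)
  · rw [apply_lie_comm, lie_e_F, apply_nil_of_mem_wordRadical hd hx, zero_smul, add_zero]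
    exact add_mem (ρ.F_mem_radF (der_mem_wordRadical hd hs hx _) _) (ρ.F_mem_radF hx _)
  · rw [apply_lie_comm, ← F_consWord]
    exact add_mem (ρ.F_mem_radF (consWord_mem_wordRadical hx _) _) (ρ.F_mem_radF hx _)

variable (d) in
/-- The subspace killed by the image of the radical in the `e`'s. -/
def kerE : Submodule ℂ M := ⨅ x ∈ wordRadical A d, LinearMap.ker (ρ.E x)

lemma mem_kerE {m : M} : m ∈ ρ.kerE d ↔ ∀ x ∈ wordRadical A d, ρ.E x m = 0 := by
  simp [kerE]

lemma apply_lie_comm' (a b : Module.End ℂ M) (m : M) : a (b m) = b (a m) - ⁅b, a⁆ m := by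
  simp [Ring.lie_def]

include hd hs in
lemma stable_kerE : ρ.Stable (ρ.kerE d) := by
  refine ⟨fun t m hm => ρ.mem_kerE.2 fun x hx => ?_, fun t m hm => ρ.mem_kerE.2 fun x hx => ?_,
    fun t m hm => ρ.mem_kerE.2 fun x hx => ?_⟩ <;> rw [mem_kerE] at hm
  · rw [apply_lie_comm', hm x hx, lie_h_E, hm _ (wordWeight_mem_wordRadical hx _), map_zero,
      sub_zero]
  · rw [apply_lie_comm', hm x hx, ← E_consWord, hm _ (consWord_mem_wordRadical hx _), map_zero,
      sub_zero]
  · rw [apply_lie_comm', hm x hx, lie_f_E, apply_nil_of_mem_wordRadical hd hx, zero_smul, sub_zero,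
      hm _ (der_mem_wordRadical hd hs hx _), map_zero, sub_zero]

include hd hs in
-- Both subspaces are stable, hence trivial. `radF` is proper, so it is zero; `kerE` contains the
-- singular vector `v`, so it is everything.
lemma radTrivial_of_irreducible (hirr : ∀ p, ρ.Stable p → p ≠ ⊤ → p = ⊥) (hF : ρ.radF d ≠ ⊤)
    {v : M} (hv0 : v ≠ 0) (hv : ∀ i, ρ.e i v = 0) : ρ.RadTrivial d := by
  intro x hx
  constructor
  · have h : ρ.kerE d = ⊤ := by
      by_contra h
      have hv' : v ∈ ρ.kerE d := ρ.mem_kerE.2 fun x _ => bracket_apply_eq_zero _ hv x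
      rw [hirr _ (ρ.stable_kerE hd hs) h] at hv'
      exact hv0 hv'
    ext m
    exact ρ.mem_kerE.1 (h ▸ Submodule.mem_top : m ∈ ρ.kerE d) x hx
  · ext m
    have := ρ.F_mem_radF hx m
    rw [hirr _ (ρ.stable_radF hd hs) hF] at this
    exact this

end WeakRep

/-! ### The Casimir operator -/

/-- Dual bases of the words of length `N` modulo the radical of the pairing. -/
structure DualSystem {ι : Type*} [DecidableEq ι] (A : Matrix ι ι ℤ) (d : ι → ℝ) (N : ℕ) where
  n : ℕ
  c : Fin n → ℂ
  v : Fin n → WordSpace ι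
  mem : ∀ s, v s ∈ wordsOfLength ι N
  sub_mem : ∀ x ∈ wordsOfLength ι N, x - ∑ s, (c s * pairing A d x (v s)) • v s ∈ wordRadical A d

namespace WeakRep

variable (ρ : WeakRep R M) {d : ι → ℝ} (S : ∀ N, DualSystem A d N)

lemma E_eq_sum (hρ : ρ.RadTrivial d) {N : ℕ} {x : WordSpace ι} (hx : x ∈ wordsOfLength ι N) :
    ρ.E x = ∑ s, ((S N).c s * pairing A d x ((S N).v s)) • ρ.E ((S N).v s) := by
  have := (hρ _ ((S N).sub_mem x hx)).1
  rwa [map_sub, sub_eq_zero, map_sum, Finset.sum_congr rfl fun s _ => map_smul ρ.E _ _] at this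

lemma F_eq_sum (hρ : ρ.RadTrivial d) {N : ℕ} {x : WordSpace ι} (hx : x ∈ wordsOfLength ι N) :
    ρ.F x = ∑ s, ((S N).c s * pairing A d x ((S N).v s)) • ρ.F ((S N).v s) := by
  have := (hρ _ ((S N).sub_mem x hx)).2
  rwa [map_sub, sub_eq_zero, map_sum, Finset.sum_congr rfl fun s _ => map_smul ρ.F _ _] at this

/-- The part of the Casimir operator coming from words of length `N`. -/
def casimirPart (N : ℕ) : Module.End ℂ M :=
  ∑ s, (S N).c s • (ρ.F ((S N).v s) * ρ.E ((S N).v s))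

/-- The part of the Casimir operator coming from words of length less than `n`. -/
def casimir (n : ℕ) : Module.End ℂ M := ∑ N ∈ Finset.range n, ρ.casimirPart S N

/-- The transfer of an operation on words through the dual system to its adjoint. -/
lemma sum_transfer (hρ : ρ.RadTrivial d) {N N' : ℕ} (T T' : WordSpace ι → WordSpace ι)
    (hT : ∀ x ∈ wordsOfLength ι N, T x ∈ wordsOfLength ι N')
    (hT' : ∀ x ∈ wordsOfLength ι N', T' x ∈ wordsOfLength ι N)
    (hadj : ∀ x y, pairing A d (T x) y = pairing A d (T' y) x) :
    ∑ s, (S N).c s • (ρ.F ((S N).v s) * ρ.E (T ((S N).v s))) =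
      ∑ s, (S N').c s • (ρ.F (T' ((S N').v s)) * ρ.E ((S N').v s)) := by
  have h1 : ∀ s, (S N).c s • (ρ.F ((S N).v s) * ρ.E (T ((S N).v s))) =
      ∑ r, ((S N).c s * (S N').c r * pairing A d (T ((S N).v s)) ((S N').v r)) •
        (ρ.F ((S N).v s) * ρ.E ((S N').v r)) := by
    intro s
    rw [ρ.E_eq_sum S hρ (hT _ ((S N).mem s)), Finset.mul_sum, Finset.smul_sum]
    refine Finset.sum_congr rfl fun r _ => ?_
    rw [mul_smul_comm, smul_smul, mul_assoc]
  have h2 : ∀ r, (S N').c r • (ρ.F (T' ((S N').v r)) * ρ.E ((S N').v r)) =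
      ∑ s, ((S N).c s * (S N').c r * pairing A d (T ((S N).v s)) ((S N').v r)) •
        (ρ.F ((S N).v s) * ρ.E ((S N').v r)) := by
    intro r
    rw [ρ.F_eq_sum S hρ (hT' _ ((S N').mem r)), Finset.sum_mul, Finset.smul_sum]
    refine Finset.sum_congr rfl fun s _ => ?_
    rw [smul_mul_assoc, smul_smul, hadj]
    ring_nf
  simp_rw [h1, h2]
  exact Finset.sum_comm

variable (hρ : ρ.RadTrivial d) (hd : ∀ i, 0 < d i) (hs : ∀ i j, d i * A i j = d j * A j i)

omit [DecidableEq ι] in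
lemma lie_sum_smul_mul {n : ℕ} (c : Fin n → ℂ) (a b : Fin n → Module.End ℂ M)
    (t : Module.End ℂ M) : ⁅∑ s, c s • (a s * b s), t⁆ =
      ∑ s, c s • (a s * ⁅b s, t⁆) + ∑ s, c s • (⁅a s, t⁆ * b s) := by
  simp only [Ring.lie_def, Finset.sum_mul, Finset.mul_sum]
  rw [← Finset.sum_add_distrib, ← Finset.sum_sub_distrib]
  refine Finset.sum_congr rfl fun s _ => ?_
  rw [smul_mul_assoc, mul_smul_comm, ← smul_sub, ← smul_add]
  congr 1
  noncomm_ring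

include hρ hd hs in
-- The weights of the two factors have opposite signs, and `wordWeight` is self-adjoint, so its two
-- contributions cancel across the dual system.
lemma lie_casimir_h (n : ℕ) (t : H) : ⁅ρ.casimir S n, ρ.h t⁆ = 0 := by
  rw [casimir, LieRing.of_associative_ring_bracket, Finset.sum_mul, Finset.mul_sum,
    ← Finset.sum_sub_distrib]
  refine Finset.sum_eq_zero fun N _ => ?_
  rw [← LieRing.of_associative_ring_bracket, casimirPart, lie_sum_smul_mul]
  simp only [← lie_skew _ (ρ.h t), lie_h_E, lie_h_F, neg_neg, mul_neg, smul_neg,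
    Finset.sum_neg_distrib]
  rw [neg_add_eq_zero]
  refine ρ.sum_transfer S hρ (wordWeight _) (wordWeight _) (fun x hx => wordWeight_mem hx _)
    (fun x hx => wordWeight_mem hx _) fun x y => ?_
  rw [pairing_wordWeight, pairing_symm hd hs]

/-- The defect of the commutation of the truncated Casimir operator with `f i`. -/
def defectF (N : ℕ) (i : ι) : Module.End ℂ M :=
  ∑ s, (S N).c s • (ρ.F ((S N).v s) * ⁅ρ.E ((S N).v s), ρ.f i⁆)

/-- The defect of the commutation of the truncated Casimir operator with `e i`. -/
def defectE (N : ℕ) (i : ι) : Module.End ℂ M :=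
  ∑ s, (S N).c s • (⁅ρ.F ((S N).v s), ρ.e i⁆ * ρ.E ((S N).v s))

omit [Fintype ι] [DecidableEq ι] in
lemma apply_nil_of_mem {N : ℕ} {x : WordSpace ι} (hx : x ∈ wordsOfLength ι (N + 1)) (k : ι) :
    x ([], k) = 0 := by
  refine wordsOfLength_induction (p := fun x => x ([], k) = 0)
    (by simp) (fun x y hx hy => by rw [Finsupp.add_apply, hx, hy, add_zero]) ?_ hx
  rintro w hw c
  refine Finsupp.single_eq_of_ne ?_
  rintro rfl
  simp at hw

omit [Fintype ι] in
lemma der_eq_zero_of_mem {x : WordSpace ι} (hx : x ∈ wordsOfLength ι 0) (j : ι) :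
    der A j x = 0 := by
  refine wordsOfLength_induction (p := fun x => der A j x = 0)
    (by simp) (fun x y hx hy => by rw [map_add, hx, hy, add_zero]) ?_ hx
  rintro ⟨w, k⟩ hw c
  obtain rfl : w = [] := by simpa using hw
  exact der_single_nil _ _ _ _

include hρ hd hs in
-- Since `-der i` from length `N + 1` to `N` is adjoint to `consWord i`, what the `e`-factors
-- contribute at length `N + 1` cancels what the `f`-factors contribute at length `N`. This makes
-- the commutator with `f i` telescope.
lemma defectF_succ (N : ℕ) (i : ι) : ρ.defectF S (N + 1) i =
    -∑ s, (S N).c s • (⁅ρ.F ((S N).v s), ρ.f i⁆ * ρ.E ((S N).v s)) := by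
  rw [defectF]
  have : ∀ s, ⁅ρ.E ((S (N + 1)).v s), ρ.f i⁆ = -ρ.E (der A i ((S (N + 1)).v s)) := by
    intro s
    rw [← lie_skew, lie_f_E, apply_nil_of_mem ((S (N + 1)).mem s), zero_smul, sub_zero]
  simp only [this, ← lie_skew _ (ρ.f i), ← F_consWord, mul_neg, smul_neg, neg_mul,
    Finset.sum_neg_distrib, neg_neg]
  rw [← Finset.sum_neg_distrib]
  have := ρ.sum_transfer S hρ (N := N + 1) (N' := N) (fun x => -der A i x) (consWord i)
    (fun x hx => neg_mem (der_mem A hx i)) (fun x hx => consWord_mem hx i) fun x y => by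
      rw [map_neg, LinearMap.neg_apply, ← pairing_consWord, pairing_symm hd hs]
  simpa using this

include hρ hd hs in
lemma defectE_succ (N : ℕ) (i : ι) : ρ.defectE S (N + 1) i =
    -∑ s, (S N).c s • (ρ.F ((S N).v s) * ⁅ρ.E ((S N).v s), ρ.e i⁆) := by
  rw [defectE]
  have : ∀ s, ⁅ρ.F ((S (N + 1)).v s), ρ.e i⁆ = -ρ.F (der A i ((S (N + 1)).v s)) := by
    intro s
    rw [← lie_skew, lie_e_F, apply_nil_of_mem ((S (N + 1)).mem s), zero_smul, add_zero]
  simp only [this, ← lie_skew _ (ρ.e i), ← E_consWord, mul_neg, smul_neg, neg_mul,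
    Finset.sum_neg_distrib, neg_neg]
  rw [← Finset.sum_neg_distrib]
  have := ρ.sum_transfer S hρ (N := N) (N' := N + 1) (consWord i) (fun x => -der A i x)
    (fun x hx => consWord_mem hx i) (fun x hx => neg_mem (der_mem A hx i)) fun x y => by
      rw [map_neg, LinearMap.neg_apply, ← pairing_consWord, pairing_symm hd hs]
  simpa using this.symm

omit [DecidableEq ι] in
lemma lie_sum_range (a : ℕ → Module.End ℂ M) (n : ℕ) (t : Module.End ℂ M) :
    ⁅∑ N ∈ Finset.range (n + 1), a N, t⁆ = ⁅∑ N ∈ Finset.range n, a N, t⁆ + ⁅a n, t⁆ := by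
  rw [Finset.sum_range_succ, add_lie]

include hρ hd hs in
lemma lie_casimir_f (n : ℕ) (i : ι) :
    ⁅ρ.casimir S n, ρ.f i⁆ = ρ.defectF S 0 i - ρ.defectF S n i := by
  induction n with
  | zero => simp [casimir]
  | succ n ih =>
    rw [casimir, lie_sum_range, ← casimir, ih, casimirPart, lie_sum_smul_mul, ← defectF,
      ρ.defectF_succ S hρ hd hs]
    abel

include hρ hd hs in
lemma lie_casimir_e (n : ℕ) (i : ι) :
    ⁅ρ.casimir S n, ρ.e i⁆ = ρ.defectE S 0 i - ρ.defectE S n i := by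
  induction n with
  | zero => simp [casimir]
  | succ n ih =>
    rw [casimir, lie_sum_range, ← casimir, ih, casimirPart, lie_sum_smul_mul, ← defectE,
      ρ.defectE_succ S hρ hd hs]
    abel

omit [Fintype ι] in
include hd in
lemma pairing_letter (N : ℕ) (i : ι) (s : Fin (S N).n) :
    ((S N).v s) ([], i) = d i * pairing A d (Finsupp.single ([], i) 1) ((S N).v s) := by
  have h3 : (d i : ℂ) ≠ 0 := by exact_mod_cast (hd i).ne'
  rw [pairing_nil_left]
  field_simp

include hρ hd in
-- On letters only `[e_i, f_i] = α_i^∨` contributes, and the dual system sums back to `f_i`. The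
-- factor `d i` inverts the norm of the letter `i`.
lemma defectF_zero (i : ι) : ρ.defectF S 0 i = (d i : ℂ) • (ρ.f i * ρ.h (R.coroot i)) := by
  have h := ρ.F_eq_sum S hρ (N := 0) (single_mem_wordsOfLength ([], i) (1 : ℂ))
  rw [F_single_nil, one_smul] at h
  rw [h, defectF, Finset.sum_mul, Finset.smul_sum]
  refine Finset.sum_congr rfl fun s _ => ?_
  rw [← lie_skew, lie_f_E, der_eq_zero_of_mem ((S 0).mem s), map_zero, zero_sub, neg_neg,
    pairing_letter S hd, mul_smul_comm, smul_mul_assoc, smul_smul, smul_smul]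
  ring_nf

include hρ hd in
lemma defectE_zero (i : ι) : ρ.defectE S 0 i = -((d i : ℂ) • (ρ.h (R.coroot i) * ρ.e i)) := by
  have h := ρ.E_eq_sum S hρ (N := 0) (single_mem_wordsOfLength ([], i) (1 : ℂ))
  rw [E_single_nil, one_smul] at h
  rw [h, defectE, Finset.mul_sum, Finset.smul_sum, ← Finset.sum_neg_distrib]
  refine Finset.sum_congr rfl fun s _ => ?_
  rw [← lie_skew, lie_e_F, der_eq_zero_of_mem ((S 0).mem s), map_zero, zero_add,
    pairing_letter S hd, mul_smul_comm, neg_mul, smul_mul_assoc, smul_neg, smul_smul, smul_smul]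
  ring_nf

include hρ hd hs in
-- The hypotheses kill the defect at the truncation level `n`. What remains is compensated, in the
-- full Casimir operator, by its Cartan part, which is left out here.
lemma casimir_f_apply {n : ℕ} {i : ι} {m : M} (h1 : ∀ x ∈ wordsOfLength ι n, ρ.E x m = 0)
    (h2 : ∀ x ∈ wordsOfLength ι n, ρ.E x (ρ.f i m) = 0) :
    ρ.casimir S n (ρ.f i m) =
      ρ.f i (ρ.casimir S n m) + (d i : ℂ) • ρ.f i (ρ.h (R.coroot i) m) := by
  have h3 : ρ.defectF S n i m = 0 := by
    rw [defectF, LinearMap.sum_apply]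
    refine Finset.sum_eq_zero fun s _ => ?_
    rw [LinearMap.smul_apply, Module.End.mul_apply, LieRing.of_associative_ring_bracket,
      LinearMap.sub_apply, Module.End.mul_apply, Module.End.mul_apply, h1 _ ((S n).mem s),
      h2 _ ((S n).mem s)]
    simp
  have := LinearMap.congr_fun (ρ.lie_casimir_f S hρ hd hs n i) m
  rw [ρ.defectF_zero S hρ hd, LinearMap.sub_apply, h3, sub_zero] at this
  rw [apply_lie_comm, this, add_comm]
  rfl

include hρ hd hs in
lemma casimir_e_apply {n : ℕ} {i : ι} {m : M} (h1 : ∀ x ∈ wordsOfLength ι n, ρ.E x m = 0) :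
    ρ.casimir S n (ρ.e i m) =
      ρ.e i (ρ.casimir S n m) - (d i : ℂ) • ρ.h (R.coroot i) (ρ.e i m) := by
  have h3 : ρ.defectE S n i m = 0 := by
    rw [defectE, LinearMap.sum_apply]
    refine Finset.sum_eq_zero fun s _ => ?_
    rw [LinearMap.smul_apply, Module.End.mul_apply, h1 _ ((S n).mem s)]
    simp
  have := LinearMap.congr_fun (ρ.lie_casimir_e S hρ hd hs n i) m
  rw [ρ.defectE_zero S hρ hd, LinearMap.sub_apply, h3, sub_zero] at this
  rw [apply_lie_comm, this, add_comm, sub_eq_add_neg]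
  rfl

end WeakRep

end

section

/-! ### Weights -/

variable {ι : Type*} [Fintype ι] [DecidableEq ι] {A : Matrix ι ι ℤ}
  {H : Type*} [AddCommGroup H] [Module ℂ H] {R : Realization A H}
  {M : Type*} [AddCommGroup M] [Module ℂ M]

/-- The number of occurrences of each letter. -/
def content {ι : Type*} [DecidableEq ι] : List ι → ι → ℕ
  | [] => 0
  | i :: w => content w + Pi.single i 1

lemma sum_content (w : List ι) : ∑ i, content w i = w.length := by
  induction w with
  | nil => simp [content]
  | cons i w ih => simp [content, Finset.sum_add_distrib, ih]

lemma sum_map_eq_content (g : ι → ℂ) (w : List ι) :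
    (w.map g).sum = ∑ i, content w i * g i := by
  induction w with
  | nil => simp [content]
  | cons i w ih =>
    simp only [List.map_cons, List.sum_cons, ih, content, Pi.add_apply, Nat.cast_add, add_mul,
      Finset.sum_add_distrib, add_comm (g i)]
    congr 1
    rw [Finset.sum_eq_single i] <;> simp +contextual

namespace Realization

variable (R : Realization A H)

/-- The combination `∑ β_i α_i` of simple roots. -/
def rootSum (β : ι → ℕ) : Module.Dual ℂ H := ∑ i, (β i : ℂ) • R.root i

@[simp] lemma rootSum_zero : R.rootSum 0 = 0 := by simp [rootSum]

lemma rootSum_add (β γ : ι → ℕ) : R.rootSum (β + γ) = R.rootSum β + R.rootSum γ := by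
  simp [rootSum, add_smul, Finset.sum_add_distrib]

lemma rootSum_single (i : ι) : R.rootSum (Pi.single i 1) = R.root i := by
  rw [rootSum, Finset.sum_eq_single i] <;> simp +contextual

lemma rootSum_injective : Function.Injective R.rootSum := by
  intro β γ h
  have := Fintype.linearIndependent_iff.1 R.linearIndependent_root
    (fun i => (β i : ℂ) - γ i) (by
      simp only [sub_smul, Finset.sum_sub_distrib]
      exact sub_eq_zero.2 h)
  ext i
  have := this i
  rw [sub_eq_zero] at this
  exact_mod_cast this

lemma rootSum_coroot (β : ι → ℕ) (i : ι) : R.rootSum β (R.coroot i) = ∑ j, (β j : ℂ) * A i j := by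
  simp [rootSum, R.root_coroot]

lemma rootSum_content_apply (w : List ι) (t : H) :
    R.rootSum (content w) t = (w.map (fun i => R.root i t)).sum := by
  rw [sum_map_eq_content]
  simp [rootSum]

end Realization

namespace WeakRep

variable (ρ : WeakRep R M)

/-- The weight spaces. -/
def wt (χ : Module.Dual ℂ H) : Submodule ℂ M where
  carrier := {m | ∀ t, ρ.h t m = χ t • m}
  zero_mem' := by simp
  add_mem' := by
    intro a b ha hb t
    rw [map_add, ha t, hb t, smul_add]
  smul_mem' := by
    intro c a ha t
    rw [map_smul, ha t, smul_comm]

variable {ρ}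

lemma e_mem_wt {χ : Module.Dual ℂ H} {m : M} (hm : m ∈ ρ.wt χ) (i : ι) :
    ρ.e i m ∈ ρ.wt (χ + R.root i) := by
  intro t
  rw [apply_lie_comm, ρ.lie_he, hm t]
  simp [add_smul, add_comm]

lemma f_mem_wt {χ : Module.Dual ℂ H} {m : M} (hm : m ∈ ρ.wt χ) (i : ι) :
    ρ.f i m ∈ ρ.wt (χ - R.root i) := by
  intro t
  rw [apply_lie_comm, ρ.lie_hf, hm t]
  simp [sub_smul]
  abel

lemma E_mem_wt {χ : Module.Dual ℂ H} {m : M} (hm : m ∈ ρ.wt χ) (w : List ι × ι) (c : ℂ) :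
    ρ.E (Finsupp.single w c) m ∈ ρ.wt (χ + R.rootSum (content (w.2 :: w.1))) := by
  intro t
  rw [apply_lie_comm, lie_h_E, hm t, wordWeight_single]
  have h : R.rootSum (content (w.2 :: w.1)) t = wordSum (fun i => R.root i t) w := by
    rw [R.rootSum_content_apply, wordSum, List.map_cons, List.sum_cons, add_comm]
  have h2 : Finsupp.single w (wordSum (fun i => R.root i t) w * c) =
      wordSum (fun i => R.root i t) w • Finsupp.single w c := by simp
  rw [LinearMap.add_apply, add_smul, h, h2, map_smul, map_smul, add_comm]
  rfl

variable (ρ)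

/-- The product of the operators `f i` along a word. -/
def fprod (w : List ι) : Module.End ℂ M := (w.map ρ.f).prod

/-- The product of the operators `e i` along a word. -/
def eprod (w : List ι) : Module.End ℂ M := (w.map ρ.e).prod

lemma fprod_cons (i : ι) (w : List ι) (m : M) : ρ.fprod (i :: w) m = ρ.f i (ρ.fprod w m) := by
  simp [fprod]

lemma eprod_cons (i : ι) (w : List ι) (m : M) : ρ.eprod (i :: w) m = ρ.e i (ρ.eprod w m) := by
  simp [eprod]

@[simp] lemma fprod_nil (m : M) : ρ.fprod [] m = m := by simp [fprod]

@[simp] lemma eprod_nil (m : M) : ρ.eprod [] m = m := by simp [eprod]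

variable {ρ}

lemma fprod_mem_wt {χ : Module.Dual ℂ H} {m : M} (hm : m ∈ ρ.wt χ) (w : List ι) :
    ρ.fprod w m ∈ ρ.wt (χ - R.rootSum (content w)) := by
  induction w with
  | nil => simpa [content] using hm
  | cons i w ih =>
    rw [fprod_cons, content, R.rootSum_add, R.rootSum_single, ← sub_sub]
    exact f_mem_wt ih i

lemma eprod_mem_wt {χ : Module.Dual ℂ H} {m : M} (hm : m ∈ ρ.wt χ) (w : List ι) :
    ρ.eprod w m ∈ ρ.wt (χ + R.rootSum (content w)) := by
  induction w with
  | nil => simpa [content] using hm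
  | cons i w ih =>
    rw [eprod_cons, content, R.rootSum_add, R.rootSum_single, ← add_assoc]
    exact e_mem_wt ih i

/-- Components of a sum of weight vectors lie in every subspace stable under `h` that contains
the sum. -/
lemma mem_of_sum_mem {p : Submodule ℂ M} (hp : ∀ t, ∀ m ∈ p, ρ.h t m ∈ p)
    (s : Finset (Module.Dual ℂ H)) (m : Module.Dual ℂ H → M) (hm : ∀ χ ∈ s, m χ ∈ ρ.wt χ)
    (hsum : ∑ χ ∈ s, m χ ∈ p) : ∀ χ ∈ s, m χ ∈ p := by
  classical
  induction s using Finset.induction_on generalizing m with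
  | empty => simp
  | insert χ₀ s h0 ih =>
    rw [Finset.sum_insert h0] at hsum
    have h1 : ∀ χ ∈ s, m χ ∈ p := by
      intro χ hχ
      have hne : χ ≠ χ₀ := by rintro rfl; exact h0 hχ
      -- With such a `t`, the operator `h t - χ₀ t` kills the component at `χ₀` and multiplies the
      -- one at `χ` by a nonzero scalar, so the induction hypothesis applies to the remaining sum.
      obtain ⟨t, ht⟩ : ∃ t, χ t ≠ χ₀ t := by
        by_contra! h
        exact hne (LinearMap.ext h)
      have h2 := sub_mem (hp t _ hsum) (p.smul_mem (χ₀ t) hsum)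
      have h3 : ρ.h t (m χ₀ + ∑ χ ∈ s, m χ) - χ₀ t • (m χ₀ + ∑ χ ∈ s, m χ) =
          ∑ χ ∈ s, (χ t - χ₀ t) • m χ := by
        rw [map_add, hm χ₀ (Finset.mem_insert_self _ _) t, smul_add, add_sub_add_left_eq_sub,
          map_sum, Finset.smul_sum, ← Finset.sum_sub_distrib]
        refine Finset.sum_congr rfl fun ψ hψ => ?_
        rw [hm ψ (Finset.mem_insert_of_mem hψ) t, sub_smul]
      rw [h3] at h2
      have h4 := ih (fun χ => (χ t - χ₀ t) • m χ)
        (fun ψ hψ => Submodule.smul_mem _ _ (hm ψ (Finset.mem_insert_of_mem hψ))) h2 χ hχ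
      exact (p.smul_mem_iff (sub_ne_zero.2 ht)).1 h4
    intro χ hχ
    rcases Finset.mem_insert.1 hχ with rfl | hχ
    · exact (p.add_mem_iff_left (Submodule.sum_mem _ h1)).1 hsum
    · exact h1 χ hχ

/-- Grouping a combination of weight vectors by weights. -/
lemma exists_weight_decomposition {K : Type*} {x : K → M} {χ : K → Module.Dual ℂ H}
    (hx : ∀ k, x k ∈ ρ.wt (χ k)) {m : M} (hm : m ∈ Submodule.span ℂ (Set.range x)) :
    ∃ (s : Finset (Module.Dual ℂ H)) (y : Module.Dual ℂ H → M),
      (∀ ψ, y ψ ∈ ρ.wt ψ ∧ y ψ ∈ Submodule.span ℂ (x '' {k | χ k = ψ})) ∧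
      (∀ ψ ∉ s, y ψ = 0) ∧ (∀ ψ ∈ s, ∃ k, χ k = ψ) ∧ m = ∑ ψ ∈ s, y ψ := by
  classical
  obtain ⟨c, rfl⟩ := Finsupp.mem_span_range_iff_exists_finsupp.1 hm
  refine ⟨c.support.image χ, fun ψ => ∑ k ∈ c.support with χ k = ψ, c k • x k, fun ψ => ⟨?_, ?_⟩,
    fun ψ hψ => ?_, fun ψ hψ => ?_, ?_⟩
  · refine Submodule.sum_mem _ fun k hk => Submodule.smul_mem _ _ ?_
    rw [← (Finset.mem_filter.1 hk).2]
    exact hx k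
  · refine Submodule.sum_mem _ fun k hk => Submodule.smul_mem _ _ (Submodule.subset_span ?_)
    exact ⟨k, (Finset.mem_filter.1 hk).2, rfl⟩
  · refine Finset.sum_eq_zero fun k hk => ?_
    obtain ⟨h1, h2⟩ := Finset.mem_filter.1 hk
    exact absurd (Finset.mem_image.2 ⟨k, h1, h2⟩) hψ
  · obtain ⟨k, _, hk⟩ := Finset.mem_image.1 hψ
    exact ⟨k, hk⟩
  · rw [Finsupp.sum]
    exact (Finset.sum_fiberwise_of_maps_to (fun k hk => Finset.mem_image_of_mem χ hk) _).symm

/-- The component of weight `ψ` of a vector of a subspace stable under `h`. -/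
lemma exists_component {K : Type*} {x : K → M} {χ : K → Module.Dual ℂ H}
    (hx : ∀ k, x k ∈ ρ.wt (χ k)) {p : Submodule ℂ M} (hp : ∀ t, ∀ m ∈ p, ρ.h t m ∈ p)
    {m : M} (hm : m ∈ Submodule.span ℂ (Set.range x)) (hmp : m ∈ p) (ψ : Module.Dual ℂ H) :
    ∃ y ∈ p, y ∈ ρ.wt ψ ∧ y ∈ Submodule.span ℂ (x '' {k | χ k = ψ}) ∧
      m - y ∈ Submodule.span ℂ (x '' {k | χ k ≠ ψ}) := by
  classical
  obtain ⟨s, y, hy, hy0, -, rfl⟩ := exists_weight_decomposition hx hm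
  have h1 := mem_of_sum_mem hp s y (fun χ _ => (hy χ).1) hmp
  refine ⟨y ψ, ?_, (hy ψ).1, (hy ψ).2, ?_⟩
  · by_cases h : ψ ∈ s
    · exact h1 ψ h
    · rw [hy0 ψ h]; exact zero_mem _
  · have : ∑ ψ ∈ s, y ψ - y ψ = ∑ ψ' ∈ s.erase ψ, y ψ' := by
      by_cases h : ψ ∈ s
      · rw [← Finset.add_sum_erase s y h]; abel
      · rw [Finset.erase_eq_of_notMem h, hy0 ψ h, sub_zero]
    rw [this]
    refine Submodule.sum_mem _ fun φ hφ => ?_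
    refine Submodule.span_mono (Set.image_mono ?_) (hy φ).2
    intro k hk
    rw [Set.mem_ofPred_eq] at hk ⊢
    rw [hk]
    exact Finset.ne_of_mem_erase hφ

lemma mem_span_weight {K : Type*} {x : K → M} {χ : K → Module.Dual ℂ H}
    (hx : ∀ k, x k ∈ ρ.wt (χ k)) {m : M} (hm : m ∈ Submodule.span ℂ (Set.range x))
    {ψ : Module.Dual ℂ H} (hψ : m ∈ ρ.wt ψ) : m ∈ Submodule.span ℂ (x '' {k | χ k = ψ}) := by
  classical
  obtain ⟨s, y, hy, hy0, -, rfl⟩ := exists_weight_decomposition hx hm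
  -- Independence of weight spaces: `∑ y φ - m = 0` is read as a sum of weight vectors whose
  -- component at `ψ` is `y ψ - m`. That component is therefore zero.
  have h1 := mem_of_sum_mem (ρ := ρ) (p := ⊥) (by simp) (insert ψ s)
    (fun φ => if φ = ψ then y ψ - ∑ φ ∈ s, y φ else y φ) (fun φ _ => by
      split_ifs with h
      · rw [h]; exact sub_mem (hy ψ).1 hψ
      · exact (hy φ).1) (by
      rw [Submodule.mem_bot, ← Finset.add_sum_erase _ _ (Finset.mem_insert_self ψ s), if_pos rfl,
        Finset.sum_congr rfl (g := y) (fun φ hφ => if_neg (Finset.ne_of_mem_erase hφ)),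
        sub_add_eq_add_sub, Finset.add_sum_erase _ _ (Finset.mem_insert_self ψ s), sub_eq_zero]
      by_cases h : ψ ∈ s
      · rw [Finset.insert_eq_of_mem h]
      · rw [Finset.sum_insert h, hy0 ψ h, zero_add]) ψ (Finset.mem_insert_self _ _)
  rw [if_pos rfl, Submodule.mem_bot, sub_eq_zero] at h1
  rw [← h1]
  exact (hy ψ).2

lemma exists_weight_of_mem_wt {K : Type*} {x : K → M} {χ : K → Module.Dual ℂ H}
    (hx : ∀ k, x k ∈ ρ.wt (χ k)) {m : M} (hm : m ∈ Submodule.span ℂ (Set.range x))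
    {ψ : Module.Dual ℂ H} (hψ : m ∈ ρ.wt ψ) (h0 : m ≠ 0) : ∃ k, χ k = ψ := by
  by_contra! h
  have := mem_span_weight hx hm hψ
  rw [Set.eq_empty_iff_forall_notMem.2 (fun k hk => h k hk : ∀ k, k ∉ {k | χ k = ψ}),
    Set.image_empty, Submodule.span_empty] at this
  exact h0 this

lemma exists_weight_vector {K : Type*} {x : K → M} {χ : K → Module.Dual ℂ H}
    (hx : ∀ k, x k ∈ ρ.wt (χ k)) {p : Submodule ℂ M} (hp : ∀ t, ∀ m ∈ p, ρ.h t m ∈ p)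
    {m : M} (hm : m ∈ Submodule.span ℂ (Set.range x)) (hmp : m ∈ p) (h0 : m ≠ 0) :
    ∃ k, ∃ y ∈ p, y ∈ ρ.wt (χ k) ∧ y ∈ Submodule.span ℂ (x '' {k' | χ k' = χ k}) ∧ y ≠ 0 := by
  obtain ⟨s, y, hy, hy0, hs, rfl⟩ := exists_weight_decomposition hx hm
  have h1 := mem_of_sum_mem hp s y (fun χ _ => (hy χ).1) hmp
  obtain ⟨ψ, hψ, hne⟩ := Finset.exists_ne_zero_of_sum_ne_zero h0
  obtain ⟨k, rfl⟩ := hs ψ hψ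
  exact ⟨k, _, h1 _ hψ, (hy _).1, (hy _).2, hne⟩

/-! ### Representations with weights bounded above. -/

variable (ρ)

/-- All weights lie below `κ`. -/
def BoundedBy (κ : Module.Dual ℂ H) : Prop :=
  ∀ χ, ∀ m ∈ ρ.wt χ, m ≠ 0 → ∃ β, χ = κ - R.rootSum β

variable {ρ}

lemma boundedBy_of_span {K : Type*} {x : K → M} {κ : Module.Dual ℂ H} {β : K → ι → ℕ}
    (hx : ∀ k, x k ∈ ρ.wt (κ - R.rootSum (β k))) (htop : Submodule.span ℂ (Set.range x) = ⊤) :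
    ρ.BoundedBy κ := by
  intro χ m hm h0
  obtain ⟨k, rfl⟩ := exists_weight_of_mem_wt hx (htop ▸ Submodule.mem_top) hm h0
  exact ⟨_, rfl⟩

lemma eprod_eq_zero {κ : Module.Dual ℂ H} (hκ : ρ.BoundedBy κ) {β : ι → ℕ} {m : M}
    (hm : m ∈ ρ.wt (κ - R.rootSum β)) {w : List ι} (hw : ¬ content w ≤ β) : ρ.eprod w m = 0 := by
  by_contra h0
  obtain ⟨γ, hγ⟩ := hκ _ _ (eprod_mem_wt hm w) h0
  refine hw ?_
  have : R.rootSum (content w + γ) = R.rootSum β := by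
    rw [R.rootSum_add]
    linear_combination (norm := module) (1 : ℂ) • hγ
  rw [← R.rootSum_injective this]
  exact le_self_add

/-- A word of prefix length `n` raises by `n + 1` simple roots, one more than the depth of `m`
allows. This makes truncation of the Casimir operator harmless. -/
lemma E_eq_zero {κ : Module.Dual ℂ H} (hκ : ρ.BoundedBy κ) {β : ι → ℕ} {m : M}
    (hm : m ∈ ρ.wt (κ - R.rootSum β)) {n : ℕ} (hn : ∑ i, β i ≤ n) {x : WordSpace ι}
    (hx : x ∈ wordsOfLength ι n) : ρ.E x m = 0 := by
  refine wordsOfLength_induction (p := fun x => ρ.E x m = 0) (by simp)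
    (fun x y hx hy => by rw [map_add, LinearMap.add_apply, hx, hy, add_zero]) ?_ hx
  intro w hw c
  by_contra h0
  obtain ⟨γ, hγ⟩ := hκ _ _ (E_mem_wt hm w c) h0
  have : R.rootSum (content (w.2 :: w.1) + γ) = R.rootSum β := by
    rw [R.rootSum_add]
    linear_combination (norm := module) (1 : ℂ) • hγ
  have h1 := congrArg (fun β => ∑ i, β i) (R.rootSum_injective this)
  simp only [Pi.add_apply, Finset.sum_add_distrib, sum_content, List.length_cons, hw] at h1
  omega

end WeakRep

end

section

variable {ι : Type*} [Fintype ι] [DecidableEq ι] {A : Matrix ι ι ℤ}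
  {H : Type*} [AddCommGroup H] [Module ℂ H] {R : Realization A H}
  {M : Type*} [AddCommGroup M] [Module ℂ M] {N : Type*} [AddCommGroup N] [Module ℂ N]

namespace WeakRep

/-! ### Homomorphisms, quotients and tensor products -/

/-- Linear maps commuting with the Chevalley operators. -/
structure IsHom (ρ : WeakRep R M) (σ : WeakRep R N) (φ : M →ₗ[ℂ] N) : Prop where
  h : ∀ t m, φ (ρ.h t m) = σ.h t (φ m)
  e : ∀ i m, φ (ρ.e i m) = σ.e i (φ m)
  f : ∀ i m, φ (ρ.f i m) = σ.f i (φ m)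

omit [Fintype ι] [DecidableEq ι] in
lemma bracket_map {a : ι → Module.End ℂ M} {b : ι → Module.End ℂ N} {φ : M →ₗ[ℂ] N}
    (hφ : ∀ i m, φ (a i m) = b i (φ m)) (x : WordSpace ι) (m : M) :
    φ (bracket a x m) = bracket b x (φ m) := by
  induction x using word_induction generalizing m with
  | h0 => simp
  | hadd x y hx hy => simp [hx, hy]
  | hnil k c => simp [bracketWord, hφ]
  | hcons i x ih => simp [bracket_consWord, Ring.lie_def, ih, hφ]

namespace IsHom

variable {ρ : WeakRep R M} {σ : WeakRep R N} {φ : M →ₗ[ℂ] N} (hφ : IsHom ρ σ φ)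
include hφ

lemma map_F (x : WordSpace ι) (m : M) : φ (ρ.F x m) = σ.F x (φ m) := bracket_map hφ.f x m

lemma stable_ker : ρ.Stable (LinearMap.ker φ) where
  h t m hm := by rw [LinearMap.mem_ker] at *; rw [hφ.h, hm, map_zero]
  e t m hm := by rw [LinearMap.mem_ker] at *; rw [hφ.e, hm, map_zero]
  f t m hm := by rw [LinearMap.mem_ker] at *; rw [hφ.f, hm, map_zero]

lemma map_wt {χ : Module.Dual ℂ H} {m : M} (hm : m ∈ ρ.wt χ) : φ m ∈ σ.wt χ := fun t => by
  rw [← hφ.h, hm t, map_smul]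

lemma map_fprod (w : List ι) (m : M) : φ (ρ.fprod w m) = σ.fprod w (φ m) := by
  induction w with
  | nil => simp
  | cons i w ih => rw [fprod_cons, fprod_cons, hφ.f, ih]

end IsHom

/-- The quotient by a stable subspace. -/
def quotient (ρ : WeakRep R M) (p : Submodule ℂ M) (hp : ρ.Stable p) : WeakRep R (M ⧸ p) where
  h :=
    { toFun := fun t => p.mapQ p (ρ.h t) (hp.h t)
      map_add' := fun s t => by
        refine LinearMap.ext fun y => ?_
        obtain ⟨m, rfl⟩ := p.mkQ_surjective y
        exact congrArg p.mkQ (LinearMap.congr_fun (map_add ρ.h s t) m)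
      map_smul' := fun c t => by
        refine LinearMap.ext fun y => ?_
        obtain ⟨m, rfl⟩ := p.mkQ_surjective y
        exact congrArg p.mkQ (LinearMap.congr_fun (map_smul ρ.h c t) m) }
  e i := p.mapQ p (ρ.e i) (hp.e i)
  f i := p.mapQ p (ρ.f i) (hp.f i)
  lie_hh s t := by
    refine LinearMap.ext fun y => ?_
    obtain ⟨m, rfl⟩ := p.mkQ_surjective y
    exact congrArg p.mkQ (LinearMap.congr_fun (ρ.lie_hh s t) m)
  lie_he t i := by
    refine LinearMap.ext fun y => ?_
    obtain ⟨m, rfl⟩ := p.mkQ_surjective y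
    exact congrArg p.mkQ (LinearMap.congr_fun (ρ.lie_he t i) m)
  lie_hf t i := by
    refine LinearMap.ext fun y => ?_
    obtain ⟨m, rfl⟩ := p.mkQ_surjective y
    exact congrArg p.mkQ (LinearMap.congr_fun (ρ.lie_hf t i) m)
  lie_ef i j := by
    refine LinearMap.ext fun y => ?_
    obtain ⟨m, rfl⟩ := p.mkQ_surjective y
    refine (congrArg p.mkQ (LinearMap.congr_fun (ρ.lie_ef i j) m)).trans ?_
    split_ifs <;> rfl

lemma isHom_mkQ (ρ : WeakRep R M) (p : Submodule ℂ M) (hp : ρ.Stable p) :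
    IsHom ρ (ρ.quotient p hp) p.mkQ := ⟨fun _ _ => rfl, fun _ _ => rfl, fun _ _ => rfl⟩

/-- The diagonal action of a pair of operators on a tensor product. -/
def diagOp (a : Module.End ℂ M) (b : Module.End ℂ N) : Module.End ℂ (M ⊗[ℂ] N) :=
  a.rTensor N + b.lTensor M

omit [Fintype ι] [DecidableEq ι] in
@[simp] lemma diagOp_tmul (a : Module.End ℂ M) (b : Module.End ℂ N) (m : M) (n : N) :
    diagOp a b (m ⊗ₜ n) = a m ⊗ₜ n + m ⊗ₜ b n := by
  simp [diagOp]

lemma lie_diagOp (a a' : Module.End ℂ M) (b b' : Module.End ℂ N) :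
    ⁅diagOp a b, diagOp a' b'⁆ = diagOp ⁅a, a'⁆ ⁅b, b'⁆ := by
  refine TensorProduct.ext' fun m n => ?_
  simp only [Ring.lie_def, LinearMap.sub_apply, Module.End.mul_apply, diagOp_tmul, map_add,
    TensorProduct.tmul_sub, TensorProduct.sub_tmul]
  abel

/-- The tensor product. -/
def tensor (ρ : WeakRep R M) (σ : WeakRep R N) : WeakRep R (M ⊗[ℂ] N) where
  h :=
    { toFun := fun t => diagOp (ρ.h t) (σ.h t)
      map_add' := fun s t => TensorProduct.ext' fun m n => by
        simp [TensorProduct.add_tmul, TensorProduct.tmul_add]; abel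
      map_smul' := fun c t => TensorProduct.ext' fun m n => by
        simp [TensorProduct.smul_tmul'] }
  e i := diagOp (ρ.e i) (σ.e i)
  f i := diagOp (ρ.f i) (σ.f i)
  lie_hh s t := by
    change ⁅diagOp _ _, diagOp _ _⁆ = _
    rw [lie_diagOp, ρ.lie_hh, σ.lie_hh]
    simp [diagOp]
  lie_he t i := by
    change ⁅diagOp _ _, diagOp _ _⁆ = _
    rw [lie_diagOp, ρ.lie_he, σ.lie_he]
    simp [diagOp]
  lie_hf t i := by
    change ⁅diagOp _ _, diagOp _ _⁆ = _
    rw [lie_diagOp, ρ.lie_hf, σ.lie_hf]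
    simp [diagOp]
    abel
  lie_ef i j := by
    change ⁅diagOp _ _, diagOp _ _⁆ = _
    rw [lie_diagOp, ρ.lie_ef, σ.lie_ef]
    split_ifs
    · rfl
    · simp [diagOp]

section

variable (ρ : WeakRep R M) (σ : WeakRep R N)

@[simp] lemma tensor_h_tmul (t : H) (m : M) (n : N) :
    (ρ.tensor σ).h t (m ⊗ₜ n) = ρ.h t m ⊗ₜ n + m ⊗ₜ σ.h t n := diagOp_tmul _ _ _ _

@[simp] lemma tensor_e_tmul (i : ι) (m : M) (n : N) :
    (ρ.tensor σ).e i (m ⊗ₜ n) = ρ.e i m ⊗ₜ n + m ⊗ₜ σ.e i n := diagOp_tmul _ _ _ _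

@[simp] lemma tensor_f_tmul (i : ι) (m : M) (n : N) :
    (ρ.tensor σ).f i (m ⊗ₜ n) = ρ.f i m ⊗ₜ n + m ⊗ₜ σ.f i n := diagOp_tmul _ _ _ _

end

lemma bracket_diagOp (a : ι → Module.End ℂ M) (b : ι → Module.End ℂ N) (x : WordSpace ι) :
    bracket (fun i => diagOp (a i) (b i)) x = diagOp (bracket a x) (bracket b x) := by
  induction x using word_induction with
  | h0 => simp [diagOp]
  | hadd x y hx hy =>
    rw [map_add, map_add, map_add, hx, hy]
    simp only [diagOp, LinearMap.rTensor_add, LinearMap.lTensor_add]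
    abel
  | hnil k c => simp [bracketWord, diagOp]
  | hcons i x ih => rw [bracket_consWord, ih, lie_diagOp, bracket_consWord, bracket_consWord]

lemma RadTrivial.tensor {ρ : WeakRep R M} {σ : WeakRep R N} {d : ι → ℝ} (hρ : ρ.RadTrivial d)
    (hσ : σ.RadTrivial d) : (ρ.tensor σ).RadTrivial d := by
  intro x hx
  constructor
  · refine (bracket_diagOp _ _ x).trans ?_
    change diagOp (ρ.E x) (σ.E x) = 0
    rw [(hρ x hx).1, (hσ x hx).1]
    simp [diagOp]
  · refine (bracket_diagOp _ _ x).trans ?_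
    change diagOp (ρ.F x) (σ.F x) = 0
    rw [(hρ x hx).2, (hσ x hx).2]
    simp [diagOp]

lemma tmul_mem_wt {ρ : WeakRep R M} {σ : WeakRep R N} {χ ψ : Module.Dual ℂ H} {m : M} {n : N}
    (hm : m ∈ ρ.wt χ) (hn : n ∈ σ.wt ψ) : m ⊗ₜ[ℂ] n ∈ (ρ.tensor σ).wt (χ + ψ) := by
  intro t
  rw [tensor_h_tmul, hm t, hn t, LinearMap.add_apply, add_smul, TensorProduct.smul_tmul',
    TensorProduct.tmul_smul]

/-! ### Highest weight vectors -/

/-- `v` is a highest weight vector of weight `κ`. -/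
structure IsHighest (ρ : WeakRep R M) (κ : Module.Dual ℂ H) (v : M) : Prop where
  mem : v ∈ ρ.wt κ
  e : ∀ i, ρ.e i v = 0
  ne_zero : v ≠ 0

/-- The subspace spanned by the vectors obtained from `v` by the operators `f i`. -/
def fspan (ρ : WeakRep R M) (v : M) : Submodule ℂ M :=
  Submodule.span ℂ (Set.range fun w => ρ.fprod w v)

variable {ρ : WeakRep R M}

lemma fprod_mem_fspan (w : List ι) (v : M) : ρ.fprod w v ∈ ρ.fspan v :=
  Submodule.subset_span ⟨w, rfl⟩

lemma self_mem_fspan (v : M) : v ∈ ρ.fspan v := fprod_mem_fspan [] v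

lemma Stable.fprod_mem {p : Submodule ℂ M} (hp : ρ.Stable p) {v : M} (hv : v ∈ p) (w : List ι) :
    ρ.fprod w v ∈ p := by
  induction w with
  | nil => simpa
  | cons i w ih => rw [fprod_cons]; exact hp.f i _ ih

lemma Stable.fspan_le {p : Submodule ℂ M} (hp : ρ.Stable p) {v : M} (hv : v ∈ p) :
    ρ.fspan v ≤ p := by
  rw [fspan, Submodule.span_le]
  rintro _ ⟨w, rfl⟩
  exact hp.fprod_mem hv w

lemma stable_fspan {κ : Module.Dual ℂ H} {v : M} (hv : v ∈ ρ.wt κ) (he : ∀ i, ρ.e i v = 0) :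
    ρ.Stable (ρ.fspan v) := by
  have key : ∀ a : Module.End ℂ M, (∀ w, a (ρ.fprod w v) ∈ ρ.fspan v) →
      ∀ m ∈ ρ.fspan v, a m ∈ ρ.fspan v := by
    intro a ha
    change ρ.fspan v ≤ (ρ.fspan v).comap a
    rw [fspan, Submodule.span_le]
    rintro _ ⟨w, rfl⟩
    exact ha w
  have hh : ∀ t w, ρ.h t (ρ.fprod w v) ∈ ρ.fspan v := by
    intro t w
    rw [fprod_mem_wt hv w t]
    exact Submodule.smul_mem _ _ (fprod_mem_fspan w v)
  have hf : ∀ i, ∀ m ∈ ρ.fspan v, ρ.f i m ∈ ρ.fspan v := fun i => key _ fun w => by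
    rw [← fprod_cons]; exact fprod_mem_fspan _ v
  refine ⟨fun t => key _ (hh t), fun i => key _ fun w => ?_, hf⟩
  induction w with
  | nil => simp [he]
  | cons j w ih =>
    rw [fprod_cons, apply_lie_comm, ρ.lie_ef]
    refine add_mem ?_ (hf j _ ih)
    split_ifs
    · exact hh _ w
    · simp

lemma fspan_boundedBy {κ : Module.Dual ℂ H} {v : M} (hv : v ∈ ρ.wt κ) (htop : ρ.fspan v = ⊤) :
    ρ.BoundedBy κ :=
  boundedBy_of_span (fprod_mem_wt hv) htop

/-- In the span of the `f`-words of a weight vector the highest weight space is a line. -/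
lemma mem_span_of_mem_wt {κ : Module.Dual ℂ H} {v : M} (hv : v ∈ ρ.wt κ) {m : M}
    (hm : m ∈ ρ.fspan v) (hκ : m ∈ ρ.wt κ) : ∃ c : ℂ, m = c • v := by
  have h := mem_span_weight (fprod_mem_wt hv) hm hκ
  have h2 : {w | κ - R.rootSum (content w) = κ} ⊆ {[]} := by
    intro w hw
    have : R.rootSum (content w) = R.rootSum 0 := by simpa using hw
    have := congrArg (fun β => ∑ i, β i) (R.rootSum_injective this)
    simpa [sum_content] using this
  have h3 := Submodule.span_mono (R := ℂ) (Set.image_mono (f := fun w => ρ.fprod w v) h2) h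
  rw [Set.image_singleton, Submodule.mem_span_singleton] at h3
  obtain ⟨c, hc⟩ := h3
  exact ⟨c, by simpa using hc.symm⟩

/-- Brackets of the `f i` map everything into the span of nonempty `f`-words, which has no vector of
the highest weight. -/
lemma radF_ne_top {κ : Module.Dual ℂ H} {v : M} (hv : ρ.IsHighest κ v) (htop : ρ.fspan v = ⊤)
    (d : ι → ℝ) : ρ.radF d ≠ ⊤ := by
  have hle : ρ.radF d ≤ Submodule.span ℂ ((fun w => ρ.fprod w v) '' {w | w ≠ []}) := by
    rw [radF, Submodule.span_le]
    rintro _ ⟨x, -, m, rfl⟩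
    have hf : ∀ i m, ρ.f i m ∈ Submodule.span ℂ ((fun w => ρ.fprod w v) '' {w | w ≠ []}) := by
      intro i m
      have hm : m ∈ ρ.fspan v := htop ▸ Submodule.mem_top
      have : ρ.fspan v ≤ (Submodule.span ℂ ((fun w => ρ.fprod w v) '' {w | w ≠ []})).comap
          (ρ.f i) := by
        rw [fspan, Submodule.span_le]
        rintro _ ⟨w, rfl⟩
        exact Submodule.subset_span ⟨i :: w, by simp, fprod_cons _ _ _ _⟩
      exact this hm
    have key : ∀ x, ∀ m, ρ.F x m ∈
        Submodule.span ℂ ((fun w => ρ.fprod w v) '' {w | w ≠ []}) := by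
      intro x
      induction x using word_induction with
      | h0 => simp
      | hadd x y hx hy =>
        intro m
        rw [map_add]
        exact add_mem (hx m) (hy m)
      | hnil k c =>
        intro m
        rw [F_single_nil]
        exact Submodule.smul_mem _ _ (hf k m)
      | hcons i x ih =>
        intro m
        rw [F_consWord, Ring.lie_def]
        exact sub_mem (hf i _) (ih _)
    exact key x m
  intro htop'
  have hv' : v ∈ Submodule.span ℂ ((fun w => ρ.fprod w v) '' {w | w ≠ []}) :=
    hle (htop' ▸ Submodule.mem_top)
  rw [Set.image_eq_range] at hv'
  obtain ⟨⟨w, hw⟩, hk⟩ := exists_weight_of_mem_wt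
    (x := fun w : {w : List ι | w ≠ []} => ρ.fprod w v)
    (χ := fun w => κ - R.rootSum (content w.1)) (fun w => fprod_mem_wt hv.mem w.1) hv' hv.mem
    hv.ne_zero
  have : R.rootSum (content w) = R.rootSum 0 := by simpa using hk
  have := congrArg (fun β => ∑ i, β i) (R.rootSum_injective this)
  exact hw (by simpa [sum_content] using this)

end WeakRep

/-! ### The universal highest weight representation -/

section Verma

variable (R) (κ : Module.Dual ℂ H)

/-- The space of `f`-words. -/
abbrev FreeVerma (ι : Type*) : Type _ := List ι →₀ ℂ

/-- Prepending a letter. -/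
def vermaF (i : ι) : Module.End ℂ (FreeVerma ι) := Finsupp.lmapDomain ℂ ℂ (List.cons i)

/-- The weight operators on `f`-words. -/
def vermaH (t : H) : Module.End ℂ (FreeVerma ι) :=
  Finsupp.linearCombination ℂ (fun w => Finsupp.single w ((κ - R.rootSum (content w)) t))

/-- The action of `e j` on an `f`-word. -/
def vermaEWord (j : ι) : List ι → FreeVerma ι
  | [] => 0
  | i :: w => vermaF i (vermaEWord j w) +
      if i = j then Finsupp.single w ((κ - R.rootSum (content w)) (R.coroot j)) else 0

/-- The action of `e j` on combinations of `f`-words. -/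
def vermaE (j : ι) : Module.End ℂ (FreeVerma ι) :=
  Finsupp.linearCombination ℂ (vermaEWord R κ j)

variable {R κ}

omit [Fintype ι] [DecidableEq ι] in
lemma vermaF_single (i : ι) (w : List ι) (c : ℂ) :
    vermaF i (Finsupp.single w c) = Finsupp.single (i :: w) c := by
  simp [vermaF, Finsupp.mapDomain_single]

lemma vermaH_single (t : H) (w : List ι) (c : ℂ) :
    vermaH R κ t (Finsupp.single w c) =
      Finsupp.single w ((κ - R.rootSum (content w)) t * c) := by
  simp only [vermaH, Finsupp.linearCombination_single, Finsupp.smul_single, smul_eq_mul, mul_comm]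

lemma vermaE_single (j : ι) (w : List ι) (c : ℂ) :
    vermaE R κ j (Finsupp.single w c) = c • vermaEWord R κ j w := by
  simp [vermaE]

lemma lie_vermaH_vermaF (t : H) (i : ι) :
    ⁅vermaH R κ t, vermaF i⁆ = -(R.root i t • vermaF i) := by
  refine Finsupp.lhom_ext fun w c => ?_
  change vermaH R κ t (vermaF i _) - vermaF i (vermaH R κ t _) = _
  rw [LinearMap.neg_apply, LinearMap.smul_apply, vermaF_single, vermaH_single, vermaH_single,
    vermaF_single, ← Finsupp.single_sub, Finsupp.smul_single, ← Finsupp.single_neg, content,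
    R.rootSum_add, R.rootSum_single]
  congr 1
  simp
  ring

lemma lie_vermaE_vermaF (j i : ι) :
    ⁅vermaE R κ j, vermaF i⁆ = if j = i then vermaH R κ (R.coroot j) else 0 := by
  refine Finsupp.lhom_ext fun w c => ?_
  change vermaE R κ j (vermaF i _) - vermaF i (vermaE R κ j _) = _
  rw [vermaF_single, vermaE_single, vermaE_single, vermaEWord, smul_add, map_smul, add_sub_cancel_left]
  by_cases h : i = j
  · subst h
    rw [if_pos rfl, if_pos rfl, vermaH_single, Finsupp.smul_single, smul_eq_mul, mul_comm]
  · rw [if_neg h, if_neg (Ne.symm h)]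
    simp

lemma lie_vermaH_vermaE (t : H) (j : ι) :
    ⁅vermaH R κ t, vermaE R κ j⁆ = R.root j t • vermaE R κ j := by
  refine Finsupp.lhom_ext fun w c => ?_
  suffices h : vermaH R κ t (vermaEWord R κ j w) =
      ((κ - R.rootSum (content w)) t + R.root j t) • vermaEWord R κ j w by
    change vermaH R κ t (vermaE R κ j _) - vermaE R κ j (vermaH R κ t _) = _
    rw [LinearMap.smul_apply, vermaH_single, vermaE_single, vermaE_single, map_smul, h]
    module
  induction w with
  | nil => simp [vermaEWord]
  | cons i w ih =>
    have h1 := LinearMap.congr_fun (lie_vermaH_vermaF (R := R) (κ := κ) t i) (vermaEWord R κ j w)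
    change vermaH R κ t (vermaF i _) - vermaF i (vermaH R κ t _) = _ at h1
    rw [LinearMap.neg_apply, LinearMap.smul_apply, sub_eq_iff_eq_add, ih] at h1
    rw [vermaEWord, map_add, h1, content, R.rootSum_add, R.rootSum_single, smul_add]
    congr 1
    · simp only [map_smul, LinearMap.sub_apply, LinearMap.add_apply]
      module
    · split_ifs with h
      · subst h
        rw [vermaH_single, Finsupp.smul_single, smul_eq_mul]
        congr 1
        simp only [LinearMap.sub_apply, LinearMap.add_apply]
        ring
      · simp

variable (R κ)

/-- The universal highest weight representation of the Chevalley relations. -/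
def freeVermaRep : WeakRep R (FreeVerma ι) where
  h :=
    { toFun := vermaH R κ
      map_add' := fun s t => Finsupp.lhom_ext fun w c => by
        rw [LinearMap.add_apply, vermaH_single, vermaH_single, vermaH_single, ← Finsupp.single_add,
          map_add, add_mul]
      map_smul' := fun a t => Finsupp.lhom_ext fun w c => by
        rw [RingHom.id_apply, LinearMap.smul_apply, vermaH_single, vermaH_single,
          Finsupp.smul_single, map_smul, smul_eq_mul, smul_eq_mul, mul_assoc] }
  e := vermaE R κ
  f := vermaF
  lie_hh s t := Finsupp.lhom_ext fun w c => by
    change vermaH R κ s (vermaH R κ t _) - vermaH R κ t (vermaH R κ s _) = _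
    rw [vermaH_single, vermaH_single, vermaH_single, vermaH_single, mul_left_comm, sub_self]
    rfl
  lie_he := lie_vermaH_vermaE
  lie_hf := lie_vermaH_vermaF
  lie_ef := lie_vermaE_vermaF

lemma freeVermaRep_fprod (w : List ι) :
    (freeVermaRep R κ).fprod w (Finsupp.single [] 1) = Finsupp.single w 1 := by
  induction w with
  | nil => simp
  | cons i w ih =>
    rw [WeakRep.fprod_cons, ih]
    exact vermaF_single i w 1

lemma freeVermaRep_isHighest : (freeVermaRep R κ).IsHighest κ (Finsupp.single [] 1) where
  mem t := by
    change vermaH R κ t _ = _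
    rw [vermaH_single]
    simp [content]
  e i := by
    change vermaE R κ i _ = _
    rw [vermaE_single]
    simp [vermaEWord]
  ne_zero := by simp

lemma freeVermaRep_fspan : (freeVermaRep R κ).fspan (Finsupp.single [] 1) = ⊤ := by
  rw [eq_top_iff]
  intro x _
  rw [← Finsupp.sum_single x]
  refine Submodule.sum_mem _ fun w _ => ?_
  have h : Finsupp.single w (x w) =
      x w • (freeVermaRep R κ).fprod w (Finsupp.single [] 1) := by
    rw [freeVermaRep_fprod, Finsupp.smul_single, smul_eq_mul, mul_one]
  rw [h]
  exact Submodule.smul_mem _ _ (WeakRep.fprod_mem_fspan w _)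

variable {d : ι → ℝ} (hd : ∀ i, 0 < d i) (hs : ∀ i j, d i * A i j = d j * A j i)

/-- The underlying space of the universal highest weight representation on which the radical acts
by zero. -/
abbrev RadVerma (d : ι → ℝ) : Type _ := FreeVerma ι ⧸ (freeVermaRep R κ).radF d

/-- The universal highest weight representation on which the radical acts by zero. -/
def radVermaRep : WeakRep R (RadVerma R κ d) :=
  (freeVermaRep R κ).quotient _ ((freeVermaRep R κ).stable_radF hd hs)

/-- The generator of `RadVerma`. -/
def radVermaGen (d : ι → ℝ) : RadVerma R κ d := Submodule.mkQ _ (Finsupp.single [] 1)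

lemma isHom_radVerma : WeakRep.IsHom (freeVermaRep R κ) (radVermaRep R κ hd hs)
    (Submodule.mkQ ((freeVermaRep R κ).radF d)) := WeakRep.isHom_mkQ _ _ _

lemma radVermaRep_fspan : (radVermaRep R κ hd hs).fspan (radVermaGen R κ d) = ⊤ := by
  rw [eq_top_iff]
  intro y _
  obtain ⟨x, rfl⟩ := Submodule.mkQ_surjective _ y
  have hx : x ∈ (freeVermaRep R κ).fspan (Finsupp.single [] 1) :=
    freeVermaRep_fspan R κ ▸ Submodule.mem_top
  suffices h : (freeVermaRep R κ).fspan (Finsupp.single [] 1) ≤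
      ((radVermaRep R κ hd hs).fspan (radVermaGen R κ d)).comap
        (Submodule.mkQ ((freeVermaRep R κ).radF d)) from h hx
  rw [WeakRep.fspan, Submodule.span_le]
  rintro _ ⟨w, rfl⟩
  rw [SetLike.mem_coe, Submodule.mem_comap, (isHom_radVerma R κ hd hs).map_fprod]
  exact WeakRep.fprod_mem_fspan w _

lemma radVermaRep_isHighest : (radVermaRep R κ hd hs).IsHighest κ (radVermaGen R κ d) where
  mem := (isHom_radVerma R κ hd hs).map_wt (freeVermaRep_isHighest R κ).mem
  e i := by
    rw [radVermaGen, ← (isHom_radVerma R κ hd hs).e, (freeVermaRep_isHighest R κ).e, map_zero]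
  ne_zero := by
    intro h
    have h1 : Finsupp.single [] 1 ∈ (freeVermaRep R κ).radF d := by
      rwa [radVermaGen, Submodule.mkQ_apply, Submodule.Quotient.mk_eq_zero] at h
    refine WeakRep.radF_ne_top (freeVermaRep_isHighest R κ) (freeVermaRep_fspan R κ) d ?_
    rw [eq_top_iff, ← freeVermaRep_fspan R κ]
    exact ((freeVermaRep R κ).stable_radF hd hs).fspan_le h1

/-- The `f`-side vanishes by construction. On the `e`-side, `kerE` is stable and contains the
generator, so irreducibility is not needed. -/
lemma radVermaRep_radTrivial : (radVermaRep R κ hd hs).RadTrivial d := by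
  intro x hx
  constructor
  · have h : (radVermaRep R κ hd hs).kerE d = ⊤ := by
      rw [eq_top_iff, ← radVermaRep_fspan R κ hd hs]
      refine ((radVermaRep R κ hd hs).stable_kerE hd hs).fspan_le ?_
      exact (WeakRep.mem_kerE _).2 fun x _ =>
        bracket_apply_eq_zero _ (radVermaRep_isHighest R κ hd hs).e x
    refine LinearMap.ext fun m => ?_
    exact (WeakRep.mem_kerE _).1 (h ▸ Submodule.mem_top : m ∈ (radVermaRep R κ hd hs).kerE d) x hx
  · refine LinearMap.ext fun y => ?_
    obtain ⟨m, rfl⟩ := Submodule.mkQ_surjective _ y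
    rw [← (isHom_radVerma R κ hd hs).map_F, LinearMap.zero_apply, Submodule.mkQ_apply,
      Submodule.Quotient.mk_eq_zero]
    exact WeakRep.F_mem_radF _ hx m

end Verma

end

section

variable {ι : Type*} [Fintype ι] [DecidableEq ι] {A : Matrix ι ι ℤ}
  {H : Type*} [AddCommGroup H] [Module ℂ H] {R : Realization A H}
  {M : Type*} [AddCommGroup M] [Module ℂ M] {N : Type*} [AddCommGroup N] [Module ℂ N]

/-! ### Eigenvalues of the Casimir operator -/

section Eigenvalue

variable (A) (d : ι → ℝ)

/-- The difference of the values of the Casimir operator at weights that differ by `β`. -/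
def casimirValue (s : ℝ) (χ : ι → ℂ) (β : ι → ℕ) : ℂ :=
  ∑ i, β i * d i * (2 * χ i + s * ∑ j, (β j : ℂ) * A i j + 2) / 2

variable {A d}

@[simp] lemma casimirValue_zero (s : ℝ) (χ : ι → ℂ) : casimirValue A d s χ 0 = 0 := by
  simp [casimirValue]

/-- With `(α_i, α_j) = d_i a_ij` and `(ρ, α_i) = d_i`, the value is `(χ + ρ, β) + s (β, β) / 2`. Its
increments match the corrections in `casimir_f_apply` for `s = -1` and in `casimir_e_apply` for `s =
1`. -/
lemma casimirValue_add_single (hA : IsGCM A) (hs : ∀ i j, d i * A i j = d j * A j i) (s : ℝ)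
    (χ : ι → ℂ) (β : ι → ℕ) (k : ι) :
    casimirValue A d s χ (β + Pi.single k 1) =
      casimirValue A d s χ β + d k * (χ k + s * ∑ j, (β j : ℂ) * A k j + s + 1) := by
  have h1 : ∀ i, ∑ j, (((β + Pi.single k 1 : ι → ℕ) j : ℕ) : ℂ) * A i j =
      ∑ j, (β j : ℂ) * A i j + A i k := by
    intro i
    simp only [Pi.add_apply, Nat.cast_add, add_mul, Finset.sum_add_distrib]
    congr 1
    rw [Finset.sum_eq_single k] <;> simp +contextual
  have h2 : ∀ g : ι → ℂ, ∑ i, (((β + Pi.single k 1 : ι → ℕ) i : ℕ) : ℂ) * g i =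
      ∑ i, (β i : ℂ) * g i + g k := by
    intro g
    simp only [Pi.add_apply, Nat.cast_add, add_mul, Finset.sum_add_distrib]
    congr 1
    rw [Finset.sum_eq_single k] <;> simp +contextual
  have h3 : ∑ i, (β i : ℂ) * (d i * (s * A i k) / 2) = d k * s * (∑ j, (β j : ℂ) * A k j) / 2 := by
    rw [Finset.mul_sum, Finset.sum_div]
    refine Finset.sum_congr rfl fun i _ => ?_
    have : (d i : ℂ) * A i k = d k * A k i := by exact_mod_cast hs i k
    linear_combination (β i : ℂ) * s / 2 * this
  have h4 : (A k k : ℂ) = 2 := by exact_mod_cast hA.diag k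
  rw [casimirValue, casimirValue]
  simp only [h1, mul_assoc, mul_div_assoc]
  rw [h2]
  have h5 : ∑ i, (β i : ℂ) * (d i * ((2 * χ i + s * (∑ j, (β j : ℂ) * A i j + A i k) + 2) / 2)) =
      ∑ i, (β i : ℂ) * (d i * ((2 * χ i + s * ∑ j, (β j : ℂ) * A i j + 2) / 2)) +
        ∑ i, (β i : ℂ) * (d i * (s * A i k) / 2) := by
    rw [← Finset.sum_add_distrib]
    refine Finset.sum_congr rfl fun i _ => ?_
    ring
  rw [h5, h3, h4]
  ring

lemma casimirValue_ne_zero (hd : ∀ i, 0 < d i) {s : ℝ} {χ : ι → ℂ} {a : ι → ℝ}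
    (ha : ∀ i, χ i = a i) {β : ι → ℕ} (hβ : β ≠ 0)
    (hpos : ∀ i, 0 < β i → 0 < 2 * a i + s * ∑ j, (β j : ℝ) * A i j + 2) :
    casimirValue A d s χ β ≠ 0 := by
  have h : casimirValue A d s χ β =
      ((∑ i, β i * d i * (2 * a i + s * ∑ j, (β j : ℝ) * A i j + 2) / 2 : ℝ) : ℂ) := by
    rw [casimirValue]
    push_cast
    refine Finset.sum_congr rfl fun i _ => ?_
    rw [ha]
  rw [h, Complex.ofReal_ne_zero]
  refine (Finset.sum_pos' (fun i _ => ?_) ?_).ne'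
  · rcases Nat.eq_zero_or_pos (β i) with h0 | h0
    · simp [h0]
    · have := hpos i h0
      have := hd i
      positivity
  · obtain ⟨i, hi⟩ := Function.ne_iff.1 hβ
    have h0 : 0 < β i := Nat.pos_of_ne_zero hi
    refine ⟨i, Finset.mem_univ _, ?_⟩
    have := hpos i h0
    have := hd i
    positivity

lemma sum_mul_gcm_le (hA : IsGCM A) (β : ι → ℕ) (i : ι) :
    ∑ j, (β j : ℝ) * A i j ≤ 2 * β i := by
  rw [← Finset.add_sum_erase _ _ (Finset.mem_univ i), hA.diag]
  have : ∑ j ∈ Finset.univ.erase i, (β j : ℝ) * A i j ≤ 0 := by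
    refine Finset.sum_nonpos fun j hj => ?_
    have h : (A i j : ℝ) ≤ 0 := by exact_mod_cast hA.nonpos i j (Finset.ne_of_mem_erase hj).symm
    exact mul_nonpos_of_nonneg_of_nonpos (Nat.cast_nonneg _) h
  push_cast
  linarith

end Eigenvalue

namespace WeakRep

variable {ρ : WeakRep R M} {d : ι → ℝ} {κ : Module.Dual ℂ H}

lemma casimir_apply_singular (ρ : WeakRep R M) (S : ∀ N, DualSystem A d N) {y : M}
    (hy : ∀ i, ρ.e i y = 0) (n : ℕ) : ρ.casimir S n y = 0 := by
  rw [casimir, LinearMap.sum_apply]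
  refine Finset.sum_eq_zero fun N _ => ?_
  rw [casimirPart, LinearMap.sum_apply]
  refine Finset.sum_eq_zero fun s _ => ?_
  rw [LinearMap.smul_apply, Module.End.mul_apply, E, bracket_apply_eq_zero _ hy, map_zero,
    smul_zero]

variable (S : ∀ N, DualSystem A d N) (hA : IsGCM A) (hρ : ρ.RadTrivial d) (hd : ∀ i, 0 < d i)
  (hs : ∀ i j, d i * A i j = d j * A j i) (hκ : ρ.BoundedBy κ)

include hA hρ hd hs hκ

/-- The operator kills the singular vector `u`, and each further `f i` adds its correction term. The
bound on `n` keeps every intermediate depth within the truncation level. -/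
lemma casimir_fprod {β : ι → ℕ} {u : M} (hu : u ∈ ρ.wt (κ - R.rootSum β))
    (he : ∀ i, ρ.e i u = 0) (w : List ι) {n : ℕ} (hn : ∑ i, β i + w.length ≤ n) :
    ρ.casimir S n (ρ.fprod w u) =
      casimirValue A d (-1) (fun i => (κ - R.rootSum β) (R.coroot i)) (content w) •
        ρ.fprod w u := by
  induction w with
  | nil => simp [content, casimir_apply_singular ρ S he n]
  | cons i w ih =>
    have hwt : ∀ w, ρ.fprod w u ∈ ρ.wt (κ - R.rootSum (β + content w)) := fun w => by
      rw [R.rootSum_add, ← sub_sub]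
      exact fprod_mem_wt hu w
    have hle : ∀ w : List ι, ∑ i, β i + w.length ≤ n → ∑ i, (β + content w) i ≤ n := by
      intro w hw
      simpa [Finset.sum_add_distrib, sum_content] using hw
    rw [List.length_cons] at hn
    have h2 := fun x hx => E_eq_zero hκ (hwt (i :: w)) (hle (i :: w) hn) (x := x) hx
    simp only [fprod_cons] at h2
    rw [fprod_cons, casimir_f_apply ρ S hρ hd hs
      (fun x hx => E_eq_zero hκ (hwt w) (hle w (by omega)) hx) h2, ih (by omega),
      fprod_mem_wt hu w, map_smul, map_smul, content, casimirValue_add_single hA hs]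
    simp only [LinearMap.sub_apply, R.rootSum_coroot]
    push_cast
    module

/-- The same accumulation going upwards, from a vector in the kernel instead of a singular one;
depth only decreases, so the level `n` stays sufficient. -/
lemma casimir_eprod {β : ι → ℕ} {m : M} (hm : m ∈ ρ.wt (κ - R.rootSum β)) {n : ℕ}
    (hn : ∑ i, β i ≤ n) (h0 : ρ.casimir S n m = 0) (w : List ι) :
    ρ.casimir S n (ρ.eprod w m) =
      -(casimirValue A d 1 (fun i => (κ - R.rootSum β) (R.coroot i)) (content w) •
        ρ.eprod w m) := by
  induction w with
  | nil => simp [content, h0]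
  | cons i w ih =>
    have h1 : ∀ x ∈ wordsOfLength ι n, ρ.E x (ρ.eprod w m) = 0 := by
      intro x hx
      by_cases h0 : ρ.eprod w m = 0
      · rw [h0, map_zero]
      have hw := eprod_mem_wt hm w
      obtain ⟨γ, hγ⟩ := hκ _ _ hw h0
      have : R.rootSum (content w + γ) = R.rootSum β := by
        rw [R.rootSum_add]
        linear_combination (norm := module) (1 : ℂ) • hγ
      have h2 := congrArg (fun β => ∑ i, β i) (R.rootSum_injective this)
      simp only [Pi.add_apply, Finset.sum_add_distrib] at h2
      rw [hγ] at hw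
      exact E_eq_zero hκ hw (by omega) hx
    have h2 := eprod_mem_wt hm (i :: w)
    rw [eprod_cons] at h2
    rw [eprod_cons, casimir_e_apply ρ S hρ hd hs h1, ih, h2, map_neg, map_smul, content,
      casimirValue_add_single hA hs, R.rootSum_add, R.rootSum_single]
    simp only [LinearMap.sub_apply, LinearMap.add_apply, R.rootSum_coroot, R.root_coroot, hA.diag]
    push_cast
    module

/-- The Casimir operator acts by zero on singular vectors of a highest weight representation. -/
lemma casimirValue_eq_zero_of_singular {μ : Module.Dual ℂ H} {u : M}
    (hu : u ∈ ρ.wt μ) (he : ∀ i, ρ.e i u = 0) (hu0 : u ≠ 0) {γ : ι → ℕ} {y : M}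
    (hy : y ∈ ρ.wt (μ - R.rootSum γ)) (hyu : y ∈ ρ.fspan u) (hye : ∀ i, ρ.e i y = 0)
    (hy0 : y ≠ 0) :
    casimirValue A d (-1) (fun i => μ (R.coroot i)) γ = 0 := by
  have S : ∀ N, DualSystem A d N := fun N => by
    have := exists_dual_system hd hs (A := A) N
    choose n c v h1 h2 using this
    exact ⟨n, c, v, h1, h2⟩
  obtain ⟨β, rfl⟩ := hκ _ _ hu hu0
  have h1 := mem_span_weight (fprod_mem_wt hu) hyu hy
  -- By its weight, `y` is a combination of `f`-words of content `γ` applied to `u`, and the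
  -- eigenvalue depends on the content only. The truncation level is the depth of `y` below `κ`.
  have h2 : ρ.casimir S (∑ i, β i + ∑ i, γ i) y =
      casimirValue A d (-1) (fun i => (κ - R.rootSum β) (R.coroot i)) γ • y := by
    have h3 : Submodule.span ℂ ((fun w => ρ.fprod w u) '' {w | κ - R.rootSum β -
        R.rootSum (content w) = κ - R.rootSum β - R.rootSum γ}) ≤
        LinearMap.eqLocus (ρ.casimir S (∑ i, β i + ∑ i, γ i))
          (casimirValue A d (-1) (fun i => (κ - R.rootSum β) (R.coroot i)) γ •
            LinearMap.id) := by
      rw [Submodule.span_le]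
      rintro _ ⟨w, hw, rfl⟩
      have hw' : content w = γ := R.rootSum_injective (by simpa using hw)
      subst hw'
      exact casimir_fprod S hA hρ hd hs hκ hu he w (by rw [sum_content])
    exact h3 h1
  rw [casimir_apply_singular ρ S hye, eq_comm, smul_eq_zero] at h2
  exact h2.resolve_right hy0

omit hA hρ hd hs hκ

/-! ### Representations of `sl₂` -/

lemma f_pow_mem_wt {χ : Module.Dual ℂ H} {y : M} (hy : y ∈ ρ.wt χ) (i : ι) (m : ℕ) :
    (ρ.f i ^ m) y ∈ ρ.wt (χ - (m : ℂ) • R.root i) := by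
  induction m with
  | zero => simpa using hy
  | succ m ih =>
    rw [pow_succ', Module.End.mul_apply]
    have : χ - ((m + 1 : ℕ) : ℂ) • R.root i = χ - (m : ℂ) • R.root i - R.root i := by
      push_cast
      module
    rw [this]
    exact f_mem_wt ih i

include hA in
lemma e_f_pow {χ : Module.Dual ℂ H} {y : M} (hy : y ∈ ρ.wt χ) {i : ι} (he : ρ.e i y = 0) (m : ℕ) :
    ρ.e i ((ρ.f i ^ (m + 1)) y) = ((m + 1) * (χ (R.coroot i) - m)) • (ρ.f i ^ m) y := by
  have key : ∀ m : ℕ, ρ.e i ((ρ.f i ^ (m + 1)) y) =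
      (χ (R.coroot i) - 2 * m) • (ρ.f i ^ m) y + ρ.f i (ρ.e i ((ρ.f i ^ m) y)) := by
    intro m
    rw [pow_succ', Module.End.mul_apply, apply_lie_comm, ρ.lie_ef, if_pos rfl,
      f_pow_mem_wt hy i m]
    simp [R.root_coroot, hA.diag, mul_comm]
  induction m with
  | zero => rw [key]; simp [he]
  | succ m ih =>
    rw [key, ih, map_smul, ← Module.End.mul_apply, ← pow_succ']
    push_cast
    module

lemma e_f_pow_of_ne {y : M} {i j : ι} (hij : j ≠ i) (he : ρ.e j y = 0) (m : ℕ) :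
    ρ.e j ((ρ.f i ^ m) y) = 0 := by
  induction m with
  | zero => simpa
  | succ m ih =>
    rw [pow_succ', Module.End.mul_apply, apply_lie_comm, ρ.lie_ef, if_neg hij, ih]
    simp

include hA in
-- If `f^(n+1) y = 0` with `f^n y ≠ 0`, applying `e` gives `(n + 1) (χ(α_i^∨) - n) = 0`.
lemma exists_nat_of_nilpotent {χ : Module.Dual ℂ H} {y : M} (hy : y ∈ ρ.wt χ) (hy0 : y ≠ 0) {i : ι}
    (he : ρ.e i y = 0) (hf : ∃ k, (ρ.f i ^ k) y = 0) : ∃ n : ℕ, χ (R.coroot i) = n := by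
  classical
  have h0 : Nat.find hf ≠ 0 := by
    intro h
    have := Nat.find_spec hf
    rw [h] at this
    exact hy0 (by simpa using this)
  obtain ⟨n, hn⟩ := Nat.exists_eq_succ_of_ne_zero h0
  have h1 := Nat.find_spec hf
  have h2 := Nat.find_min hf (m := n) (by omega)
  rw [hn, Nat.succ_eq_add_one] at h1
  have h3 := e_f_pow hA hy he n
  rw [h1, map_zero, eq_comm, smul_eq_zero] at h3
  have h4 := h3.resolve_right h2
  rw [mul_eq_zero] at h4
  refine ⟨n, sub_eq_zero.1 (h4.resolve_left ?_)⟩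
  exact_mod_cast Nat.succ_ne_zero n

include hA in
lemma f_pow_ne_zero {χ : Module.Dual ℂ H} {y : M} (hy : y ∈ ρ.wt χ) (hy0 : y ≠ 0) {i : ι}
    (he : ρ.e i y = 0) {a : ℝ} (ha : χ (R.coroot i) = a) {n : ℕ} (hn : (n : ℝ) ≤ a) :
    (ρ.f i ^ n) y ≠ 0 := by
  induction n with
  | zero => simpa
  | succ n ih =>
    intro h
    have h3 := e_f_pow hA hy he n
    push_cast at hn
    rw [h, map_zero, eq_comm, smul_eq_zero, ha, mul_eq_zero] at h3
    rcases h3 with (h3 | h3) | h3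
    · exact Nat.succ_ne_zero n (by exact_mod_cast h3)
    · have : a - n = 0 := by exact_mod_cast h3
      linarith
    · exact ih (by linarith) h3

include hA in
/-- A highest weight representation of large highest weight has a nonzero vector at shallow
depths. -/
lemma exists_ne_zero_mem_wt {v : M} (hv : ρ.IsHighest κ v) {a : ι → ℝ}
    (ha : ∀ i, κ (R.coroot i) = a i) {β : ι → ℕ} (hβ : ∀ i, (β i : ℝ) ≤ a i) :
    ∃ x ∈ ρ.wt (κ - R.rootSum β), x ≠ 0 := by
  -- The powers `f_k ^ β_k` are applied for one index after another. The vector stays killed by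
  -- `e_i` for every index `i` not yet used, so each stage is a computation in `sl₂`.
  have key : ∀ s : Finset ι, ∃ x ∈ ρ.wt (κ - R.rootSum (fun i => if i ∈ s then β i else 0)),
      x ≠ 0 ∧ ∀ i ∉ s, ρ.e i x = 0 := by
    intro s
    induction s using Finset.induction_on with
    | empty =>
      refine ⟨v, ?_, hv.ne_zero, fun i _ => hv.e i⟩
      have : (fun i => if i ∈ (∅ : Finset ι) then β i else 0) = 0 := by ext; simp
      rw [this]
      simpa using hv.mem
    | insert k s hk ih =>
      obtain ⟨x, hx, hx0, hxe⟩ := ih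
      refine ⟨(ρ.f k ^ β k) x, ?_, ?_, fun i hi => ?_⟩
      · have h := f_pow_mem_wt hx k (β k)
        have h2 : R.rootSum (fun i => if i ∈ insert k s then β i else 0) =
            R.rootSum (fun i => if i ∈ s then β i else 0) + (β k : ℂ) • R.root k := by
          simp only [Realization.rootSum]
          rw [← Finset.add_sum_erase _ _ (Finset.mem_univ k),
            ← Finset.add_sum_erase (a := k) _ (fun i => (((if i ∈ s then β i else 0 : ℕ)) : ℂ) •
              R.root i) (Finset.mem_univ k), if_pos (Finset.mem_insert_self k s), if_neg hk,
            Nat.cast_zero, zero_smul, zero_add, add_comm]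
          congr 1
          refine Finset.sum_congr rfl fun i hi => ?_
          simp [Finset.ne_of_mem_erase hi]
        rw [h2, ← sub_sub]
        exact h
      · have h3 : ∀ γ : ι → ℕ, (κ - R.rootSum γ) (R.coroot k) =
            ((a k - ∑ j, (γ j : ℝ) * A k j : ℝ) : ℂ) := by
          intro γ
          rw [LinearMap.sub_apply, R.rootSum_coroot, ha]
          push_cast
          rfl
        refine f_pow_ne_zero hA hx hx0 (hxe k hk) (h3 _) ?_
        -- Since `k ∉ s`, only nonpositive entries of `A` enter: the value on `α_k^∨` is still at
        -- least `a k`.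
        have h4 := sum_mul_gcm_le hA (fun i => if i ∈ s then β i else 0) k
        simp only [if_neg hk, Nat.cast_zero, mul_zero] at h4
        have := hβ k
        linarith
      · rw [Finset.mem_insert, not_or] at hi
        exact e_f_pow_of_ne hi.1 (hxe i hi.2) _
  obtain ⟨x, hx, hx0, -⟩ := key Finset.univ
  exact ⟨x, by simpa using hx, hx0⟩

/-! ### Irreducibility -/

include hA hρ hd hs hκ in
/-- An integrable highest weight representation is irreducible. -/
lemma highest_mem_of_stable (hf : ∀ i m, ∃ k, (ρ.f i ^ k) m = 0) {μ : Module.Dual ℂ H} {u : M}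
    (hu : ρ.IsHighest μ u) {p : Submodule ℂ M} (hp : ρ.Stable p) (hle : p ≤ ρ.fspan u)
    (hp0 : p ≠ ⊥) : u ∈ p := by
  classical
  have hex : ∃ n, ∃ β : ι → ℕ, ∑ i, β i = n ∧ ∃ y ∈ p, y ∈ ρ.wt (μ - R.rootSum β) ∧ y ≠ 0 := by
    -- This yields some weight vector in `p`; one of minimal depth, chosen next, is singular because
    -- each `e i` would decrease the depth.
    obtain ⟨m, hm, hm0⟩ := p.exists_mem_ne_zero_of_ne_bot hp0
    obtain ⟨w, y, hyp, hy, -, hy0⟩ :=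
      exists_weight_vector (fprod_mem_wt hu.mem) hp.h (hle hm) hm hm0
    exact ⟨_, content w, rfl, y, hyp, hy, hy0⟩
  obtain ⟨β, hβ, y, hyp, hy, hy0⟩ := Nat.find_spec hex
  have hye : ∀ i, ρ.e i y = 0 := by
    intro i
    by_contra h0
    have h1 := e_mem_wt hy i
    obtain ⟨w, hw⟩ := exists_weight_of_mem_wt (fprod_mem_wt hu.mem) (hle (hp.e i y hyp)) h1 h0
    rw [← hw] at h1
    refine Nat.find_min hex ?_ ⟨content w, rfl, ρ.e i y, hp.e i y hyp, h1, h0⟩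
    have : R.rootSum (content w + Pi.single i 1) = R.rootSum β := by
      rw [R.rootSum_add, R.rootSum_single]
      linear_combination (norm := module) (-1 : ℂ) • hw
    have h2 := congrArg (fun β => ∑ i, β i) (R.rootSum_injective this)
    simp only [Pi.add_apply, Finset.sum_add_distrib, Finset.sum_pi_single', Finset.mem_univ,
      if_true] at h2
    omega
  have hc := casimirValue_eq_zero_of_singular hA hρ hd hs hκ hu.mem hu.e hu.ne_zero hy (hle hyp)
    hye hy0
  have hβ0 : β = 0 := by
    by_contra hne
    -- Integrability makes both singular weights `μ` and `μ - β` dominant. Then `2 a_i - (Aβ)_i + 2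
    -- = a_i + b_i + 2 > 0`, against the vanishing of the Casimir value.
    have h1 := fun i => exists_nat_of_nilpotent hA hu.mem hu.ne_zero (hu.e i) (hf i u)
    have h2 := fun i => exists_nat_of_nilpotent hA hy hy0 (hye i) (hf i y)
    choose a ha using h1
    choose b hb using h2
    refine casimirValue_ne_zero hd (a := fun i => (a i : ℝ)) (fun i => by simp [ha]) hne
      (fun i _ => ?_) hc
    have h3 := hb i
    rw [LinearMap.sub_apply, R.rootSum_coroot, ha] at h3
    have h4 : (a i : ℝ) - ∑ j, (β j : ℝ) * A i j = b i := by exact_mod_cast h3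
    have h5 : (0 : ℝ) ≤ a i := Nat.cast_nonneg _
    have h6 : (0 : ℝ) ≤ b i := Nat.cast_nonneg _
    linarith
  subst hβ0
  rw [R.rootSum_zero, sub_zero] at hy
  obtain ⟨c, rfl⟩ := mem_span_of_mem_wt hu.mem (hle hyp) hy
  have hc0 : c ≠ 0 := by rintro rfl; simp at hy0
  exact (p.smul_mem_iff hc0).1 hyp

include hA hρ hd hs in
/-- A proper subrepresentation of a highest weight representation on which the radical acts
trivially vanishes at shallow depths. -/
lemma eq_zero_of_mem_stable {v : M} (hv : ρ.IsHighest κ v) (htop : ρ.fspan v = ⊤)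
    {p : Submodule ℂ M} (hp : ρ.Stable p) (hvp : v ∉ p) {a : ι → ℝ}
    (ha : ∀ i, κ (R.coroot i) = a i) {β : ι → ℕ} (hβ : ∀ i, (β i : ℝ) ≤ a i) {y : M} (hyp : y ∈ p)
    (hy : y ∈ ρ.wt (κ - R.rootSum β)) : y = 0 := by
  have hκ := fspan_boundedBy hv.mem htop
  induction hn : ∑ i, β i using Nat.strong_induction_on generalizing β y with
  | _ n ih =>
    by_contra hy0
    have hye : ∀ i, ρ.e i y = 0 := by
      intro i
      by_contra h0
      have h1 := e_mem_wt hy i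
      obtain ⟨γ, hγ⟩ := hκ _ _ h1 h0
      rw [hγ] at h1
      have h3 : R.rootSum (γ + Pi.single i 1) = R.rootSum β := by
        rw [R.rootSum_add, R.rootSum_single]
        linear_combination (norm := module) (1 : ℂ) • hγ
      have h3 := R.rootSum_injective h3
      have h2 := congrArg (fun β => ∑ i, β i) h3
      simp only [Pi.add_apply, Finset.sum_add_distrib, Finset.sum_pi_single', Finset.mem_univ,
        if_true] at h2
      refine h0 (ih _ (by omega) (fun j => le_trans ?_ (hβ j)) (hp.e i y hyp) h1 rfl)
      rw [← h3]
      exact_mod_cast (le_self_add : γ j ≤ γ j + _)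
    have hc := casimirValue_eq_zero_of_singular hA hρ hd hs hκ hv.mem hv.e hv.ne_zero hy
      (htop ▸ Submodule.mem_top) hye hy0
    by_cases hβ0 : β = 0
    · subst hβ0
      rw [R.rootSum_zero, sub_zero] at hy
      obtain ⟨c, rfl⟩ := mem_span_of_mem_wt hv.mem (htop ▸ Submodule.mem_top) hy
      have hc0 : c ≠ 0 := by rintro rfl; simp at hy0
      exact hvp ((p.smul_mem_iff hc0).1 hyp)
    -- Here `(Aβ)_i ≤ 2 β_i ≤ 2 a_i`, so every factor is at least `2`.
    · refine casimirValue_ne_zero hd ha hβ0 (fun i _ => ?_) hc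
      have := sum_mul_gcm_le hA β i
      have := hβ i
      linarith

end WeakRep

end

section

variable {ι : Type*} [Fintype ι] [DecidableEq ι] {A : Matrix ι ι ℤ}
  {H : Type*} [AddCommGroup H] [Module ℂ H] {R : Realization A H}
  {M : Type*} [AddCommGroup M] [Module ℂ M] {N : Type*} [AddCommGroup N] [Module ℂ N]

/-! ### Coinvariants of a tensor product with a universal representation -/

namespace WeakRep

/-- The product of the operators `-f i` along a word, in the opposite order. -/
def antiWord (σ : WeakRep R N) : List ι → Module.End ℂ N
  | [] => 1
  | i :: w => -(antiWord σ w * σ.f i)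

/-- The linear extension of `antiWord`. -/
def anti (σ : WeakRep R N) : FreeVerma ι →ₗ[ℂ] Module.End ℂ N :=
  Finsupp.linearCombination ℂ σ.antiWord

lemma anti_single (σ : WeakRep R N) (w : List ι) (c : ℂ) :
    σ.anti (Finsupp.single w c) = c • σ.antiWord w := by
  simp [anti]

lemma anti_vermaF (σ : WeakRep R N) (i : ι) (p : FreeVerma ι) :
    σ.anti (vermaF i p) = -(σ.anti p * σ.f i) := by
  induction p using Finsupp.induction_linear with
  | zero => simp
  | add p q hp hq => rw [map_add, map_add, map_add, hp, hq, add_mul, neg_add]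
  | single w c =>
    rw [vermaF_single, anti_single, anti_single, antiWord, smul_neg, smul_mul_assoc]

/-- `anti` is the antipode followed by the action on `N`, so a Lie element on the left moves to the
right with a sign. Hence `anti` kills `radF` when the radical acts by zero on `N`. -/
lemma anti_F (σ : WeakRep R N) (κ : Module.Dual ℂ H) (x : WordSpace ι) (p : FreeVerma ι) :
    σ.anti ((freeVermaRep R κ).F x p) = -(σ.anti p * σ.F x) := by
  induction x using word_induction generalizing p with
  | h0 => simp
  | hadd x y hx hy =>
    rw [map_add, LinearMap.add_apply, map_add, hx, hy, map_add, mul_add, neg_add]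
  | hnil k c =>
    rw [F_single_nil, F_single_nil, LinearMap.smul_apply, map_smul]
    refine (congrArg (c • ·) (anti_vermaF σ k p)).trans ?_
    simp
  | hcons i x ih =>
    rw [F_consWord, F_consWord]
    have h : (⁅(freeVermaRep R κ).f i, (freeVermaRep R κ).F x⁆ : Module.End ℂ _) p =
        vermaF i ((freeVermaRep R κ).F x p) - (freeVermaRep R κ).F x (vermaF i p) := rfl
    rw [h, map_sub, anti_vermaF, ih, ih, anti_vermaF, Ring.lie_def]
    noncomm_ring

variable {d : ι → ℝ} (hd : ∀ i, 0 < d i) (hs : ∀ i j, d i * A i j = d j * A j i)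
  {κ : Module.Dual ℂ H} {σ : WeakRep R N}

/-- `anti` on the universal representation on which the radical acts by zero. -/
def radAnti (hσ : σ.RadTrivial d) : RadVerma R κ d →ₗ[ℂ] Module.End ℂ N :=
  Submodule.liftQ _ σ.anti (by
    rw [radF, Submodule.span_le]
    rintro _ ⟨x, hx, p, rfl⟩
    rw [SetLike.mem_coe, LinearMap.mem_ker, anti_F, (hσ x hx).2, mul_zero, neg_zero])

/-- A map on the tensor product of the universal representation with `N` that identifies the
coinvariants of the `f i` with `N`. -/
def coinv (hσ : σ.RadTrivial d) : RadVerma R κ d ⊗[ℂ] N →ₗ[ℂ] N :=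
  TensorProduct.lift (radAnti hσ)

lemma coinv_gen (hσ : σ.RadTrivial d) (x : N) :
    coinv hσ (radVermaGen R κ d ⊗ₜ x) = x := by
  rw [coinv, TensorProduct.lift.tmul, radVermaGen, radAnti, Submodule.mkQ_apply,
    Submodule.liftQ_apply, anti_single, antiWord]
  simp

/-- The antipode property: `f p ⊗ x` contributes `-S(p) f x`, which cancels the contribution of `p ⊗
f x`. -/
lemma coinv_f (hσ : σ.RadTrivial d) (i : ι) (z : RadVerma R κ d ⊗[ℂ] N) :
    coinv hσ (((radVermaRep R κ hd hs).tensor σ).f i z) = 0 := by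
  induction z with
  | zero => simp
  | add z z' h h' => rw [map_add, map_add, h, h', add_zero]
  | tmul p x =>
    obtain ⟨p, rfl⟩ := Submodule.mkQ_surjective _ p
    rw [tensor_f_tmul, map_add, ← (isHom_radVerma R κ hd hs).f]
    simp only [coinv, TensorProduct.lift.tmul, radAnti, Submodule.mkQ_apply, Submodule.liftQ_apply]
    refine (congrArg (· + _) (LinearMap.congr_fun (anti_vermaF σ i p) x)).trans ?_
    simp

lemma coinv_F (hσ : σ.RadTrivial d) (x : WordSpace ι) (z : RadVerma R κ d ⊗[ℂ] N) :
    coinv hσ (((radVermaRep R κ hd hs).tensor σ).F x z) = 0 := by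
  induction x using word_induction generalizing z with
  | h0 => simp
  | hadd x y hx hy => rw [map_add, LinearMap.add_apply, map_add, hx, hy, add_zero]
  | hnil k c =>
    rw [F_single_nil, LinearMap.smul_apply, map_smul, coinv_f, smul_zero]
  | hcons i x ih =>
    rw [F_consWord, eq_sub_of_add_eq (apply_lie_comm _ _ z).symm, map_sub, coinv_f, ih, sub_zero]

/-- Each summand has an `F` on the left. This obstruction shows that the Casimir operator is not
surjective on certain weight spaces. -/
lemma coinv_casimir (hσ : σ.RadTrivial d) (S : ∀ N, DualSystem A d N) (n : ℕ)
    (z : RadVerma R κ d ⊗[ℂ] N) :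
    coinv hσ (((radVermaRep R κ hd hs).tensor σ).casimir S n z) = 0 := by
  rw [casimir, LinearMap.sum_apply, map_sum]
  refine Finset.sum_eq_zero fun N _ => ?_
  rw [casimirPart, LinearMap.sum_apply, map_sum]
  refine Finset.sum_eq_zero fun s _ => ?_
  rw [LinearMap.smul_apply, map_smul, Module.End.mul_apply, coinv_F, smul_zero]

/-! ### Weight spaces of tensor products -/

section TensorWeights

variable {ρ : WeakRep R M} {κ₁ κ₂ : Module.Dual ℂ H} {v : M} {v' : N}

lemma fprod_tmul_fprod_mem_wt (hv : v ∈ ρ.wt κ₁) (hv' : v' ∈ σ.wt κ₂) (w : List ι × List ι) :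
    ρ.fprod w.1 v ⊗ₜ[ℂ] σ.fprod w.2 v' ∈
      (ρ.tensor σ).wt (κ₁ + κ₂ - R.rootSum (content w.1 + content w.2)) := by
  have : κ₁ + κ₂ - R.rootSum (content w.1 + content w.2) =
      (κ₁ - R.rootSum (content w.1)) + (κ₂ - R.rootSum (content w.2)) := by
    rw [R.rootSum_add]
    abel
  rw [this]
  exact tmul_mem_wt (fprod_mem_wt hv _) (fprod_mem_wt hv' _)

lemma span_fprod_tmul_fprod (htop : ρ.fspan v = ⊤) (htop' : σ.fspan v' = ⊤) :
    Submodule.span ℂ (Set.range fun w : List ι × List ι =>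
      ρ.fprod w.1 v ⊗ₜ[ℂ] σ.fprod w.2 v') = ⊤ := by
  rw [eq_top_iff, ← TensorProduct.span_tmul_eq_top, Submodule.span_le]
  rintro _ ⟨a, b, rfl⟩
  have h := Submodule.apply_mem_map₂ (TensorProduct.mk ℂ M N)
    (htop ▸ Submodule.mem_top : a ∈ ρ.fspan v) (htop' ▸ Submodule.mem_top : b ∈ σ.fspan v')
  rw [fspan, fspan, Submodule.map₂_span_span] at h
  refine Submodule.span_mono ?_ h
  rintro _ ⟨_, ⟨w, rfl⟩, _, ⟨w', rfl⟩, rfl⟩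
  exact ⟨(w, w'), rfl⟩

lemma tensor_boundedBy (hv : v ∈ ρ.wt κ₁) (hv' : v' ∈ σ.wt κ₂) (htop : ρ.fspan v = ⊤)
    (htop' : σ.fspan v' = ⊤) : (ρ.tensor σ).BoundedBy (κ₁ + κ₂) :=
  boundedBy_of_span (fprod_tmul_fprod_mem_wt hv hv') (span_fprod_tmul_fprod htop htop')

lemma finite_tensor_wt (hv : v ∈ ρ.wt κ₁) (hv' : v' ∈ σ.wt κ₂) (htop : ρ.fspan v = ⊤)
    (htop' : σ.fspan v' = ⊤) (β : ι → ℕ) :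
    FiniteDimensional ℂ ((ρ.tensor σ).wt (κ₁ + κ₂ - R.rootSum β)) := by
  set T : Set (List ι × List ι) :=
    {w | κ₁ + κ₂ - R.rootSum (content w.1 + content w.2) = κ₁ + κ₂ - R.rootSum β}
  have hT : T.Finite := by
    refine ((List.finite_length_le ι (∑ i, β i)).prod
      (List.finite_length_le ι (∑ i, β i))).subset ?_
    intro w hw
    have h : content w.1 + content w.2 = β := R.rootSum_injective (by simpa [T] using hw)
    have h2 : w.1.length + w.2.length = ∑ i, β i := by
      rw [← h, ← sum_content, ← sum_content, ← Finset.sum_add_distrib]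
      rfl
    exact ⟨by simp; omega, by simp; omega⟩
  have : FiniteDimensional ℂ (Submodule.span ℂ
      ((fun w : List ι × List ι => ρ.fprod w.1 v ⊗ₜ[ℂ] σ.fprod w.2 v') '' T)) :=
    FiniteDimensional.span_of_finite ℂ (hT.image _)
  refine Submodule.finiteDimensional_of_le (S₂ := Submodule.span ℂ
    ((fun w : List ι × List ι => ρ.fprod w.1 v ⊗ₜ[ℂ] σ.fprod w.2 v') '' T)) fun m hm => ?_
  exact mem_span_weight (fprod_tmul_fprod_mem_wt hv hv')
    (span_fprod_tmul_fprod htop htop' ▸ Submodule.mem_top) hm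

end TensorWeights

/-! ### Singular vectors -/

lemma exists_apply_eq_zero_of_not_mem_range {W : Submodule ℂ M} [FiniteDimensional ℂ W]
    {C : Module.End ℂ M} (hC : ∀ m ∈ W, C m ∈ W) {x : M} (hx : x ∈ W)
    (hxr : ∀ m, C m ≠ x) : ∃ m ∈ W, m ≠ 0 ∧ C m = 0 := by
  by_contra! h
  have hinj : Function.Injective (C.restrict hC) := by
    rw [injective_iff_map_eq_zero]
    rintro ⟨m, hm⟩ h0
    by_contra hne
    exact h m hm (fun h => hne (Subtype.ext h)) (congrArg Subtype.val h0)
  obtain ⟨⟨m, hm⟩, hmx⟩ := LinearMap.surjective_of_injective hinj ⟨x, hx⟩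
  exact hxr m (congrArg Subtype.val hmx)

lemma casimir_mem_wt {ρ : WeakRep R M} (S : ∀ N, DualSystem A d N) (hρ : ρ.RadTrivial d)
    (hd : ∀ i, 0 < d i) (hs : ∀ i j, d i * A i j = d j * A j i) (n : ℕ) {χ : Module.Dual ℂ H}
    {m : M} (hm : m ∈ ρ.wt χ) : ρ.casimir S n m ∈ ρ.wt χ := by
  intro t
  have h := apply_lie_comm (ρ.casimir S n) (ρ.h t) m
  rw [lie_casimir_h ρ S hρ hd hs, LinearMap.zero_apply, zero_add] at h
  rw [← h, hm t, map_smul]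

/-- In a bounded representation, a vector killed by the Casimir operator whose weight is not
exceptional is singular. -/
lemma singular_of_casimir_eq_zero (hA : IsGCM A) {ρ : WeakRep R M} (S : ∀ N, DualSystem A d N)
    (hρ : ρ.RadTrivial d) (hd : ∀ i, 0 < d i) (hs : ∀ i j, d i * A i j = d j * A j i)
    (hκ : ρ.BoundedBy κ) {β : ι → ℕ} {m : M} (hm : m ∈ ρ.wt (κ - R.rootSum β))
    {n : ℕ} (hn : ∑ i, β i ≤ n) (hC : ρ.casimir S n m = 0)
    (hne : ∀ γ ≤ β, γ ≠ 0 →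
      casimirValue A d 1 (fun i => (κ - R.rootSum β) (R.coroot i)) γ ≠ 0) (i : ι) :
    ρ.e i m = 0 := by
  have hbound : ∀ w, ρ.eprod w m ≠ 0 → w.length ≤ ∑ i, β i := by
    intro w hw
    have h : content w ≤ β := by
      by_contra h
      exact hw (eprod_eq_zero hκ hm h)
    rw [← sum_content]
    exact Finset.sum_le_sum fun i _ => h i
  by_contra h0
  -- Minimizing `k` picks a longest word of raising operators not killing `m`; the resulting vector
  -- is singular. By `hbound` the truncated subtraction is a true one.
  have hex : ∃ k, ∃ w, w ≠ [] ∧ ρ.eprod w m ≠ 0 ∧ ∑ i, β i - w.length = k :=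
    ⟨_, [i], by simp, by simpa [eprod_cons] using h0, rfl⟩
  classical
  obtain ⟨w, hw, hw0, hk⟩ := Nat.find_spec hex
  have hsing : ∀ j, ρ.e j (ρ.eprod w m) = 0 := by
    intro j
    by_contra hj
    rw [← eprod_cons] at hj
    have h1 := hbound _ hj
    refine Nat.find_min hex ?_ ⟨j :: w, by simp, hj, rfl⟩
    rw [← hk]
    rw [List.length_cons] at h1 ⊢
    omega
  have h1 := casimir_eprod S hA hρ hd hs hκ hm hn hC w
  rw [casimir_apply_singular ρ S hsing, eq_comm, neg_eq_zero, smul_eq_zero] at h1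
  refine hne (content w) ?_ ?_ (h1.resolve_right hw0)
  · by_contra h
    exact hw0 (eprod_eq_zero hκ hm h)
  · intro h
    have := sum_content w
    rw [h] at this
    exact hw (List.length_eq_zero_iff.1 (by simpa using this.symm))

/-- Writing `2(a - Aβ) + Aγ + 2 = 2a - Aβ - A(β - γ) + 2` and bounding `Aβ ≤ 2β`, `A(β - γ) ≤ 2(β -
γ)` leaves at least `2γ + 2`. -/
lemma casimirValue_ne_zero_of_le (hA : IsGCM A) (hd : ∀ i, 0 < d i) {a : ι → ℝ}
    (ha : ∀ i, κ (R.coroot i) = a i) {β γ : ι → ℕ} (hβ : ∀ i, 2 * (β i : ℝ) ≤ a i)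
    (hγ : γ ≤ β) (hγ0 : γ ≠ 0) :
    casimirValue A d 1 (fun i => (κ - R.rootSum β) (R.coroot i)) γ ≠ 0 := by
  refine casimirValue_ne_zero hd (a := fun i => a i - ∑ j, (β j : ℝ) * A i j) (fun i => ?_) hγ0
    (fun i _ => ?_)
  · rw [LinearMap.sub_apply, R.rootSum_coroot, ha]
    push_cast
    rfl
  · have h1 := sum_mul_gcm_le hA β i
    have h2 := sum_mul_gcm_le hA (β - γ) i
    have h3 : ∀ j, (((β - γ : ι → ℕ) j : ℕ) : ℝ) = β j - γ j := fun j => by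
      rw [Pi.sub_apply, Nat.cast_sub (hγ j)]
    simp only [h3, sub_mul, Finset.sum_sub_distrib] at h2
    have h4 := hβ i
    have h5 : (0 : ℝ) ≤ γ i := Nat.cast_nonneg _
    linarith

/-- There are singular vectors at shallow depths in the tensor product of the universal
representation and a highest weight representation. -/
lemma exists_singular_radVerma (hA : IsGCM A) (hσ : σ.RadTrivial d) {κ₁ κ₂ : Module.Dual ℂ H}
    {v : N} (hv : σ.IsHighest κ₂ v) (htop : σ.fspan v = ⊤) {a b : ι → ℝ}
    (ha : ∀ i, κ₁ (R.coroot i) = a i) (hb : ∀ i, κ₂ (R.coroot i) = b i) {β : ι → ℕ}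
    (hβa : ∀ i, (β i : ℝ) ≤ a i) (hβb : ∀ i, (β i : ℝ) ≤ b i) :
    ∃ m, ((radVermaRep R κ₁ hd hs).tensor σ).IsHighest (κ₁ + κ₂ - R.rootSum β) m := by
  have S : ∀ N, DualSystem A d N := fun N => by
    have := exists_dual_system hd hs (A := A) N
    choose n c v h1 h2 using this
    exact ⟨n, c, v, h1, h2⟩
  set τ := (radVermaRep R κ₁ hd hs).tensor σ with hτ
  have hg := radVermaRep_isHighest R κ₁ hd hs
  have hgtop := radVermaRep_fspan R κ₁ hd hs
  have hτr : τ.RadTrivial d := (radVermaRep_radTrivial R κ₁ hd hs).tensor hσ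
  have hτb : τ.BoundedBy (κ₁ + κ₂) := tensor_boundedBy hg.mem hv.mem hgtop htop
  have := finite_tensor_wt hg.mem hv.mem hgtop htop β
  obtain ⟨x, hx, hx0⟩ := exists_ne_zero_mem_wt hA hv hb hβb
  have hgx : radVermaGen R κ₁ d ⊗ₜ[ℂ] x ∈ τ.wt (κ₁ + κ₂ - R.rootSum β) := by
    rw [add_sub_assoc]
    exact tmul_mem_wt hg.mem hx
  -- The vector `gen ⊗ x` is outside the image of the Casimir operator, as `coinv` kills that image
  -- and sends this vector to `x ≠ 0`. On a finite dimensional weight space, failing surjectivity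
  -- forces a kernel.
  obtain ⟨m, hm, hm0, hC⟩ := exists_apply_eq_zero_of_not_mem_range
    (C := τ.casimir S (∑ i, β i)) (fun m hm => casimir_mem_wt S hτr hd hs _ hm) hgx (by
      intro m hm
      have h := congrArg (coinv hσ) hm
      rw [coinv_gen, hτ, coinv_casimir] at h
      exact hx0 h.symm)
  refine ⟨m, hm, singular_of_casimir_eq_zero hA S hτr hd hs hτb hm le_rfl hC
    fun γ hγ hγ0 => ?_, hm0⟩
  refine casimirValue_ne_zero_of_le (a := fun i => a i + b i) hA hd (fun i => ?_) (fun i => ?_)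
    hγ hγ0
  · rw [LinearMap.add_apply, ha, hb]
    push_cast
    rfl
  · linarith [hβa i, hβb i]

/-! ### Maps from the universal representation -/

section Transport

variable {ρ : WeakRep R M} {v : M}

/-- The map of the words to the vectors that they produce from `v`. -/
def fromFreeVerma (ρ : WeakRep R M) (v : M) : FreeVerma ι →ₗ[ℂ] M :=
  Finsupp.linearCombination ℂ (fun w => ρ.fprod w v)

lemma fromFreeVerma_single (ρ : WeakRep R M) (v : M) (w : List ι) (c : ℂ) :
    ρ.fromFreeVerma v (Finsupp.single w c) = c • ρ.fprod w v := by
  simp [fromFreeVerma]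

lemma isHom_fromFreeVerma (hv : v ∈ ρ.wt κ) (he : ∀ i, ρ.e i v = 0) :
    IsHom (freeVermaRep R κ) ρ (ρ.fromFreeVerma v) where
  h t m := by
    induction m using Finsupp.induction_linear with
    | zero => simp
    | add p q hp hq => simp only [map_add, hp, hq]
    | single w c =>
      change ρ.fromFreeVerma v (vermaH R κ t _) = _
      rw [vermaH_single, fromFreeVerma_single, fromFreeVerma_single, map_smul,
        fprod_mem_wt hv w t, smul_smul, mul_comm]
  e j m := by
    induction m using Finsupp.induction_linear with
    | zero => simp
    | add p q hp hq => simp only [map_add, hp, hq]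
    | single w c =>
      change ρ.fromFreeVerma v (vermaE R κ j _) = _
      rw [vermaE_single, fromFreeVerma_single, map_smul, map_smul]
      congr 1
      induction w with
      | nil => simp [vermaEWord, he]
      | cons i w ih =>
        rw [fprod_cons, apply_lie_comm, ρ.lie_ef, vermaEWord, map_add, ← ih, add_comm]
        congr 1
        · by_cases hij : i = j
          · subst hij
            rw [if_pos rfl, if_pos rfl, fromFreeVerma_single, fprod_mem_wt hv w]
          · rw [if_neg hij, if_neg (Ne.symm hij)]
            simp
        · generalize vermaEWord R κ j w = p
          induction p using Finsupp.induction_linear with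
          | zero => simp
          | add p q hp hq => simp only [map_add, hp, hq]
          | single w c =>
            rw [vermaF_single, fromFreeVerma_single, fromFreeVerma_single, map_smul, fprod_cons]
  f i m := by
    induction m using Finsupp.induction_linear with
    | zero => simp
    | add p q hp hq => simp only [map_add, hp, hq]
    | single w c =>
      change ρ.fromFreeVerma v (vermaF i _) = _
      rw [vermaF_single, fromFreeVerma_single, fromFreeVerma_single, map_smul, fprod_cons]

lemma exists_isHom_radVerma (hρ : ρ.RadTrivial d) (hv : v ∈ ρ.wt κ) (he : ∀ i, ρ.e i v = 0) :
    ∃ π : RadVerma R κ d →ₗ[ℂ] M, IsHom (radVermaRep R κ hd hs) ρ π ∧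
      π (radVermaGen R κ d) = v := by
  have hh := isHom_fromFreeVerma hv he
  refine ⟨Submodule.liftQ _ (ρ.fromFreeVerma v) ?_, ⟨?_, ?_, ?_⟩, ?_⟩
  · rw [radF, Submodule.span_le]
    rintro _ ⟨x, hx, p, rfl⟩
    rw [SetLike.mem_coe, LinearMap.mem_ker, hh.map_F, (hρ x hx).2, LinearMap.zero_apply]
  · intro t y
    obtain ⟨p, rfl⟩ := Submodule.mkQ_surjective _ y
    exact hh.h t p
  · intro t y
    obtain ⟨p, rfl⟩ := Submodule.mkQ_surjective _ y
    exact hh.e t p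
  · intro t y
    obtain ⟨p, rfl⟩ := Submodule.mkQ_surjective _ y
    exact hh.f t p
  · rw [radVermaGen, Submodule.mkQ_apply, Submodule.liftQ_apply, fromFreeVerma_single]
    simp

lemma IsHom.rTensor {ρ' : WeakRep R M} {K : Type*} [AddCommGroup K] [Module ℂ K]
    {τ : WeakRep R K} {π : K →ₗ[ℂ] M} (hπ : IsHom τ ρ' π) :
    IsHom (τ.tensor σ) (ρ'.tensor σ) (π.rTensor N) where
  h t m := by
    induction m with
    | zero => simp
    | add p q hp hq => simp only [map_add, hp, hq]
    | tmul p q => simp [hπ.h]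
  e t m := by
    induction m with
    | zero => simp
    | add p q hp hq => simp only [map_add, hp, hq]
    | tmul p q => simp [hπ.e]
  f t m := by
    induction m with
    | zero => simp
    | add p q hp hq => simp only [map_add, hp, hq]
    | tmul p q => simp [hπ.f]

lemma eq_zero_of_mem_stable_of_mem_span (hA : IsGCM A) (hd : ∀ i, 0 < d i)
    (hs : ∀ i j, d i * A i j = d j * A j i) (hρ : ρ.RadTrivial d) (hv : ρ.IsHighest κ v)
    (htop : ρ.fspan v = ⊤) {p : Submodule ℂ M} (hp : ρ.Stable p) (hvp : v ∉ p) {a : ι → ℝ}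
    (ha : ∀ i, κ (R.coroot i) = a i) {β : ι → ℕ} (hβ : ∀ i, (β i : ℝ) ≤ a i) {y : M}
    (hy : y ∈ Submodule.span ℂ (Set.range fun w : {w : List ι // content w ≤ β} => ρ.fprod w v))
    (hyp : y ∈ p) : y = 0 := by
  by_contra hne
  obtain ⟨w, z, hz, hzw, -, hz0⟩ := exists_weight_vector
    (χ := fun w : {w : List ι // content w ≤ β} => κ - R.rootSum (content w.1))
    (fun w => fprod_mem_wt hv.mem w.1) hp.h hy hyp hne
  refine hz0 (eq_zero_of_mem_stable hA hρ hd hs hv htop hp hvp ha (fun i => le_trans ?_ (hβ i))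
    hz hzw)
  exact_mod_cast w.2 i

/-- There are singular vectors at shallow depths in the tensor product of two highest weight
representations on which the radical acts by zero. -/
theorem exists_singular_tensor (hA : IsGCM A) (hd : ∀ i, 0 < d i)
    (hs : ∀ i j, d i * A i j = d j * A j i) (hρ : ρ.RadTrivial d) (hσ : σ.RadTrivial d)
    {κ₁ κ₂ : Module.Dual ℂ H} {v' : N} (hv : ρ.IsHighest κ₁ v)
    (hv' : σ.IsHighest κ₂ v') (htop' : σ.fspan v' = ⊤) {a b : ι → ℝ}
    (ha : ∀ i, κ₁ (R.coroot i) = a i) (hb : ∀ i, κ₂ (R.coroot i) = b i) {β : ι → ℕ}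
    (hβa : ∀ i, (β i : ℝ) ≤ a i) (hβb : ∀ i, (β i : ℝ) ≤ b i) :
    ∃ u, (ρ.tensor σ).IsHighest (κ₁ + κ₂ - R.rootSum β) u := by
  obtain ⟨m, hm⟩ := exists_singular_radVerma hd hs hA hσ hv' htop' ha hb hβa hβb
  obtain ⟨π, hπ, hπv⟩ := exists_isHom_radVerma hd hs hρ hv.mem hv.e
  have hπ' := hπ.rTensor (σ := σ)
  refine ⟨π.rTensor N m, hπ'.map_wt hm.mem, fun i => by rw [← hπ'.e, hm.e, map_zero], ?_⟩
  have hg := radVermaRep_isHighest R κ₁ hd hs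
  have hgtop := radVermaRep_fspan R κ₁ hd hs
  -- The first tensor factors occurring in `m` have content at most `β`. On their span `π` is
  -- injective, because its kernel is a proper stable subspace and so vanishes at these depths.
  set low : Submodule ℂ (RadVerma R κ₁ d) := Submodule.span ℂ
    (Set.range fun w : {w : List ι // content w ≤ β} =>
      (radVermaRep R κ₁ hd hs).fprod w (radVermaGen R κ₁ d)) with hlow_def
  have hlow : ∀ y ∈ low, π y = 0 → y = 0 := fun y hy hy0 =>
    eq_zero_of_mem_stable_of_mem_span hA hd hs (radVermaRep_radTrivial R κ₁ hd hs) hg hgtop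
      hπ.stable_ker (by rw [LinearMap.mem_ker, hπv]; exact hv.ne_zero) ha hβa hy hy0
  have hinj : Function.Injective ((π ∘ₗ low.subtype).rTensor N) :=
    Module.Flat.rTensor_preserves_injective_linearMap _ (by
      rw [injective_iff_map_eq_zero]
      rintro ⟨y, hy⟩ h
      exact Subtype.ext (hlow y hy h))
  have hm' : m ∈ LinearMap.range (low.subtype.rTensor N) := by
    have h1 := mem_span_weight (fprod_tmul_fprod_mem_wt hg.mem hv'.mem)
      (span_fprod_tmul_fprod hgtop htop' ▸ Submodule.mem_top) hm.mem
    refine Submodule.span_le.2 ?_ h1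
    rintro _ ⟨w, hw, rfl⟩
    have h : content w.1 + content w.2 = β := R.rootSum_injective (by simpa using hw)
    exact ⟨⟨_, Submodule.subset_span ⟨⟨w.1, h ▸ le_self_add⟩, rfl⟩⟩ ⊗ₜ σ.fprod w.2 v',
      LinearMap.rTensor_tmul _ _ _ _⟩
  obtain ⟨z, rfl⟩ := hm'
  intro h0
  rw [← LinearMap.comp_apply, ← LinearMap.rTensor_comp] at h0
  have hz : z = 0 := hinj (h0.trans (map_zero _).symm)
  exact hm.ne_zero (by rw [hz, map_zero])

end Transport

end WeakRep

end

section

variable {ι : Type*} [Fintype ι] [DecidableEq ι] {A : Matrix ι ι ℤ}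
  {H : Type*} [AddCommGroup H] [Module ℂ H] {R : Realization A H}
  {M : Type*} [AddCommGroup M] [Module ℂ M] {N : Type*} [AddCommGroup N] [Module ℂ N]

/-! ### Serre relations -/

section Serre

variable {d : ι → ℝ} (hA : IsGCM A) (hd : ∀ i, 0 < d i) (hs : ∀ i j, d i * A i j = d j * A j i)

/-- The word `[x_i, [x_i, … [x_i, x_j]]]` with `n` letters in front of the last one. -/
def serreWord (n : ℕ) (i j : ι) : WordSpace ι := Finsupp.single (List.replicate n i, j) 1

lemma serreWord_succ (n : ℕ) (i j : ι) : serreWord (n + 1) i j = consWord i (serreWord n i j) := by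
  simp [serreWord, List.replicate_succ]

lemma serreWord_apply_nil_of_ne {j k : ι} (hjk : j ≠ k) (n : ℕ) (i : ι) :
    serreWord n i j ([], k) = 0 := by
  simp [serreWord, hjk]

lemma serreWord_succ_apply_nil (n : ℕ) (i j k : ι) : serreWord (n + 1) i j ([], k) = 0 := by
  rw [serreWord_succ, consWord_apply_nil]

lemma der_serreWord_of_ne {i j k : ι} (hi : i ≠ k) (hj : j ≠ k) (n : ℕ) :
    der A k (serreWord n i j) = 0 := by
  induction n with
  | zero => exact der_single_nil _ _ _ _
  | succ n ih =>
    rw [serreWord_succ, der_consWord, if_neg hi, ih, serreWord_apply_nil_of_ne hj]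
    simp

include hA in
-- The `sl₂` formula for the string through `x_j`; the coefficient vanishes exactly when `n =
-- -a_ij`, the length in the Serre relation.
lemma der_serreWord_left {i j : ι} (hij : i ≠ j) (n : ℕ) :
    der A i (serreWord (n + 1) i j) = (-((n + 1) * (n + A i j)) : ℂ) • serreWord n i j := by
  have hw : ∀ n, wordWeight (fun p => (A i p : ℂ)) (serreWord n i j) =
      (2 * n + A i j : ℂ) • serreWord n i j := by
    intro n
    simp [serreWord, wordSum, hA.diag, mul_comm]
  induction n with
  | zero =>
    rw [serreWord_succ, der_consWord, if_pos rfl, hw, serreWord_apply_nil_of_ne hij.symm]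
    have : der A i (serreWord 0 i j) = 0 := der_single_nil _ _ _ _
    rw [this]
    simp
  | succ n ih =>
    rw [serreWord_succ, der_consWord, if_pos rfl, hw, ih, serreWord_apply_nil_of_ne hij.symm,
      map_smul, ← serreWord_succ]
    push_cast
    module

lemma der_serreWord_right {i j : ι} (hij : i ≠ j) (n : ℕ) :
    der A j (serreWord (n + 1) i j) = (A j i : ℂ) • serreWord n i i := by
  induction n with
  | zero =>
    rw [serreWord_succ, der_consWord, if_neg hij]
    have : der A j (serreWord 0 i j) = 0 := der_single_nil _ _ _ _
    rw [this]
    simp [serreWord]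
  | succ n ih =>
    rw [serreWord_succ, der_consWord, if_neg hij, ih, serreWord_succ_apply_nil, map_smul,
      ← serreWord_succ]
    simp

include hd hs in
-- Formally `[x_i, x_i]` is a nonzero word, but the weight term and the boundary term of its
-- derivative cancel, each being `a_ii` times a letter up to sign.
lemma serreWord_self_mem_wordRadical (n : ℕ) (i : ι) :
    serreWord (n + 1) i i ∈ wordRadical A d := by
  induction n with
  | succ n ih => rw [serreWord_succ]; exact consWord_mem_wordRadical ih i
  | zero =>
    refine mem_wordRadical_of_der hd hs (serreWord_succ_apply_nil 0 i i) fun k => ?_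
    have h0 : der A k (serreWord (0 + 1) i i) = 0 := by
      rw [serreWord_succ, der_consWord]
      have : der A k (serreWord 0 i i) = 0 := der_single_nil _ _ _ _
      rw [this]
      by_cases h : i = k
      · subst h
        simp [serreWord, wordSum]
      · simp [h, serreWord]
    rw [h0]
    exact zero_mem _

include hA hd hs in
-- All derivatives lie in the radical: the one at `i` has a zero coefficient, the one at `j` is a
-- multiple of an iterated `[x_i, x_i]`, the others are zero. If `a_ij = 0` the derivative at `j` is
-- a single letter, and `a_ji = 0` is used.
lemma serreWord_mem_wordRadical {i j : ι} (hij : i ≠ j) :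
    serreWord (1 - A i j).toNat i j ∈ wordRadical A d := by
  have h1 := hA.nonpos i j hij
  obtain ⟨n, hn⟩ : ∃ n : ℕ, A i j = -n := ⟨(-A i j).toNat, by omega⟩
  have h2 : (1 - A i j).toNat = n + 1 := by omega
  rw [h2]
  refine mem_wordRadical_of_der hd hs (serreWord_succ_apply_nil n i j) fun k => ?_
  by_cases hi : i = k
  · subst hi
    rw [der_serreWord_left hA hij, hn]
    simp
  by_cases hj : j = k
  · subst hj
    rw [der_serreWord_right hij]
    rcases n with - | n
    · rw [hA.zero_symm i j (by simpa using hn)]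
      simp
    · exact Submodule.smul_mem _ _ (serreWord_self_mem_wordRadical hd hs n i)
  · rw [der_serreWord_of_ne hi hj]
    exact zero_mem _

lemma bracket_serreWord (a : ι → Module.End ℂ M) (n : ℕ) (i j : ι) :
    bracket a (serreWord n i j) = ((LieAlgebra.ad ℂ (Module.End ℂ M) (a i)) ^ n) (a j) := by
  induction n with
  | zero => simp [serreWord, bracketWord]
  | succ n ih => rw [serreWord_succ, bracket_consWord, ih, pow_succ', Module.End.mul_apply,
      LieAlgebra.ad_apply]

end Serre

namespace WeakRep

/-! ### Integrability -/

/-- The operators `f i` are locally nilpotent. -/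
def Integrable (ρ : WeakRep R M) : Prop := ∀ i m, ∃ k, (ρ.f i ^ k) m = 0

lemma pow_apply_eq_zero_of_le {f : Module.End ℂ M} {m : M} {k l : ℕ} (hk : (f ^ k) m = 0)
    (hkl : k ≤ l) : (f ^ l) m = 0 := by
  obtain ⟨c, rfl⟩ := Nat.exists_eq_add_of_le' hkl
  rw [pow_add, Module.End.mul_apply, hk, map_zero]

/-- The vectors killed by a power of `f`. -/
def nilpotentSubmodule (f : Module.End ℂ M) : Submodule ℂ M where
  carrier := {m | ∃ k, (f ^ k) m = 0}
  zero_mem' := ⟨0, by simp⟩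
  add_mem' := by
    rintro a b ⟨k, hk⟩ ⟨l, hl⟩
    refine ⟨k + l, ?_⟩
    rw [map_add, pow_apply_eq_zero_of_le hk le_self_add, pow_apply_eq_zero_of_le hl le_add_self,
      add_zero]
  smul_mem' := by
    rintro c a ⟨k, hk⟩
    exact ⟨k, by rw [map_smul, hk, smul_zero]⟩

lemma mem_nilpotentSubmodule {f : Module.End ℂ M} {m : M} :
    m ∈ nilpotentSubmodule f ↔ ∃ k, (f ^ k) m = 0 := Iff.rfl

/-- Operators that are ad-nilpotent with respect to `f` preserve the vectors killed by a power
of `f`. -/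
lemma apply_mem_nilpotentSubmodule {f g : Module.End ℂ M}
    (hg : ∃ n, ((LieAlgebra.ad ℂ (Module.End ℂ M) f) ^ n) g = 0) {m : M}
    (hm : m ∈ nilpotentSubmodule f) : g m ∈ nilpotentSubmodule f := by
  obtain ⟨n, hn⟩ := hg
  obtain ⟨k, hk⟩ := hm
  -- In `f (g m) = [f, g] m + g (f m)` the first term lowers the nilpotency order of `g` under `ad
  -- f`, the second that of `m` under `f`.
  induction hN : n + k using Nat.strong_induction_on generalizing n k g m with
  | _ N ih =>
    rcases n with - | n
    · have : g = 0 := by simpa using hn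
      rw [this, LinearMap.zero_apply]
      exact zero_mem _
    rcases k with - | k
    · have : m = 0 := by simpa using hk
      rw [this, map_zero]
      exact zero_mem _
    have h1 : ⁅f, g⁆ m ∈ nilpotentSubmodule f :=
      ih (n + (k + 1)) (by omega) n (by rwa [pow_succ, Module.End.mul_apply,
        LieAlgebra.ad_apply] at hn) (k + 1) hk rfl
    have h2 : g (f m) ∈ nilpotentSubmodule f :=
      ih (n + 1 + k) (by omega) (n + 1) hn k (by rwa [pow_succ, Module.End.mul_apply] at hk) rfl
    obtain ⟨l, hl⟩ : f (g m) ∈ nilpotentSubmodule f := by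
      rw [apply_lie_comm]
      exact add_mem h1 h2
    exact ⟨l + 1, by rwa [pow_succ, Module.End.mul_apply]⟩

variable {ρ : WeakRep R M} {σ : WeakRep R N} {d : ι → ℝ} {κ : Module.Dual ℂ H}

lemma Integrable.tensor (hρ : ρ.Integrable) (hσ : σ.Integrable) : (ρ.tensor σ).Integrable := by
  intro i z
  rw [← mem_nilpotentSubmodule]
  induction z with
  | zero => exact zero_mem _
  | add z z' h h' => exact add_mem h h'
  | tmul a b =>
    obtain ⟨k, hk⟩ := hρ i a
    obtain ⟨l, hl⟩ := hσ i b
    induction hN : k + l using Nat.strong_induction_on generalizing k l a b with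
    | _ N ih =>
      rcases k with - | k
      · have : a = 0 := by simpa using hk
        rw [this, TensorProduct.zero_tmul]
        exact zero_mem _
      rcases l with - | l
      · have : b = 0 := by simpa using hl
        rw [this, TensorProduct.tmul_zero]
        exact zero_mem _
      obtain ⟨n, hn⟩ : (ρ.tensor σ).f i (a ⊗ₜ b) ∈ nilpotentSubmodule ((ρ.tensor σ).f i) := by
        rw [tensor_f_tmul]
        exact add_mem
          (ih (k + (l + 1)) (by omega) _ _ k (by rwa [pow_succ, Module.End.mul_apply] at hk)
            (l + 1) hl rfl)
          (ih (k + 1 + l) (by omega) _ _ (k + 1) hk l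
            (by rwa [pow_succ, Module.End.mul_apply] at hl) rfl)
      exact ⟨n + 1, by rwa [pow_succ, Module.End.mul_apply]⟩

/-- A singular vector below the highest weight of an irreducible representation is zero. -/
lemma eq_zero_of_singular (hirr : ∀ p, ρ.Stable p → p ≠ ⊤ → p = ⊥) (hv : ρ.IsHighest κ v)
    {β : ι → ℕ} (hβ : β ≠ 0) {y : M} (hy : y ∈ ρ.wt (κ - R.rootSum β))
    (hye : ∀ i, ρ.e i y = 0) : y = 0 := by
  have h : ρ.fspan y = ⊥ := by
    refine hirr _ (stable_fspan hy hye) fun htop => ?_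
    obtain ⟨w, hw⟩ := exists_weight_of_mem_wt (fprod_mem_wt hy)
      (htop ▸ Submodule.mem_top : v ∈ ρ.fspan y) hv.mem hv.ne_zero
    have h0 : R.rootSum (β + content w) = R.rootSum 0 := by
      rw [R.rootSum_add, R.rootSum_zero]
      linear_combination (norm := module) (-1 : ℂ) • hw
    exact hβ (add_eq_zero.1 (R.rootSum_injective h0)).1
  have := self_mem_fspan (ρ := ρ) y
  rwa [h, Submodule.mem_bot] at this

/-- An irreducible highest weight representation of dominant integral highest weight is
integrable. -/
theorem integrable_of_irreducible (hA : IsGCM A) (hd : ∀ i, 0 < d i)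
    (hs : ∀ i j, d i * A i j = d j * A j i) (hρ : ρ.RadTrivial d)
    (hirr : ∀ p, ρ.Stable p → p ≠ ⊤ → p = ⊥) {v : M} (hv : ρ.IsHighest κ v)
    (htop : ρ.fspan v = ⊤) (hκ : ∀ i, ∃ n : ℕ, κ (R.coroot i) = n) : ρ.Integrable := by
  intro i m
  have hvi : v ∈ nilpotentSubmodule (ρ.f i) := by
    obtain ⟨n, hn⟩ := hκ i
    -- With `n = κ(α_i^∨)`, the vector `f_i^(n+1) v` is singular by the `sl₂` formula, hence zero by
    -- irreducibility.
    refine ⟨n + 1, eq_zero_of_singular hirr hv (β := (n + 1) • Pi.single i 1) ?_ ?_ fun j => ?_⟩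
    · intro h
      have := congrFun h i
      simp at this
    · have h := f_pow_mem_wt hv.mem i (n + 1)
      have h2 : R.rootSum ((n + 1) • Pi.single i 1) = ((n + 1 : ℕ) : ℂ) • R.root i := by
        rw [Realization.rootSum, Finset.sum_eq_single i] <;> simp +contextual
      rwa [h2]
    · by_cases hj : j = i
      · subst hj
        rw [e_f_pow hA hv.mem (hv.e j), hn]
        simp
      · exact e_f_pow_of_ne hj (hv.e j) _
  have hf : ∀ j, ∀ m ∈ nilpotentSubmodule (ρ.f i), ρ.f j m ∈ nilpotentSubmodule (ρ.f i) := by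
    intro j m hm
    by_cases hij : i = j
    · subst hij
      exact apply_mem_nilpotentSubmodule ⟨1, by simp⟩ hm
    · refine apply_mem_nilpotentSubmodule ⟨(1 - A i j).toNat, ?_⟩ hm
      rw [← bracket_serreWord]
      exact (hρ _ (serreWord_mem_wordRadical hA hd hs hij)).2
  have hle : ρ.fspan v ≤ nilpotentSubmodule (ρ.f i) := by
    rw [fspan, Submodule.span_le]
    rintro _ ⟨w, rfl⟩
    induction w with
    | nil => simpa using hvi
    | cons j w ih =>
      change ρ.fprod (j :: w) v ∈ nilpotentSubmodule _
      rw [fprod_cons]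
      exact hf j _ ih
  exact hle (htop ▸ Submodule.mem_top)

end WeakRep

end

section

variable {ι : Type*} [Fintype ι] [DecidableEq ι] {A : Matrix ι ι ℤ}
  {H : Type*} [AddCommGroup H] [Module ℂ H] {R : Realization A H}
  {M : Type*} [AddCommGroup M] [Module ℂ M] {N : Type*} [AddCommGroup N] [Module ℂ N]

/-! ### Representations of the Kac-Moody algebra -/

section LieAlgebra

variable (R) in
/-- The projection of the free Lie algebra onto the Kac-Moody algebra. -/
def proj : FreeLie ι H →ₗ⁅ℂ⁆ KMAlgebra R where
  toFun x := LieSubmodule.Quotient.mk (N := relatorIdeal R) x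
  map_add' _ _ := rfl
  map_smul' _ _ := rfl
  map_lie' {x y} := LieSubmodule.Quotient.mk_bracket (I := relatorIdeal R) x y

lemma proj_surjective : Function.Surjective (proj R) :=
  LieSubmodule.Quotient.surjective_mk' (relatorIdeal R)

lemma proj_of (x : Generators ι H) : proj R (FreeLieAlgebra.of ℂ x) = gen R x := rfl

lemma proj_eq_zero_of_relator {x : FreeLie ι H} (hx : Relator R x) : proj R x = 0 :=
  LieSubmodule.Quotient.mk_eq_zero'.2 (LieSubmodule.subset_lieSpan hx)

variable (R) in
/-- The map from `H` to the Kac-Moody algebra. -/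
def genH : H →ₗ[ℂ] KMAlgebra R where
  toFun t := gen R (.h t)
  map_add' s t := by
    have := proj_eq_zero_of_relator (Relator.add (R := R) s t)
    rwa [map_sub, map_add, sub_eq_zero] at this
  map_smul' c t := by
    have := proj_eq_zero_of_relator (Relator.smul (R := R) c t)
    rwa [map_sub, map_smul, sub_eq_zero] at this

lemma lie_gen_h_h (s t : H) : ⁅gen R (.h s), gen R (.h t)⁆ = 0 := by
  simpa only [LieHom.map_lie, proj_of] using proj_eq_zero_of_relator (Relator.hh (R := R) s t)

lemma lie_gen_h_e (t : H) (i : ι) : ⁅gen R (.h t), gen R (.e i)⁆ = R.root i t • gen R (.e i) := by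
  simpa only [LieHom.map_lie, proj_of, map_sub, map_smul, sub_eq_zero] using
    proj_eq_zero_of_relator (Relator.he (R := R) t i)

lemma lie_gen_h_f (t : H) (i : ι) :
    ⁅gen R (.h t), gen R (.f i)⁆ = -(R.root i t • gen R (.f i)) := by
  simpa only [LieHom.map_lie, proj_of, map_add, map_smul, add_eq_zero_iff_eq_neg] using
    proj_eq_zero_of_relator (Relator.hf (R := R) t i)

lemma lie_gen_e_f (i j : ι) :
    ⁅gen R (.e i), gen R (.f j)⁆ = if i = j then gen R (.h (R.coroot i)) else 0 := by
  split_ifs with h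
  · subst h
    simpa only [LieHom.map_lie, proj_of, map_sub, sub_eq_zero] using
      proj_eq_zero_of_relator (Relator.ef_same (R := R) i)
  · simpa only [LieHom.map_lie, proj_of] using
      proj_eq_zero_of_relator (Relator.ef_ne (R := R) i j h)

lemma WeakRep.ext {ρ σ : WeakRep R M} (h : ρ.h = σ.h) (e : ρ.e = σ.e) (f : ρ.f = σ.f) : ρ = σ := by
  cases ρ
  cases σ
  cases h
  cases e
  cases f
  rfl

/-- The Chevalley operators of a representation of the Kac-Moody algebra. -/
def WeakRep.ofLieHom (φ : KMAlgebra R →ₗ⁅ℂ⁆ Module.End ℂ M) : WeakRep R M where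
  h := (φ : KMAlgebra R →ₗ[ℂ] Module.End ℂ M) ∘ₗ genH R
  e i := φ (gen R (.e i))
  f i := φ (gen R (.f i))
  lie_hh s t := (φ.map_lie _ _).symm.trans ((congrArg φ (lie_gen_h_h s t)).trans (map_zero φ))
  lie_he t i := (φ.map_lie _ _).symm.trans ((congrArg φ (lie_gen_h_e t i)).trans (map_smul φ _ _))
  lie_hf t i := (φ.map_lie _ _).symm.trans ((congrArg φ (lie_gen_h_f t i)).trans
    (by rw [map_neg, map_smul]))
  lie_ef i j := (φ.map_lie _ _).symm.trans ((congrArg φ (lie_gen_e_f i j)).trans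
    (by split_ifs <;> first | rfl | exact map_zero φ))

lemma map_ad_pow {L L' : Type*} [LieRing L] [LieAlgebra ℂ L] [LieRing L'] [LieAlgebra ℂ L']
    (φ : L →ₗ⁅ℂ⁆ L') (n : ℕ) (x y : L) :
    φ ((LieAlgebra.ad ℂ L x ^ n) y) = (LieAlgebra.ad ℂ L' (φ x) ^ n) (φ y) := by
  induction n with
  | zero => simp
  | succ n ih => rw [pow_succ', pow_succ', Module.End.mul_apply, Module.End.mul_apply,
      LieAlgebra.ad_apply, LieAlgebra.ad_apply, LieHom.map_lie, ih]

variable {d : ι → ℝ} (hA : IsGCM A) (hd : ∀ i, 0 < d i) (hs : ∀ i j, d i * A i j = d j * A j i)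

include hA hd hs in
/-- A representation of the Chevalley relations on which the radical acts by zero is a
representation of the Kac-Moody algebra. -/
lemma WeakRep.exists_lieHom (ρ : WeakRep R M) (hρ : ρ.RadTrivial d) :
    ∃ φ : KMAlgebra R →ₗ⁅ℂ⁆ Module.End ℂ M, WeakRep.ofLieHom φ = ρ := by
  let g : Generators ι H → Module.End ℂ M := fun
    | .h t => ρ.h t
    | .e i => ρ.e i
    | .f i => ρ.f i
  let ψ : FreeLie ι H →ₗ⁅ℂ⁆ Module.End ℂ M := FreeLieAlgebra.lift ℂ g
  have hψh : ∀ t, ψ (freeH ι t) = ρ.h t := fun t => FreeLieAlgebra.lift_of_apply g _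
  have hψe : ∀ t, ψ (freeE H t) = ρ.e t := fun t => FreeLieAlgebra.lift_of_apply g _
  have hψf : ∀ t, ψ (freeF H t) = ρ.f t := fun t => FreeLieAlgebra.lift_of_apply g _
  have hle : relatorIdeal R ≤ ψ.ker := by
    rw [relatorIdeal, LieSubmodule.lieSpan_le]
    intro x hx
    rw [SetLike.mem_coe, LieHom.mem_ker]
    cases hx with
    | add x y => rw [map_sub, map_add, hψh, hψh, hψh, map_add, sub_self]
    | smul c x => rw [map_sub, map_smul, hψh, hψh, map_smul, sub_self]
    | hh x y => rw [LieHom.map_lie, hψh, hψh, ρ.lie_hh]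
    | he x i => rw [map_sub, map_smul, LieHom.map_lie, hψh, hψe, ρ.lie_he, sub_self]
    | hf x i => rw [map_add, map_smul, LieHom.map_lie, hψh, hψf, ρ.lie_hf, neg_add_cancel]
    | ef_same i => rw [map_sub, LieHom.map_lie, hψe, hψf, hψh, ρ.lie_ef, if_pos rfl, sub_self]
    | ef_ne i j hij => rw [LieHom.map_lie, hψe, hψf, ρ.lie_ef, if_neg hij]
    | serre_e i j hij =>
      rw [map_ad_pow, hψe, hψe, ← bracket_serreWord]
      exact (hρ _ (serreWord_mem_wordRadical hA hd hs hij)).1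
    | serre_f i j hij =>
      rw [map_ad_pow, hψf, hψf, ← bracket_serreWord]
      exact (hρ _ (serreWord_mem_wordRadical hA hd hs hij)).2
  let φ₀ : KMAlgebra R →ₗ[ℂ] Module.End ℂ M :=
    Submodule.liftQ (relatorIdeal R).toSubmodule (ψ : FreeLie ι H →ₗ[ℂ] Module.End ℂ M) hle
  have hφ₀ : ∀ x, φ₀ (proj R x) = ψ x := fun x => rfl
  let φ : KMAlgebra R →ₗ⁅ℂ⁆ Module.End ℂ M :=
    { φ₀ with
      map_lie' := by
        intro x y
        obtain ⟨x, rfl⟩ := proj_surjective x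
        obtain ⟨y, rfl⟩ := proj_surjective y
        change φ₀ _ = ⁅φ₀ _, φ₀ _⁆
        rw [← LieHom.map_lie, hφ₀, hφ₀, hφ₀, LieHom.map_lie] }
  refine ⟨φ, ?_⟩
  exact WeakRep.ext (LinearMap.ext hψh) (funext hψe) (funext hψf)

/-- A subspace that is stable under the Chevalley operators is stable under the Kac-Moody
algebra. -/
lemma WeakRep.Stable.lie_mem {φ : KMAlgebra R →ₗ⁅ℂ⁆ Module.End ℂ M} {p : Submodule ℂ M}
    (hp : (WeakRep.ofLieHom φ).Stable p) (x : KMAlgebra R) {m : M} (hm : m ∈ p) : φ x m ∈ p := by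
  let K : LieSubalgebra ℂ (FreeLie ι H) :=
    { carrier := {x | ∀ m ∈ p, φ (proj R x) m ∈ p}
      zero_mem' := fun m _ => by simp
      add_mem' := fun {a b} ha hb m hm => by
        rw [map_add, map_add, LinearMap.add_apply]
        exact add_mem (ha m hm) (hb m hm)
      smul_mem' := fun c a ha m hm => by
        rw [map_smul, map_smul, LinearMap.smul_apply]
        exact p.smul_mem _ (ha m hm)
      lie_mem' := fun {a b} ha hb m hm => by
        rw [LieHom.map_lie, LieHom.map_lie, Ring.lie_def]
        exact sub_mem (ha _ (hb m hm)) (hb _ (ha m hm)) }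
  have hK : ∀ g : Generators ι H, FreeLieAlgebra.of ℂ g ∈ K := by
    rintro (t | i | i)
    · exact hp.h t
    · exact hp.e i
    · exact hp.f i
  -- The generators lie in `K`, so the identity of the free Lie algebra factors through `K`; this
  -- replaces an induction on Lie elements.
  have h : K.incl.comp (FreeLieAlgebra.lift ℂ fun g => (⟨_, hK g⟩ : K)) = LieHom.id := by
    refine FreeLieAlgebra.hom_ext fun g => ?_
    rw [LieHom.comp_apply, FreeLieAlgebra.lift_of_apply]
    rfl
  obtain ⟨x, rfl⟩ := proj_surjective x
  have hx : x ∈ K := by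
    have := LieHom.congr_fun h x
    rw [LieHom.id_apply] at this
    rw [← this]
    exact Subtype.property _
  exact hx m hm

end LieAlgebra

/-! ### Modules over the enveloping algebra -/

section Envelope

lemma env_mem_of_ι_mem (S : Subalgebra ℂ (Env R))
    (hS : ∀ x, UniversalEnvelopingAlgebra.ι ℂ x ∈ S) (a : Env R) : a ∈ S := by
  let g : KMAlgebra R →ₗ⁅ℂ⁆ S :=
    { toFun := fun x => ⟨_, hS x⟩
      map_add' := fun x y => Subtype.ext (map_add _ x y)
      map_smul' := fun c x => Subtype.ext (map_smul _ c x)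
      map_lie' := fun {x y} => Subtype.ext (LieHom.map_lie _ x y) }
  have h : S.val.comp (UniversalEnvelopingAlgebra.lift ℂ g) = AlgHom.id ℂ (Env R) := by
    refine UniversalEnvelopingAlgebra.hom_ext (L := KMAlgebra R) (R := ℂ) ?_
    refine LieHom.ext fun x => ?_
    change S.val (UniversalEnvelopingAlgebra.lift ℂ g (UniversalEnvelopingAlgebra.ι ℂ x)) = _
    rw [UniversalEnvelopingAlgebra.lift_ι_apply]
    rfl
  have h2 := AlgHom.congr_fun h a
  rw [AlgHom.id_apply] at h2
  rw [← h2]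
  exact Subtype.property _

variable [Module (Env R) M] [IsScalarTower ℂ (Env R) M]

variable (R M) in
/-- The action of the Kac-Moody algebra on a module over its enveloping algebra. -/
def envAction : KMAlgebra R →ₗ⁅ℂ⁆ Module.End ℂ M where
  toFun x := (Algebra.lsmul ℂ ℂ M : Env R →ₐ[ℂ] Module.End ℂ M) (UniversalEnvelopingAlgebra.ι ℂ x)
  map_add' x y := by rw [map_add, map_add]
  map_smul' c x := by rw [map_smul, map_smul]; rfl
  map_lie' {x y} := by
    rw [LieHom.map_lie, Ring.lie_def, Ring.lie_def, map_sub, map_mul, map_mul]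

variable (R M) in
/-- The Chevalley operators on a module over the enveloping algebra. -/
abbrev envRep : WeakRep R M := WeakRep.ofLieHom (envAction R M)

lemma WeakRep.Stable.smul_mem {p : Submodule ℂ M} (hp : (envRep R M).Stable p) (a : Env R) {m : M}
    (hm : m ∈ p) : a • m ∈ p := by
  let S : Subalgebra ℂ (Env R) :=
    { carrier := {a | ∀ m ∈ p, a • m ∈ p}
      mul_mem' := fun {a b} ha hb m hm => by
        rw [mul_smul]
        exact ha _ (hb m hm)
      add_mem' := fun {a b} ha hb m hm => by
        rw [add_smul]
        exact add_mem (ha m hm) (hb m hm)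
      algebraMap_mem' := fun c m hm => by
        rw [algebraMap_smul]
        exact p.smul_mem c hm }
  exact env_mem_of_ι_mem S (fun x m hm => hp.lie_mem x hm) a m hm

/-- The submodule over the enveloping algebra given by a stable subspace. -/
def WeakRep.Stable.toSubmodule {p : Submodule ℂ M} (hp : (envRep R M).Stable p) :
    Submodule (Env R) M where
  carrier := p
  zero_mem' := p.zero_mem
  add_mem' := p.add_mem
  smul_mem' a _ hm := hp.smul_mem a hm

lemma stable_restrictScalars (p : Submodule (Env R) M) :
    (envRep R M).Stable (p.restrictScalars ℂ) :=
  ⟨fun _ _ hm => p.smul_mem _ hm, fun _ _ hm => p.smul_mem _ hm, fun _ _ hm => p.smul_mem _ hm⟩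

lemma isHom_of_linearMap [Module (Env R) N] [IsScalarTower ℂ (Env R) N] (ψ : M →ₗ[Env R] N) :
    WeakRep.IsHom (envRep R M) (envRep R N) (ψ.restrictScalars ℂ) :=
  ⟨fun _ _ => map_smul ψ _ _, fun _ _ => map_smul ψ _ _, fun _ _ => map_smul ψ _ _⟩

end Envelope

end

section

variable {ι : Type*} [Fintype ι] [DecidableEq ι] {A : Matrix ι ι ℤ}
  {H : Type*} [AddCommGroup H] [Module ℂ H] {R : Realization A H}
  {M : Type*} [AddCommGroup M] [Module ℂ M] {N : Type*} [AddCommGroup N] [Module ℂ N]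
  {d : ι → ℝ} {κ : Module.Dual ℂ H}

/-! ### Verma modules -/

section VermaModule

variable (R κ) in
/-- The generator of the Verma module. -/
def vermaGen : Verma R κ := Submodule.Quotient.mk 1

lemma smul_vermaGen (a : Env R) : a • vermaGen R κ = Submodule.Quotient.mk a := by
  rw [vermaGen, ← Submodule.Quotient.mk_smul, smul_eq_mul, mul_one]

lemma vermaGen_e (i : ι) : (envRep R (Verma R κ)).e i (vermaGen R κ) = 0 := by
  refine (smul_vermaGen _).trans ?_
  rw [Submodule.Quotient.mk_eq_zero]
  exact Submodule.subset_span (Or.inl ⟨i, rfl⟩)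

lemma vermaGen_mem_wt : vermaGen R κ ∈ (envRep R (Verma R κ)).wt κ := by
  intro t
  refine (smul_vermaGen _).trans ?_
  rw [← algebraMap_smul (Env R) (κ t) (vermaGen R κ), smul_vermaGen, Submodule.Quotient.eq]
  exact Submodule.subset_span (Or.inr ⟨t, rfl⟩)

lemma vermaGen_fspan : (envRep R (Verma R κ)).fspan (vermaGen R κ) = ⊤ := by
  rw [eq_top_iff]
  intro y _
  obtain ⟨a, rfl⟩ := Submodule.Quotient.mk_surjective _ y
  rw [← smul_vermaGen]
  exact (WeakRep.stable_fspan vermaGen_mem_wt vermaGen_e).smul_mem a (WeakRep.self_mem_fspan _)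

/-- The universal property of the Verma module. -/
lemma exists_verma_linearMap [Module (Env R) M] [IsScalarTower ℂ (Env R) M] {u : M}
    (hu : u ∈ (envRep R M).wt κ) (he : ∀ i, (envRep R M).e i u = 0) :
    ∃ ψ : Verma R κ →ₗ[Env R] M, ψ (vermaGen R κ) = u := by
  refine ⟨Submodule.liftQ _ (LinearMap.toSpanSingleton (Env R) M u) ?_, ?_⟩
  · rw [vermaIdeal, Submodule.span_le]
    rintro _ (⟨i, rfl⟩ | ⟨t, rfl⟩)
    · exact he i
    · rw [SetLike.mem_coe, LinearMap.mem_ker, LinearMap.toSpanSingleton_apply, sub_smul,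
        algebraMap_smul, sub_eq_zero]
      exact hu t
  · rw [vermaGen, Submodule.liftQ_apply, LinearMap.toSpanSingleton_apply, one_smul]

/-- A representation of the Kac-Moody algebra makes a module over the enveloping algebra. -/
abbrev envModule (φ : KMAlgebra R →ₗ⁅ℂ⁆ Module.End ℂ M) : Module (Env R) M :=
  Module.compHom M (UniversalEnvelopingAlgebra.lift ℂ φ).toRingHom

lemma envModule_isScalarTower (φ : KMAlgebra R →ₗ⁅ℂ⁆ Module.End ℂ M) :
    letI := envModule φ
    IsScalarTower ℂ (Env R) M := by
  let _ := envModule φ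
  refine ⟨fun c a m => ?_⟩
  change UniversalEnvelopingAlgebra.lift ℂ φ (c • a) m =
    c • UniversalEnvelopingAlgebra.lift ℂ φ a m
  rw [map_smul, LinearMap.smul_apply]

lemma envModule_envAction (φ : KMAlgebra R →ₗ⁅ℂ⁆ Module.End ℂ M) :
    letI := envModule φ
    letI := envModule_isScalarTower φ
    envAction R M = φ := by
  refine LieHom.ext fun x => LinearMap.ext fun m => ?_
  change UniversalEnvelopingAlgebra.lift ℂ φ (UniversalEnvelopingAlgebra.ι ℂ x) m = _
  rw [UniversalEnvelopingAlgebra.lift_ι_apply]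

variable (hA : IsGCM A) (hd : ∀ i, 0 < d i) (hs : ∀ i j, d i * A i j = d j * A j i)

include hA hd hs in
-- Nonvanishing of the generator is the point. The explicit representation on `RadVerma` satisfies
-- the Serre relations and has a nonzero highest weight vector, which is the image of the generator;
-- no PBW theorem is used.
lemma vermaGen_isHighest : (envRep R (Verma R κ)).IsHighest κ (vermaGen R κ) where
  mem := vermaGen_mem_wt
  e := vermaGen_e
  ne_zero := by
    obtain ⟨φ, hφ⟩ := (radVermaRep R κ hd hs).exists_lieHom hA hd hs
      (radVermaRep_radTrivial R κ hd hs)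
    have hg := radVermaRep_isHighest R κ hd hs
    let _ := envModule φ
    let _ := envModule_isScalarTower φ
    have hφ' : envRep R (RadVerma R κ d) = radVermaRep R κ hd hs := by
      rw [envRep, envModule_envAction, hφ]
    rw [← hφ'] at hg
    obtain ⟨ψ, hψ⟩ := exists_verma_linearMap hg.mem hg.e
    intro h0
    rw [h0, map_zero] at hψ
    exact hg.ne_zero hψ.symm

/-- The span of the vectors of weight lower than the highest weight. -/
def vermaLower (R : Realization A H) (κ : Module.Dual ℂ H) : Submodule ℂ (Verma R κ) :=
  Submodule.span ℂ ((fun w => (envRep R (Verma R κ)).fprod w (vermaGen R κ)) ''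
    {w | κ - R.rootSum (content w) ≠ κ})

/-- A submodule contains the weight components of its elements, and a nonzero component of weight
`κ` is a multiple of the generator. This bound passes to sums, so the sum of all proper submodules
is proper. -/
lemma le_vermaLower {p : Submodule (Env R) (Verma R κ)} (hp : p ≠ ⊤) :
    p.restrictScalars ℂ ≤ vermaLower R κ := by
  intro x hx
  have htop : ∀ x, x ∈ (envRep R (Verma R κ)).fspan (vermaGen R κ) := 
    Submodule.eq_top_iff'.1 vermaGen_fspan
  obtain ⟨y, hyp, hy, -, hxy⟩ := WeakRep.exists_component
    (WeakRep.fprod_mem_wt vermaGen_mem_wt) (stable_restrictScalars p).h (htop x) hx κ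
  suffices h : y = 0 by
    rw [h, sub_zero] at hxy
    exact hxy
  by_contra hy0
  obtain ⟨c, rfl⟩ := WeakRep.mem_span_of_mem_wt vermaGen_mem_wt (htop y) hy
  have hc0 : c ≠ 0 := by rintro rfl; simp at hy0
  have hg : vermaGen R κ ∈ p := ((p.restrictScalars ℂ).smul_mem_iff hc0).1 hyp
  refine hp (eq_top_iff.2 fun z _ => ?_)
  obtain ⟨a, rfl⟩ := Submodule.Quotient.mk_surjective _ z
  rw [← smul_vermaGen]
  exact p.smul_mem a hg

lemma vermaRadical_le_vermaLower :
    (vermaRadical R κ).restrictScalars ℂ ≤ vermaLower R κ := by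
  intro x hx
  rw [Submodule.restrictScalars_mem, vermaRadical, sSup_eq_iSup'] at hx
  refine Submodule.iSup_induction (fun p : {p : Submodule (Env R) (Verma R κ) | p ≠ ⊤} => p.1)
    (motive := fun x => x ∈ vermaLower R κ) hx (fun p y hy => le_vermaLower p.2 hy)
    (zero_mem _) fun y z hy hz => add_mem hy hz

include hA hd hs in
lemma vermaGen_notMem_vermaRadical : vermaGen R κ ∉ vermaRadical R κ := by
  intro h
  have hg := vermaGen_isHighest (κ := κ) (R := R) hA hd hs
  have h1 := vermaRadical_le_vermaLower (R := R) (κ := κ) h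
  rw [vermaLower, Set.image_eq_range] at h1
  obtain ⟨w, hw⟩ := WeakRep.exists_weight_of_mem_wt
    (fun w : {w : List ι | κ - R.rootSum (content w) ≠ κ} =>
      WeakRep.fprod_mem_wt hg.mem w.1) h1 hg.mem hg.ne_zero
  exact w.2 hw

end VermaModule

/-! ### The irreducible modules -/

section Irreducible

variable (R κ) in
/-- The projection of the Verma module onto its irreducible quotient. -/
def irrMk : Verma R κ →ₗ[Env R] IrrModule R κ := (vermaRadical R κ).mkQ

variable (R κ) in
/-- The highest weight vector of the irreducible module. -/
def irrGen : IrrModule R κ := irrMk R κ (vermaGen R κ)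

lemma irrMk_surjective : Function.Surjective (irrMk R κ) := Submodule.mkQ_surjective _

lemma irrMk_eq_zero {x : Verma R κ} : irrMk R κ x = 0 ↔ x ∈ vermaRadical R κ :=
  Submodule.Quotient.mk_eq_zero _

lemma irrGen_fspan : (envRep R (IrrModule R κ)).fspan (irrGen R κ) = ⊤ := by
  rw [eq_top_iff]
  intro y _
  obtain ⟨x, rfl⟩ := irrMk_surjective y
  have hx : x ∈ (envRep R (Verma R κ)).fspan (vermaGen R κ) :=
    Submodule.eq_top_iff'.1 vermaGen_fspan x
  suffices h : (envRep R (Verma R κ)).fspan (vermaGen R κ) ≤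
      ((envRep R (IrrModule R κ)).fspan (irrGen R κ)).comap
        ((irrMk R κ).restrictScalars ℂ) from h hx
  rw [WeakRep.fspan, Submodule.span_le]
  rintro _ ⟨w, rfl⟩
  change irrMk R κ ((envRep R (Verma R κ)).fprod w (vermaGen R κ)) ∈
    (envRep R (IrrModule R κ)).fspan (irrGen R κ)
  have h := (isHom_of_linearMap (irrMk R κ)).map_fprod w (vermaGen R κ)
  rw [LinearMap.restrictScalars_apply] at h
  rw [h]
  exact WeakRep.fprod_mem_fspan w _

lemma irr_eq_bot_of_stable (p : Submodule ℂ (IrrModule R κ))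
    (hp : (envRep R (IrrModule R κ)).Stable p) (hp' : p ≠ ⊤) : p = ⊥ := by
  rw [eq_bot_iff]
  intro y hy
  obtain ⟨x, rfl⟩ := irrMk_surjective y
  rw [Submodule.mem_bot, irrMk_eq_zero]
  have hne : hp.toSubmodule.comap (irrMk R κ) ≠ ⊤ := by
    intro h
    refine hp' (eq_top_iff.2 fun z _ => ?_)
    obtain ⟨z, rfl⟩ := irrMk_surjective z
    exact (h ▸ Submodule.mem_top : z ∈ hp.toSubmodule.comap (irrMk R κ))
  exact (le_sSup hne : _ ≤ vermaRadical R κ) hy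

variable (hA : IsGCM A) (hd : ∀ i, 0 < d i) (hs : ∀ i j, d i * A i j = d j * A j i)
include hA hd hs

lemma irrGen_isHighest : (envRep R (IrrModule R κ)).IsHighest κ (irrGen R κ) where
  mem := (isHom_of_linearMap (irrMk R κ)).map_wt vermaGen_mem_wt
  e i := by
    refine ((isHom_of_linearMap (irrMk R κ)).e i (vermaGen R κ)).symm.trans ?_
    rw [vermaGen_e, map_zero]
  ne_zero h := vermaGen_notMem_vermaRadical hA hd hs (irrMk_eq_zero.1 h)

lemma irr_radTrivial : (envRep R (IrrModule R κ)).RadTrivial d :=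
  have h := irrGen_isHighest (R := R) (κ := κ) hA hd hs
  (envRep R (IrrModule R κ)).radTrivial_of_irreducible hd hs irr_eq_bot_of_stable
    (WeakRep.radF_ne_top h irrGen_fspan d) h.ne_zero h.e

lemma irr_integrable (hκ : ∀ i, ∃ n : ℕ, κ (R.coroot i) = n) :
    (envRep R (IrrModule R κ)).Integrable :=
  WeakRep.integrable_of_irreducible hA hd hs (irr_radTrivial hA hd hs) irr_eq_bot_of_stable
    (irrGen_isHighest hA hd hs) irrGen_fspan hκ

/-- The map `ψ` from the Verma module with value `u` has kernel equal to the radical. The kernel is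
proper as `u ≠ 0`. If the radical had nonzero image, this would contain `u = ψ n` with `n` in the
radical; then the generator minus `n` is in the kernel, and the generator itself would be in the
radical. -/
lemma exists_irrModule_envLinearMap [Module (Env R) M] [IsScalarTower ℂ (Env R) M] {u : M}
    (hu : (envRep R M).IsHighest κ u)
    (hirr : ∀ p, (envRep R M).Stable p → p ≤ (envRep R M).fspan u → p ≠ ⊥ → u ∈ p) :
    ∃ θ : IrrModule R κ →ₗ[Env R] M, Function.Injective θ := by
  obtain ⟨ψ, hψ⟩ := exists_verma_linearMap hu.mem hu.e
  have hle : LinearMap.ker ψ ≤ vermaRadical R κ := by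
    refine le_sSup fun h => ?_
    have : vermaGen R κ ∈ LinearMap.ker ψ := h ▸ Submodule.mem_top
    rw [LinearMap.mem_ker, hψ] at this
    exact hu.ne_zero this
  have hker : vermaRadical R κ ≤ LinearMap.ker ψ := by
    by_contra h
    obtain ⟨n, hn, hnu⟩ := hirr (((vermaRadical R κ).map ψ).restrictScalars ℂ)
      (stable_restrictScalars _) (by
        rintro _ ⟨n, -, rfl⟩
        obtain ⟨a, rfl⟩ := Submodule.Quotient.mk_surjective _ n
        rw [← smul_vermaGen, map_smul, hψ]
        exact (WeakRep.stable_fspan hu.mem hu.e).smul_mem a (WeakRep.self_mem_fspan _)) (by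
        intro h0
        refine h fun n hn => ?_
        have : ψ n ∈ ((vermaRadical R κ).map ψ).restrictScalars ℂ := ⟨n, hn, rfl⟩
        rwa [h0] at this)
    have hk : vermaGen R κ - n ∈ vermaRadical R κ :=
      hle (by rw [LinearMap.mem_ker, map_sub, hψ, hnu, sub_self])
    have := add_mem hk hn
    rw [sub_add_cancel] at this
    exact vermaGen_notMem_vermaRadical hA hd hs this
  let θ : IrrModule R κ →ₗ[Env R] M := Submodule.liftQ (vermaRadical R κ) ψ hker
  refine ⟨θ, (injective_iff_map_eq_zero θ).2 fun y hy => ?_⟩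
  obtain ⟨x, rfl⟩ := irrMk_surjective y
  rw [irrMk_eq_zero]
  exact hle hy

/-- A singular vector generating an irreducible subrepresentation gives a copy of the irreducible
module. -/
lemma exists_irrModule_linearMap {φ : KMAlgebra R →ₗ⁅ℂ⁆ Module.End ℂ M} {u : M}
    (hu : (WeakRep.ofLieHom φ).IsHighest κ u)
    (hirr : ∀ p, (WeakRep.ofLieHom φ).Stable p → p ≤ (WeakRep.ofLieHom φ).fspan u → p ≠ ⊥ →
      u ∈ p) :
    ∃ θ : IrrModule R κ →ₗ[ℂ] M, Function.Injective θ ∧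
      ∀ (x : KMAlgebra R) (m : IrrModule R κ), θ ⁅x, m⁆ = φ x (θ m) := by
  let _ := envModule φ
  let _ := envModule_isScalarTower φ
  have hφ := envModule_envAction φ
  rw [← hφ] at hu hirr
  obtain ⟨θ, hθ⟩ := exists_irrModule_envLinearMap hA hd hs hu hirr
  refine ⟨θ.restrictScalars ℂ, hθ, fun x m => ?_⟩
  exact (map_smul θ (UniversalEnvelopingAlgebra.ι ℂ x) m).trans
    (LinearMap.congr_fun (LieHom.congr_fun hφ x) (θ m))

end Irreducible

/-! ### Tensor products -/

section Tensor

variable {κ₁ κ₂ : Module.Dual ℂ H}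

lemma ofLieHom_toEnd_tensor :
    WeakRep.ofLieHom (LieModule.toEnd ℂ (KMAlgebra R) (IrrModule R κ₁ ⊗[ℂ] IrrModule R κ₂)) =
      (envRep R (IrrModule R κ₁)).tensor (envRep R (IrrModule R κ₂)) := by
  have h : ∀ x : KMAlgebra R,
      LieModule.toEnd ℂ (KMAlgebra R) (IrrModule R κ₁ ⊗[ℂ] IrrModule R κ₂) x =
        WeakRep.diagOp (envAction R (IrrModule R κ₁) x) (envAction R (IrrModule R κ₂) x) :=
    fun x => TensorProduct.ext' fun m n => by
      rw [LieModule.toEnd_apply_apply, TensorProduct.LieModule.lie_tmul_right,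
        WeakRep.diagOp_tmul]
      rfl
  exact WeakRep.ext (LinearMap.ext fun t => h _) (funext fun i => h _) (funext fun i => h _)

variable (hA : IsGCM A) (hd : ∀ i, 0 < d i) (hs : ∀ i j, d i * A i j = d j * A j i)
include hA hd hs

/-- The highest weights of the irreducible submodules of a tensor product are obtained by
subtracting sums of simple roots. -/
theorem OccursInTensor.exists_rootSum {μ : Module.Dual ℂ H} (h : OccursInTensor R κ₁ κ₂ μ) :
    ∃ β, μ = κ₁ + κ₂ - R.rootSum β := by
  obtain ⟨φ, hφ⟩ := h
  have h1 := irrGen_isHighest (R := R) (κ := κ₁) hA hd hs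
  have h2 := irrGen_isHighest (R := R) (κ := κ₂) hA hd hs
  have h3 := irrGen_isHighest (R := R) (κ := μ) hA hd hs
  refine WeakRep.tensor_boundedBy h1.mem h2.mem irrGen_fspan irrGen_fspan μ
    (φ (irrGen R μ)) ?_ ?_
  · rw [← ofLieHom_toEnd_tensor]
    intro t
    refine (φ.map_lie (gen R (.h t)) (irrGen R μ)).symm.trans ?_
    refine (congrArg φ (h3.mem t)).trans ?_
    rw [map_smul]
  · intro h0
    exact h3.ne_zero (hφ (h0.trans (map_zero φ).symm))

/-- A singular vector of an integrable tensor product gives an irreducible submodule. -/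
lemma occursInTensor_of_isHighest {μ : Module.Dual ℂ H}
    (hκ₁ : ∀ i, ∃ n : ℕ, κ₁ (R.coroot i) = n) (hκ₂ : ∀ i, ∃ n : ℕ, κ₂ (R.coroot i) = n)
    {u : IrrModule R κ₁ ⊗[ℂ] IrrModule R κ₂}
    (hu : ((envRep R (IrrModule R κ₁)).tensor (envRep R (IrrModule R κ₂))).IsHighest μ u) :
    OccursInTensor R κ₁ κ₂ μ := by
  have h1 := irrGen_isHighest (R := R) (κ := κ₁) hA hd hs
  have h2 := irrGen_isHighest (R := R) (κ := κ₂) hA hd hs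
  have hirr := fun p hp hle hp0 => WeakRep.highest_mem_of_stable (p := p) hA
    ((irr_radTrivial hA hd hs).tensor (irr_radTrivial hA hd hs)) hd hs
    (WeakRep.tensor_boundedBy h1.mem h2.mem irrGen_fspan irrGen_fspan)
    ((irr_integrable hA hd hs hκ₁).tensor (irr_integrable hA hd hs hκ₂)) hu hp hle hp0
  rw [← ofLieHom_toEnd_tensor] at hu hirr
  obtain ⟨θ, hθ, hθx⟩ := exists_irrModule_linearMap hA hd hs hu hirr
  exact ⟨{ θ with map_lie' := fun {x m} => hθx x m }, hθ⟩

/-- The components of shallow depth of a tensor product. -/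
theorem occursInTensor_of_le {a b : ι → ℕ} (ha : ∀ i, κ₁ (R.coroot i) = a i)
    (hb : ∀ i, κ₂ (R.coroot i) = b i) {β : ι → ℕ} (hβa : β ≤ a) (hβb : β ≤ b) :
    OccursInTensor R κ₁ κ₂ (κ₁ + κ₂ - R.rootSum β) := by
  obtain ⟨u, hu⟩ := WeakRep.exists_singular_tensor hA hd hs (irr_radTrivial hA hd hs)
    (irr_radTrivial hA hd hs) (irrGen_isHighest (R := R) (κ := κ₁) hA hd hs)
    (irrGen_isHighest (R := R) (κ := κ₂) hA hd hs) irrGen_fspan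
    (a := fun i => a i) (b := fun i => b i) (β := β) (fun i => by simp [ha])
    (fun i => by simp [hb]) (fun i => by exact_mod_cast hβa i) (fun i => by exact_mod_cast hβb i)
  exact occursInTensor_of_isHighest hA hd hs (fun i => ⟨_, ha i⟩) (fun i => ⟨_, hb i⟩) hu

end Tensor

end

section

/-! ### Open cones in rational vector spaces -/

section RationalSpaces

variable {W : Type*} [AddCommGroup W] [Module ℚ W] {K : Type*} [Finite K]

lemma exists_pos_add_smul {V : Submodule ℚ W} (F : K → V →ₗ[ℚ] ℚ) {p₀ : V}
    (h₀ : ∀ k, 0 < F k p₀) (p : V) : ∃ t : ℚ, 0 < t ∧ ∀ k, 0 < F k (p₀ + t • p) := by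
  have h : ∀ᶠ t : ℚ in nhdsWithin 0 (Set.Ioi 0), ∀ k, 0 < F k (p₀ + t • p) := by
    rw [Filter.eventually_all]
    intro k
    have hc : Continuous fun t : ℚ => F k p₀ + t * F k p := by fun_prop
    have := (hc.tendsto 0).eventually_const_lt (u := 0) (by simpa using h₀ k)
    filter_upwards [nhdsWithin_le_nhds this] with t ht
    simpa using ht
  obtain ⟨t, h1, h2⟩ := (h.and self_mem_nhdsWithin).exists
  exact ⟨t, h2, h1⟩

lemma hasNonemptyInteriorIn_of_functionals {S : Set W} {V : Submodule ℚ W} (F : K → V →ₗ[ℚ] ℚ)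
    {p₀ : V} (h₀ : ∀ k, 0 < F k p₀) (hS : ∀ p : V, (∀ k, 0 < F k p) → (p : W) ∈ S) :
    HasNonemptyInteriorIn S V := by
  let _ : TopologicalSpace V := moduleTopology ℚ V
  have : IsModuleTopology ℚ V := ⟨rfl⟩
  have hopen : IsOpen {p : V | ∀ k, 0 < F k p} := by
    rw [Set.ofPred_forall]
    exact isOpen_iInter_of_finite fun k =>
      isOpen_lt continuous_const (IsModuleTopology.continuous_of_linearMap (F k))
  exact ⟨p₀, interior_maximal (fun p hp => hS p hp) hopen h₀⟩

/-- An arbitrary `p` is a multiple of the difference of two points of `S`, namely `p₀ + t p` and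
`p₀` for small `t > 0`. -/
lemma le_span_of_functionals {S : Set W} {V : Submodule ℚ W} (F : K → V →ₗ[ℚ] ℚ)
    {p₀ : V} (h₀ : ∀ k, 0 < F k p₀) (hS : ∀ p : V, (∀ k, 0 < F k p) → (p : W) ∈ S) :
    V ≤ Submodule.span ℚ S := by
  intro p hp
  obtain ⟨t, ht, h⟩ := exists_pos_add_smul F h₀ ⟨p, hp⟩
  have h1 := Submodule.subset_span (R := ℚ) (hS _ h)
  have h2 := Submodule.subset_span (R := ℚ) (hS _ h₀)
  have h3 := sub_mem h1 h2
  rw [Submodule.coe_add, add_sub_cancel_left, Submodule.coe_smul] at h3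
  exact ((Submodule.span ℚ S).smul_mem_iff ht.ne').1 h3

lemma exists_linearMap_apply_eq {k U : Type*} [Field k] [AddCommGroup U] [Module k U] {ι : Type*}
    {v : ι → U} (hv : LinearIndependent k v) (c : ι → k) : ∃ f : U →ₗ[k] k, ∀ i, f (v i) = c i := by
  obtain ⟨f, hf⟩ := LinearMap.exists_extend ((Module.Basis.span hv).constr k c)
  refine ⟨f, fun i => ?_⟩
  have h := LinearMap.congr_fun hf (Module.Basis.span hv i)
  rw [Module.Basis.constr_basis, LinearMap.comp_apply, Submodule.subtype_apply,
    Module.Basis.span_apply] at h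
  exact h

/-- Serves to turn complex values known to be rational into `ℚ`-linear functionals, and complex
solutions of rational linear systems into rational ones. -/
lemma exists_rational_retraction : ∃ π : ℂ →ₗ[ℚ] ℚ, ∀ q : ℚ, π q = q := by
  obtain ⟨π, hπ⟩ := LinearMap.exists_leftInverse_of_injective (Algebra.linearMap ℚ ℂ)
    (LinearMap.ker_eq_bot.2 (algebraMap ℚ ℂ).injective)
  refine ⟨π, fun q => ?_⟩
  have := LinearMap.congr_fun hπ q
  simpa using this

end RationalSpaces

/-! ### Rational weights -/

variable {ι : Type*} {A : Matrix ι ι ℤ} {H : Type*} [AddCommGroup H] [Module ℂ H]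

lemma rat_smul_apply (q : ℚ) (wt : Module.Dual ℂ H) (x : H) : (q • wt) x = (q : ℂ) * wt x := by
  rw [LinearMap.smul_apply, Rat.smul_def]

lemma linearIndependent_rat {κ : Type*} {v : κ → Module.Dual ℂ H}
    (hv : LinearIndependent ℂ v) : LinearIndependent ℚ v :=
  hv.restrict_scalars (by
    intro p q h
    simp only [Rat.smul_def, mul_one] at h
    exact_mod_cast h)

variable [Fintype ι] {R : Realization A H} (Z : IntegralForm R)

lemma rootSum_mem_span (β : ι → ℕ) :
    R.rootSum β ∈ Submodule.span ℚ R.simpleRoots := by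
  refine Submodule.sum_mem _ fun i _ => ?_
  have : (β i : ℂ) • R.root i = (β i : ℚ) • R.root i := by
    rw [Nat.cast_smul_eq_nsmul, Nat.cast_smul_eq_nsmul]
  rw [this]
  exact Submodule.smul_mem _ _ (Submodule.subset_span ⟨i, rfl⟩)

lemma root_mem_weightLattice (i : ι) : R.root i ∈ weightLattice Z := Z.root_integral i

lemma span_simpleRoots_le : Submodule.span ℚ R.simpleRoots ≤ rationalWeights Z := by
  refine Submodule.span_mono ?_
  rintro _ ⟨i, rfl⟩
  exact root_mem_weightLattice Z i

lemma finrank_span_simpleRoots :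
    Module.finrank ℚ (Submodule.span ℚ R.simpleRoots) = R.simpleRoots.ncard := by
  rw [Realization.simpleRoots, finrank_span_eq_card (linearIndependent_rat R.linearIndependent_root),
    ← Nat.card_coe_set_eq, Nat.card_range_of_injective R.linearIndependent_root.injective,
    Nat.card_eq_fintype_card]

/-- A rational weight has a positive integral multiple in the weight lattice. -/
lemma exists_nsmul_mem_weightLattice {wt : Module.Dual ℂ H} (h : wt ∈ rationalWeights Z) :
    ∃ N : ℕ, 1 ≤ N ∧ N • wt ∈ weightLattice Z := by
  induction h using Submodule.span_induction with
  | mem x hx => exact ⟨1, le_rfl, by rwa [one_smul]⟩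
  | zero => exact ⟨1, le_rfl, by rw [smul_zero]; exact zero_mem _⟩
  | add x y _ _ hx hy =>
    obtain ⟨a, ha, hx⟩ := hx
    obtain ⟨b, hb, hy⟩ := hy
    refine ⟨a * b, Nat.mul_pos ha hb, ?_⟩
    have : (a * b) • (x + y) = b • a • x + a • b • y := by
      rw [smul_add, smul_smul, smul_smul, mul_comm b a]
    rw [this]
    exact add_mem (nsmul_mem hx b) (nsmul_mem hy a)
  | smul q x _ hx =>
    obtain ⟨a, ha, hx⟩ := hx
    refine ⟨a * q.den, Nat.mul_pos ha q.den_pos, ?_⟩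
    have : (a * q.den) • q • x = q.num • a • x := by
      rw [← Nat.cast_smul_eq_nsmul ℚ, ← Nat.cast_smul_eq_nsmul ℚ a, ← Int.cast_smul_eq_zsmul ℚ,
        smul_smul, smul_smul]
      congr 1
      push_cast
      rw [mul_assoc, Rat.den_mul_eq_num, mul_comm]
    rw [this]
    exact zsmul_mem hx _

lemma exists_rat_apply_coroot {wt : Module.Dual ℂ H} (h : wt ∈ rationalWeights Z) (i : ι) :
    ∃ q : ℚ, wt (R.coroot i) = q := by
  obtain ⟨N, hN, h⟩ := exists_nsmul_mem_weightLattice Z h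
  obtain ⟨m, hm⟩ := h _ (Z.coroot_mem i)
  refine ⟨m / N, ?_⟩
  have hN' : (N : ℂ) ≠ 0 := by exact_mod_cast Nat.one_le_iff_ne_zero.1 hN
  rw [LinearMap.smul_apply, nsmul_eq_mul] at hm
  push_cast
  rw [eq_div_iff hN', mul_comm, hm]

/-- The values on the simple coroots as rational functionals. -/
lemma exists_coroot_functional : ∃ ev : ι → rationalWeights Z →ₗ[ℚ] ℚ,
    ∀ i (wt : rationalWeights Z), (wt : Module.Dual ℂ H) (R.coroot i) = ev i wt := by
  obtain ⟨π, hπ⟩ := exists_rational_retraction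
  refine ⟨fun i =>
    { toFun := fun wt => π ((wt : Module.Dual ℂ H) (R.coroot i))
      map_add' := fun a b => by simp
      map_smul' := fun q a => by
        rw [Submodule.coe_smul, LinearMap.smul_apply, map_smul, RingHom.id_apply] }, ?_⟩
  intro i wt
  obtain ⟨q, hq⟩ := exists_rat_apply_coroot Z wt.2 i
  change _ = ((π _ : ℚ) : ℂ)
  rw [hq, hπ]

/-! ### Dimension of the space of rational weights, and a weight with value one on all coroots. -/

section Basis

variable {Z} {b : Module.Basis (Fin (Module.finrank ℂ H)) ℂ H}
  (hb : Z.lattice = Submodule.span ℤ (Set.range b))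
include hb

lemma coord_mem_weightLattice (k : Fin (Module.finrank ℂ H)) : b.coord k ∈ weightLattice Z := by
  intro x hx
  rw [hb] at hx
  induction hx using Submodule.span_induction with
  | mem x hx =>
    obtain ⟨j, rfl⟩ := hx
    refine ⟨if j = k then 1 else 0, ?_⟩
    rw [Module.Basis.coord_apply, Module.Basis.repr_self, Finsupp.single_apply]
    split_ifs <;> simp
  | zero => exact ⟨0, by simp⟩
  | add x y _ _ hx hy =>
    obtain ⟨m, hm⟩ := hx
    obtain ⟨n, hn⟩ := hy
    exact ⟨m + n, by rw [map_add, hm, hn, Int.cast_add]⟩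
  | smul c x _ hx =>
    obtain ⟨m, hm⟩ := hx
    exact ⟨c * m, by rw [map_zsmul, hm, zsmul_eq_mul, Int.cast_mul]⟩

lemma rationalWeights_eq_span : rationalWeights Z = Submodule.span ℚ (Set.range b.coord) := by
  refine le_antisymm ?_ ?_
  · rw [rationalWeights, Submodule.span_le]
    intro wt hwt
    have h : wt = ∑ k, wt (b k) • b.coord k := by
      refine b.ext fun j => ?_
      simp
    rw [h]
    refine Submodule.sum_mem _ fun k _ => ?_
    obtain ⟨m, hm⟩ := hwt (b k) (hb ▸ Submodule.subset_span ⟨k, rfl⟩)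
    have : (m : ℂ) • b.coord k = (m : ℚ) • b.coord k := by
      rw [Int.cast_smul_eq_zsmul, Int.cast_smul_eq_zsmul]
    rw [hm, this]
    exact Submodule.smul_mem _ _ (Submodule.subset_span ⟨k, rfl⟩)
  · refine Submodule.span_mono ?_
    rintro _ ⟨k, rfl⟩
    exact coord_mem_weightLattice hb k

omit hb in
variable (Z) in
lemma finrank_rationalWeights [FiniteDimensional ℂ H] :
    Module.finrank ℚ (rationalWeights Z) = Module.finrank ℂ H := by
  obtain ⟨b, hb⟩ := Z.exists_basis
  have hli : LinearIndependent ℚ b.coord := by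
    refine linearIndependent_rat (H := H) ?_
    rw [← b.coe_dualBasis]
    exact b.dualBasis.linearIndependent
  rw [rationalWeights_eq_span hb, finrank_span_eq_card hli, Fintype.card_fin]

omit hb in
variable (Z) in
lemma finiteDimensional_rationalWeights : FiniteDimensional ℚ (rationalWeights Z) := by
  obtain ⟨b, hb⟩ := Z.exists_basis
  rw [rationalWeights_eq_span hb]
  exact FiniteDimensional.span_of_finite ℚ (Set.finite_range _)

omit hb in
variable (Z) in
/-- There is a rational weight with value one on all simple coroots. -/
lemma exists_rationalWeight_one :
    ∃ wt ∈ rationalWeights Z, ∀ i, wt (R.coroot i) = 1 := by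
  obtain ⟨b, hb⟩ := Z.exists_basis
  obtain ⟨f, hf⟩ := exists_linearMap_apply_eq R.linearIndependent_coroot (fun _ => 1)
  obtain ⟨π, hπ⟩ := exists_rational_retraction
  -- The complex form `f` takes the value one on all coroots. Since coroots have integral
  -- coordinates in `b`, these equations persist when `π` is applied to the values of `f` on the
  -- basis.
  refine ⟨∑ k, π (f (b k)) • b.coord k, Submodule.sum_mem _ fun k _ => Submodule.smul_mem _ _
    (Submodule.subset_span (coord_mem_weightLattice hb k)), fun i => ?_⟩
  have hm : ∀ k, ∃ m : ℤ, b.coord k (R.coroot i) = m := fun k =>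
    coord_mem_weightLattice hb k _ (Z.coroot_mem i)
  choose m hm using hm
  have h1 : ∑ k, (m k : ℂ) * f (b k) = 1 := by
    rw [← hf i]
    conv_rhs => rw [← b.sum_repr (R.coroot i)]
    rw [map_sum]
    refine Finset.sum_congr rfl fun k _ => ?_
    rw [map_smul, smul_eq_mul, ← hm k]
    rfl
  have h2 : ∑ k, (m k : ℚ) * π (f (b k)) = 1 := by
    have h3 := congrArg π h1
    have h4 : π 1 = 1 := by simpa using hπ 1
    rw [h4, map_sum] at h3
    rw [← h3]
    refine Finset.sum_congr rfl fun k _ => ?_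
    rw [← zsmul_eq_mul, ← zsmul_eq_mul, map_zsmul]
  simp only [LinearMap.sum_apply, rat_smul_apply, hm]
  have h5 : ((∑ k, (m k : ℚ) * π (f (b k)) : ℚ) : ℂ) = 1 := by rw [h2]; simp
  rw [← h5]
  push_cast
  exact Finset.sum_congr rfl fun k _ => mul_comm _ _

end Basis

/-! ### The space `E` -/

lemma mem_spanE {p : Triple Z} : p ∈ spanE Z ↔ (p.1 : Module.Dual ℂ H) + (p.2.1 : Module.Dual ℂ H) -
    (p.2.2 : Module.Dual ℂ H) ∈ Submodule.span ℚ R.simpleRoots := Iff.rfl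

/-- The difference `λ₁ + λ₂ - μ`. -/
def spanEDiff : spanE Z →ₗ[ℚ] Submodule.span ℚ R.simpleRoots where
  toFun p := ⟨_, p.2⟩
  map_add' p q := Subtype.ext (by simp; abel)
  map_smul' c p := Subtype.ext (by simp [smul_sub])

/-- The space `E` in the coordinates `λ₁`, `λ₂`, `λ₁ + λ₂ - μ`. -/
def spanEEquiv : spanE Z ≃ₗ[ℚ]
    rationalWeights Z × rationalWeights Z × Submodule.span ℚ R.simpleRoots :=
  LinearEquiv.ofBijective
    (((LinearMap.fst ℚ _ _).comp (spanE Z).subtype).prod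
      (((LinearMap.fst ℚ _ _).comp ((LinearMap.snd ℚ _ _).comp (spanE Z).subtype)).prod
        (spanEDiff Z))) (by
    constructor
    · rintro ⟨⟨a, b, c⟩, hp⟩ ⟨⟨a', b', c'⟩, hp'⟩ h
      have h1 : a = a' := congrArg Prod.fst h
      have h2 : b = b' := congrArg (fun x => x.2.1) h
      have h3 : (a : Module.Dual ℂ H) + b - c = a' + b' - c' :=
        congrArg (fun x => (x.2.2 : Module.Dual ℂ H)) h
      subst h1 h2
      have h4 : c = c' := Subtype.ext (sub_right_injective h3)
      subst h4
      rfl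
    · rintro ⟨a, b, c⟩
      refine ⟨⟨(a, b, a + b - ⟨c, span_simpleRoots_le Z c.2⟩), ?_⟩, ?_⟩
      · rw [mem_spanE]
        simp
      · refine Prod.ext rfl (Prod.ext rfl (Subtype.ext ?_))
        change (a : Module.Dual ℂ H) + b - (a + b - c) = c
        abel)

lemma finrank_spanE [FiniteDimensional ℂ H] :
    Module.finrank ℚ (spanE Z) = 2 * Module.finrank ℂ H + R.simpleRoots.ncard := by
  have := finiteDimensional_rationalWeights Z
  have : FiniteDimensional ℚ (Submodule.span ℚ R.simpleRoots) :=
    FiniteDimensional.span_of_finite ℚ (Set.finite_range _)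
  rw [(spanEEquiv Z).finrank_eq, Module.finrank_prod, Module.finrank_prod,
    finrank_rationalWeights, finrank_span_simpleRoots]
  ring

/-- The coordinates of `λ₁ + λ₂ - μ` in the basis of simple roots. -/
lemma exists_root_functional : ∃ n : ι → spanE Z →ₗ[ℚ] ℚ, ∀ p : spanE Z,
    (p.1.1 : Module.Dual ℂ H) + p.1.2.1 - p.1.2.2 = ∑ i, n i p • R.root i := by
  let B := Module.Basis.span (linearIndependent_rat (H := H) R.linearIndependent_root)
  refine ⟨fun i => (B.coord i).comp (spanEDiff Z), fun p => ?_⟩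
  have h := congrArg Subtype.val (B.sum_repr (spanEDiff Z p))
  rw [Submodule.coe_sum] at h
  refine h.symm.trans (Finset.sum_congr rfl fun i _ => ?_)
  rw [Submodule.coe_smul, Module.Basis.span_apply]
  rfl

end

section

variable {ι : Type*} [Fintype ι] [DecidableEq ι] {A : Matrix ι ι ℤ} {H : Type*} [AddCommGroup H]
  [Module ℂ H] {R : Realization A H} (Z : IntegralForm R)

/-! ### The tensor cone -/

lemma IsSymmetrizable.exists_real (h : IsSymmetrizable A) :
    ∃ d : ι → ℝ, (∀ i, 0 < d i) ∧ ∀ i j, d i * A i j = d j * A j i := by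
  obtain ⟨d, hd, hs⟩ := h
  refine ⟨fun i => d i, fun i => Rat.cast_pos.2 (hd i), fun i j => ?_⟩
  have h := hs.apply i j
  simp only [Matrix.diagonal_mul, Matrix.map_apply] at h
  change (d i : ℝ) * A i j = d j * A j i
  exact_mod_cast h.symm

lemma tensorCone_subset_spanE (hA : IsGCM A) (hsymm : IsSymmetrizable A) :
    tensorCone Z ⊆ (spanE Z : Set (Triple Z)) := by
  rintro p ⟨-, -, -, N, hN, -, -, -, hocc⟩
  obtain ⟨d, hd, hs⟩ := hsymm.exists_real
  obtain ⟨β, hβ⟩ := OccursInTensor.exists_rootSum hA hd hs hocc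
  rw [SetLike.mem_coe, mem_spanE]
  have hN' : (N : ℚ) ≠ 0 := by exact_mod_cast Nat.one_le_iff_ne_zero.1 hN
  refine ((Submodule.span ℚ R.simpleRoots).smul_mem_iff hN').1 ?_
  have h : (N : ℚ) • ((p.1 : Module.Dual ℂ H) + p.2.1 - p.2.2) = R.rootSum β := by
    rw [Nat.cast_smul_eq_nsmul, smul_sub, smul_add, hβ]
    abel
  rw [h]
  exact rootSum_mem_span β

lemma mem_dominantIntegral {wt : Module.Dual ℂ H} (h : wt ∈ weightLattice Z)
    (hdom : ∀ i, ∃ q : ℚ, 0 ≤ q ∧ wt (R.coroot i) = q) : wt ∈ dominantIntegral Z :=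
  ⟨h, Submodule.subset_span h, hdom⟩

/-- A nonnegative rational value of an integral weight on a coroot is a natural number. -/
lemma exists_nat_apply_coroot {wt : Module.Dual ℂ H} (h : wt ∈ weightLattice Z) {i : ι} {q : ℚ}
    (hq : 0 ≤ q) (hwt : wt (R.coroot i) = q) : ∃ n : ℕ, (n : ℚ) = q := by
  obtain ⟨m, hm⟩ := h _ (Z.coroot_mem i)
  have h1 : (m : ℚ) = q := by exact_mod_cast hm.symm.trans hwt
  have h2 : 0 ≤ m := by
    rw [← h1] at hq
    exact_mod_cast hq
  lift m to ℕ using h2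
  exact ⟨m, by exact_mod_cast h1⟩

lemma exists_common_multiple {V : Type*} [AddCommGroup V] (L : AddSubgroup V) {κ : Type*}
    (s : Finset κ) (x : κ → V) (h : ∀ k ∈ s, ∃ N : ℕ, 1 ≤ N ∧ N • x k ∈ L) :
    ∃ N : ℕ, 1 ≤ N ∧ ∀ k ∈ s, N • x k ∈ L := by
  classical
  induction s using Finset.induction_on with
  | empty => exact ⟨1, le_rfl, by simp⟩
  | insert k s _ ih =>
    obtain ⟨a, ha, hka⟩ := h k (Finset.mem_insert_self k s)
    obtain ⟨b, hb, hsb⟩ := ih fun j hj => h j (Finset.mem_insert_of_mem hj)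
    refine ⟨a * b, Nat.mul_pos ha hb, fun j hj => ?_⟩
    rcases Finset.mem_insert.1 hj with rfl | hj
    · rw [mul_comm, mul_smul]
      exact nsmul_mem hka b
    · rw [mul_smul]
      exact nsmul_mem (hsb j hj) a

/-- A rational number has a positive integral multiple that is an integer. -/
lemma exists_nsmul_mem_range_cast (q : ℚ) :
    ∃ N : ℕ, 1 ≤ N ∧ N • q ∈ (Int.castAddHom ℚ).range :=
  ⟨q.den, q.den_pos, q.num, by simp [Rat.den_mul_eq_num]⟩

lemma mem_rationalDominant_of_nsmul {wt : Module.Dual ℂ H} (hwt : wt ∈ rationalWeights Z) {N : ℕ}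
    (hN : 1 ≤ N) (h : ∀ i, ∃ q : ℚ, 0 ≤ q ∧ (N • wt) (R.coroot i) = q) :
    wt ∈ rationalDominant Z := by
  refine ⟨hwt, fun i => ?_⟩
  obtain ⟨q, hq, h⟩ := h i
  have hN' : (N : ℂ) ≠ 0 := by exact_mod_cast Nat.one_le_iff_ne_zero.1 hN
  refine ⟨q / N, by positivity, ?_⟩
  rw [LinearMap.smul_apply, nsmul_eq_mul] at h
  push_cast
  rw [eq_div_iff hN', mul_comm, h]

/-- Triples of rational weights for which `λ₁ + λ₂ - μ` is small with respect to `λ₁` and `λ₂`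
are in the tensor cone. -/
lemma mem_tensorCone_of_lt (hA : IsGCM A) (hsymm : IsSymmetrizable A) {p : Triple Z} {n a b : ι → ℚ}
    (ha : ∀ i, (p.1 : Module.Dual ℂ H) (R.coroot i) = a i)
    (hb : ∀ i, (p.2.1 : Module.Dual ℂ H) (R.coroot i) = b i)
    (hn : (p.1 : Module.Dual ℂ H) + p.2.1 - p.2.2 = ∑ i, n i • R.root i)
    (h0 : ∀ i, 0 ≤ n i) (hna : ∀ i, n i ≤ a i) (hnb : ∀ i, n i ≤ b i) : p ∈ tensorCone Z := by
  obtain ⟨d, hd, hs⟩ := hsymm.exists_real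
  obtain ⟨N₁, hN₁, h1⟩ := exists_nsmul_mem_weightLattice Z p.1.2
  obtain ⟨N₂, hN₂, h2⟩ := exists_nsmul_mem_weightLattice Z p.2.1.2
  obtain ⟨N₃, hN₃, h3⟩ := exists_common_multiple (Int.castAddHom ℚ).range Finset.univ n
    (fun i _ => exists_nsmul_mem_range_cast (n i))
  -- One factor each clears the denominators of `λ₁`, of `λ₂` and of the root coordinates `n`;
  -- integrality of `N μ` then follows.
  set N := N₁ * N₂ * N₃ with hNdef
  have hN : 1 ≤ N := Nat.mul_pos (Nat.mul_pos hN₁ hN₂) hN₃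
  have hN0 : (0 : ℚ) ≤ N := Nat.cast_nonneg _
  have hL₁ : N • (p.1 : Module.Dual ℂ H) ∈ weightLattice Z := by
    have : N = N₂ * N₃ * N₁ := by ring
    rw [this, mul_smul]
    exact nsmul_mem h1 _
  have hL₂ : N • (p.2.1 : Module.Dual ℂ H) ∈ weightLattice Z := by
    have : N = N₁ * N₃ * N₂ := by ring
    rw [this, mul_smul]
    exact nsmul_mem h2 _
  have hval : ∀ (wt : Module.Dual ℂ H) (c : ι → ℚ) i, wt (R.coroot i) = c i →
      (N • wt) (R.coroot i) = ((N * c i : ℚ) : ℂ) := by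
    intro wt c i h
    rw [LinearMap.smul_apply, h, nsmul_eq_mul]
    push_cast
    rfl
  have hβ : ∀ i, ∃ k : ℕ, (k : ℚ) = N * n i := by
    intro i
    obtain ⟨z, hz⟩ := h3 i (Finset.mem_univ i)
    have hz' : ((N₁ * N₂ * z : ℤ) : ℚ) = N * n i := by
      have hz : (z : ℚ) = N₃ * n i := by simpa using hz
      rw [hNdef]
      push_cast
      rw [hz]
      ring
    have h4 : 0 ≤ (N₁ * N₂ * z : ℤ) := by
      have : (0 : ℚ) ≤ N * n i := mul_nonneg hN0 (h0 i)
      rw [← hz'] at this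
      exact_mod_cast this
    obtain ⟨k, hk⟩ := Int.eq_ofNat_of_zero_le h4
    refine ⟨k, ?_⟩
    rw [← hz', hk]
    simp
  have ha' : ∀ i, ∃ k : ℕ, (k : ℚ) = N * a i := fun i =>
    exists_nat_apply_coroot Z hL₁ (mul_nonneg hN0 ((h0 i).trans (hna i))) (hval _ _ i (ha i))
  have hb' : ∀ i, ∃ k : ℕ, (k : ℚ) = N * b i := fun i =>
    exists_nat_apply_coroot Z hL₂ (mul_nonneg hN0 ((h0 i).trans (hnb i))) (hval _ _ i (hb i))
  choose β hβ using hβ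
  choose a' ha' using ha'
  choose b' hb' using hb'
  have hva : ∀ i, (N • (p.1 : Module.Dual ℂ H)) (R.coroot i) = (a' i : ℂ) := fun i => by
    rw [hval _ _ i (ha i), ← ha', Rat.cast_natCast]
  have hvb : ∀ i, (N • (p.2.1 : Module.Dual ℂ H)) (R.coroot i) = (b' i : ℂ) := fun i => by
    rw [hval _ _ i (hb i), ← hb', Rat.cast_natCast]
  have hβa : β ≤ a' := fun i => by
    have : (β i : ℚ) ≤ a' i := by
      rw [hβ, ha']
      exact mul_le_mul_of_nonneg_left (hna i) hN0
    exact_mod_cast this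
  have hβb : β ≤ b' := fun i => by
    have : (β i : ℚ) ≤ b' i := by
      rw [hβ, hb']
      exact mul_le_mul_of_nonneg_left (hnb i) hN0
    exact_mod_cast this
  have hμ : N • (p.2.2 : Module.Dual ℂ H) =
      N • (p.1 : Module.Dual ℂ H) + N • (p.2.1 : Module.Dual ℂ H) - R.rootSum β := by
    have h5 : R.rootSum β = N • ((p.1 : Module.Dual ℂ H) + p.2.1 - p.2.2) := by
      rw [hn, Realization.rootSum, Finset.smul_sum]
      refine Finset.sum_congr rfl fun i _ => ?_
      rw [← Nat.cast_smul_eq_nsmul ℚ, smul_smul, ← hβ, Nat.cast_smul_eq_nsmul,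
        Nat.cast_smul_eq_nsmul]
    rw [h5, smul_sub, smul_add]
    abel
  have hL₃ : N • (p.2.2 : Module.Dual ℂ H) ∈ weightLattice Z := by
    rw [hμ]
    refine sub_mem (add_mem hL₁ hL₂) (sum_mem fun i _ => ?_)
    rw [Nat.cast_smul_eq_nsmul]
    exact nsmul_mem (root_mem_weightLattice Z i) _
  have hdom₁ : ∀ i, ∃ q : ℚ, 0 ≤ q ∧ (N • (p.1 : Module.Dual ℂ H)) (R.coroot i) = q := fun i =>
    ⟨a' i, Nat.cast_nonneg _, by rw [hva, Rat.cast_natCast]⟩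
  have hdom₂ : ∀ i, ∃ q : ℚ, 0 ≤ q ∧ (N • (p.2.1 : Module.Dual ℂ H)) (R.coroot i) = q := fun i =>
    ⟨b' i, Nat.cast_nonneg _, by rw [hvb, Rat.cast_natCast]⟩
  have hdom₃ : ∀ i, ∃ q : ℚ, 0 ≤ q ∧ (N • (p.2.2 : Module.Dual ℂ H)) (R.coroot i) = q := by
    intro i
    -- Dominance of `N μ` is automatic: `(Aβ)_i ≤ 2 β_i ≤ a'_i + b'_i`.
    refine ⟨a' i + b' i - ∑ j, (β j : ℚ) * A i j, ?_, ?_⟩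
    · have h6 : ∑ j, (β j : ℚ) * A i j ≤ 2 * β i := by exact_mod_cast sum_mul_gcm_le hA β i
      have h7 : (β i : ℚ) ≤ a' i := by exact_mod_cast hβa i
      have h8 : (β i : ℚ) ≤ b' i := by exact_mod_cast hβb i
      linarith
    · rw [hμ, LinearMap.sub_apply, LinearMap.add_apply, hva, hvb, R.rootSum_coroot]
      push_cast
      rfl
  refine ⟨mem_rationalDominant_of_nsmul Z p.1.2 hN hdom₁,
    mem_rationalDominant_of_nsmul Z p.2.1.2 hN hdom₂,
    mem_rationalDominant_of_nsmul Z p.2.2.2 hN hdom₃, N, hN, mem_dominantIntegral Z hL₁ hdom₁,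
    mem_dominantIntegral Z hL₂ hdom₂, mem_dominantIntegral Z hL₃ hdom₃, ?_⟩
  rw [hμ]
  exact occursInTensor_of_le hA hd hs hva hvb hβa hβb

/-- The tensor cone contains the points of `E` at which finitely many functionals, which are
simultaneously positive somewhere, are positive. -/
lemma exists_functionals (hA : IsGCM A) (hsymm : IsSymmetrizable A) :
    ∃ (F : ι ⊕ ι ⊕ ι → spanE Z →ₗ[ℚ] ℚ) (p₀ : spanE Z), (∀ k, 0 < F k p₀) ∧
      ∀ p : spanE Z, (∀ k, 0 < F k p) → (p : Triple Z) ∈ tensorCone Z := by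
  obtain ⟨ev, hev⟩ := exists_coroot_functional Z
  obtain ⟨n, hn⟩ := exists_root_functional Z
  obtain ⟨wt, hwt, hwt1⟩ := exists_rationalWeight_one Z
  let ev₁ : ι → spanE Z →ₗ[ℚ] ℚ := fun i =>
    (ev i).comp ((LinearMap.fst ℚ _ _).comp (spanE Z).subtype)
  let ev₂ : ι → spanE Z →ₗ[ℚ] ℚ := fun i =>
    (ev i).comp ((LinearMap.fst ℚ _ _).comp ((LinearMap.snd ℚ _ _).comp (spanE Z).subtype))
  let w : rationalWeights Z := ⟨wt, hwt⟩
  let r : rationalWeights Z := ∑ i, ⟨R.root i, Submodule.subset_span (root_mem_weightLattice Z i)⟩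
  have hr : (r : Module.Dual ℂ H) = ∑ i, R.root i := by simp [r]
  have hw : ∀ i, ev i w = 1 := fun i => by
    have := (hev i w).symm.trans (hwt1 i)
    exact_mod_cast this
  -- At this point all root coordinates of `λ₁ + λ₂ - μ` are `1` and all coroot values of `λ₁`, `λ₂`
  -- are `2`, so `0 < n_i < a_i` and `n_i < b_i` hold strictly.
  let p₀ : spanE Z := ⟨((2 : ℚ) • w, (2 : ℚ) • w, (4 : ℚ) • w - r), by
    rw [mem_spanE]
    have h : (((2 : ℚ) • w : rationalWeights Z) : Module.Dual ℂ H) +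
        (((2 : ℚ) • w : rationalWeights Z) : Module.Dual ℂ H) -
        (((4 : ℚ) • w - r : rationalWeights Z) : Module.Dual ℂ H) = ∑ i, R.root i := by
      rw [Submodule.coe_sub, hr, Submodule.coe_smul, Submodule.coe_smul]
      module
    rw [h]
    exact sum_mem fun i _ => Submodule.subset_span ⟨i, rfl⟩⟩
  have hn₀ : ∀ i, n i p₀ = 1 := by
    have h1 := hn p₀
    have h2 : (p₀.1.1 : Module.Dual ℂ H) + p₀.1.2.1 - p₀.1.2.2 = ∑ i, (1 : ℚ) • R.root i := by
      simp only [p₀, one_smul]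
      rw [Submodule.coe_sub, hr, Submodule.coe_smul, Submodule.coe_smul]
      module
    have h3 : ∑ i, (n i p₀ - 1) • R.root i = 0 := by
      simp only [sub_smul, Finset.sum_sub_distrib]
      rw [← h1, h2, sub_self]
    intro i
    exact sub_eq_zero.1 (Fintype.linearIndependent_iff.1
      (linearIndependent_rat (H := H) R.linearIndependent_root) _ h3 i)
  have he₁ : ∀ i, ev₁ i p₀ = 2 := fun i => by
    change ev i ((2 : ℚ) • w) = 2
    rw [map_smul, hw]
    norm_num
  have he₂ : ∀ i, ev₂ i p₀ = 2 := he₁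
  refine ⟨Sum.elim n (Sum.elim (fun i => ev₁ i - n i) fun i => ev₂ i - n i), p₀, ?_, ?_⟩
  · rintro (i | i | i)
    · simp [hn₀]
    · simp [hn₀, he₁]
    · simp [hn₀, he₂]
  · intro p hp
    refine mem_tensorCone_of_lt Z hA hsymm (fun i => hev i p.1.1) (fun i => hev i p.1.2.1) (hn p)
      (fun i => (hp (Sum.inl i)).le) (fun i => ?_) fun i => ?_
    · have := hp (Sum.inr (Sum.inl i))
      exact (sub_pos.1 this).le
    · have := hp (Sum.inr (Sum.inr i))
      exact (sub_pos.1 this).le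

lemma span_tensorCone (hA : IsGCM A) (hsymm : IsSymmetrizable A) :
    Submodule.span ℚ (tensorCone Z) = spanE Z := by
  obtain ⟨F, p₀, h₀, hF⟩ := exists_functionals Z hA hsymm
  exact le_antisymm (Submodule.span_le.2 (tensorCone_subset_spanE Z hA hsymm))
    (le_span_of_functionals F h₀ hF)

end

end

end KacMoody

theorem mainTheorem4 (l : ℕ) (A : Matrix (Fin (l + 1)) (Fin (l + 1)) ℤ)
    (hA : KacMoody.IsGCM A) (hsymm : KacMoody.IsSymmetrizable A)
    (hirr : KacMoody.IsIndecomposable A)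
    {H : Type*} [AddCommGroup H] [Module ℂ H] [FiniteDimensional ℂ H]
    (R : KacMoody.Realization A H) (Z : KacMoody.IntegralForm R) :
    KacMoody.tensorCone Z ⊆ (KacMoody.spanE Z : Set (KacMoody.Triple Z)) ∧
    KacMoody.HasNonemptyInteriorIn (KacMoody.tensorCone Z) (KacMoody.spanE Z) ∧
    Module.finrank ℚ (KacMoody.spanE Z) =
      2 * Module.finrank ℂ H + R.simpleRoots.ncard ∧
    Submodule.span ℚ (KacMoody.tensorCone Z) = KacMoody.spanE Z ∧
    Module.finrank ℚ (Submodule.span ℚ (KacMoody.tensorCone Z)) =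
      2 * Module.finrank ℂ H + R.simpleRoots.ncard := by
  obtain ⟨F, p₀, h₀, hF⟩ := KacMoody.exists_functionals Z hA hsymm
  refine ⟨KacMoody.tensorCone_subset_spanE Z hA hsymm,
    KacMoody.hasNonemptyInteriorIn_of_functionals F h₀ hF, KacMoody.finrank_spanE Z,
    KacMoody.span_tensorCone Z hA hsymm, ?_⟩
  rw [KacMoody.span_tensorCone Z hA hsymm]
  exact KacMoody.finrank_spanE Z
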